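/- Let $K$ be a field of characteristic $0$. A hyperexponential term is an element $h\neq0$ of a differential field extension of $K(x,y)$ (with commuting derivations $D_x,D_y$) of the form $h=c_0\exp(a/b)\prod_{\ell=1}^L c_\ell^{e_\ell}$ with $a\in K[x,y]$, $b,c_0,\dots,c_L\in K[x,y]\setminus\{0\}$, $e_\ell\in K\setminus\{0\}$ (meaning that $D h/h=Dc_0/c_0+D(a/b)+\sum_\ell e_\ell\,Dc_\ell/c_\ell$ for $D\in\{D_x,D_y\}$), where $\max\{\deg_x a,\deg_x b\}+\sum_\ell\deg_x c_\ell$ and $\max\{\deg_y a,\deg_y b\}+\sum_\ell\deg_y c_\ell$ are nonzero. A creative telescoping relation of order $r$ for $h$ is an equation $p_0h+p_1D_xh+\cdots+p_rD_x^rh=D_yQ$ with $p_0,\dots,p_r\in K[x]$, $p_r\neq0$, and $Q$ zero or hyperexponential. Let $b^*$ be the square free part of $b$ and put $$\alpha=\deg_x b^*+\deg_x b+\sum_\ell\deg_x c_\ell,\quad \beta=\deg_x a-\deg_x b-1,\quad \gamma=\deg_y b^*+\max\{\deg_y a,\deg_y b\}+\sum_\ell\deg_y c_\ell,$$ $$\tau=\max\{\alpha,\gamma,\deg_x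 c_0,\deg_y c_0\}.$$ Let $\phi_3=1$ if $a/b\in K(x)$, $e_\ell\in\mathbb Z$ for all $\ell$ with $\deg_y c_\ell\neq0$, and $\deg_y c_0\ge\sum_\ell e_\ell\deg_y c_\ell$; otherwise let $\phi_3=0$. Call the term normalized if the $c_\ell$ ($\ell\ge1$) are square free and pairwise coprime and no $e_\ell$ is in $\mathbb N$. Computations are carried out by arithmetic computation trees over $K$ (one tree for each $L$, each choice of the degrees in $x$ and $y$ of $a,b,c_0,\dots,c_L$, and each order $r$), whose inputs are the coefficients of $a,b,c_0,\dots,c_L$ and the $e_\ell$; every arithmetic operation and every zero test in $K$ counts as one operation. To compute a relation means to compute $p_0,\dots,p_r$ and $f,g\in K[x,y]$ with $Q=(f/g)h$. Let $\kappa:\mathbb N\to\mathbb R$ be increasing and sublinear ($\kappa(t)/t$ is nonincreasing for large $t$) such that for all $n,m\ge1$ a nonzero solution of degree at most $n$ of a homogeneous linear system over $K(x)$ with $m$ variables and at most $m$ equations, with polynomial coefficients of degree at most $n$, can be computed, whenever there is one, with $n m^3\kappa(\max\{n,m\})$ operations in $K$. The implied constants below depend only on $K$, $\kappa$, an upper bound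 for $\beta$, and, in (2), on the bound $c$. 1. If $r=\tau-1+\phi_3$, and if the term is normalized in case $\phi_3=0$, then a creative telescoping relation of order $r$ for $h$ can be computed using $$2\kappa(2\tau^3)\tau^9+\mathrm O\bigl((1+\kappa(2\tau^3))\tau^8\bigr)$$ operations in $K$. 2. For every $c$, if $\bigl|r-\tfrac14(1+\sqrt{17})\tau\bigr|\le c$ and $\tau$ is sufficiently large (depending on the same data as the implied constant), then a creative telescoping relation of order $r$ for $h$ can be computed using $$\tfrac1{32}(349+85\sqrt{17})\,\kappa(11\tau^2)\tau^8+\mathrm O\bigl((1+\kappa(11\tau^2))\tau^7\bigr)$$ operations in $K$; here $\tfrac14(1+\sqrt{17})\le1.281$ and $\tfrac1{32}(349+85\sqrt{17})\le21.86$. 3. Creative telescoping relations for hyperexponential terms can be computed in polynomial time: there are constants $C,k$ depending only on $K$ and $\kappa$ such that for every $L$ and every choice of the degrees in $x$ and $y$ of $a,b,c_0,\dots,c_L$ there are an order $r$ and a tree that computes, for all terms with these degrees, a creative telescoping relation of order $r$ with at most $C\max\{\tau,\deg_x a\}^k$ operations in $K$. -/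

import Mathlib

open scoped Polynomial Polynomial.Bivariate

universe u v

noncomputable section

/-! ## Arithmetic programs over a field and their operation count -/

/-- The four arithmetic operations of a field. -/
inductive ArithOp
  | add
  | sub
  | mul
  | div

/-- The value of an arithmetic operation. -/
def ArithOp.apply {K : Type*} [Field K] : ArithOp → K → K → K
  | .add, s, t => s + t
  | .sub, s, t => s - t
  | .mul, s, t => s * t
  | .div, s, t => s / t

/-- An operand is a constant of the field, an input (inputs are indexed by `ι`),
or the content of a work register. -/
inductive Operand (K ι : Type*)
  | const (k : K)
  | input (i : ι)
  | reg (n : ℕ)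

/-- The value of an operand, given the inputs and the contents of the work registers. -/
def Operand.val {K ι : Type*} (inp : ι → K) (mem : ℕ → K) : Operand K ι → K
  | .const k => k
  | .input i => inp i
  | .reg n => mem n

/-- An arithmetic computation tree over `K` with inputs indexed by `ι` and outputs indexed by `ω`:
a finite tree whose inner nodes either perform one arithmetic operation and store its result in a
work register, or test one operand for being zero and branch; every leaf says where the outputs are
to be found. -/
inductive CompTree (K ι ω : Type*)
  | output (out : ω → Operand K ι)
  | compute (op : ArithOp) (s t : Operand K ι) (dst : ℕ) (next : CompTree K ι ω)
  | branch (s : Operand K ι) (ifZero ifNonzero : CompTree K ι ω)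

/-- `Run inp T mem out n`: on the inputs `inp` and with work registers containing `mem`, the tree
`T` terminates with outputs `out` after exactly `n` operations in `K`. Every arithmetic operation
and every zero test counts as one operation; a division by zero aborts the computation. -/
inductive CompTree.Run {K ι ω : Type*} [Field K] (inp : ι → K) :
    CompTree K ι ω → (ℕ → K) → (ω → K) → ℕ → Prop
  | output (out : ω → Operand K ι) (mem : ℕ → K) :
      Run inp (.output out) mem (fun o => (out o).val inp mem) 0
  | compute (op : ArithOp) (s t : Operand K ι) (dst : ℕ) (next : CompTree K ι ω)
      (mem : ℕ → K) (res : ω → K) (n : ℕ)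
      (hdiv : op = ArithOp.div → t.val inp mem ≠ 0)
      (hnext : Run inp next
        (Function.update mem dst (op.apply (s.val inp mem) (t.val inp mem))) res n) :
      Run inp (.compute op s t dst next) mem res (n + 1)
  | branchZero (s : Operand K ι) (ifZero ifNonzero : CompTree K ι ω)
      (mem : ℕ → K) (res : ω → K) (n : ℕ)
      (hs : s.val inp mem = 0) (hnext : Run inp ifZero mem res n) :
      Run inp (.branch s ifZero ifNonzero) mem res (n + 1)
  | branchNonzero (s : Operand K ι) (ifZero ifNonzero : CompTree K ι ω)
      (mem : ℕ → K) (res : ω → K) (n : ℕ)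
      (hs : s.val inp mem ≠ 0) (hnext : Run inp ifNonzero mem res n) :
      Run inp (.branch s ifZero ifNonzero) mem res (n + 1)

/-- Started with zeros in all work registers, `T` computes `out` from `inp` using at most `N`
operations in `K`. -/
def CompTree.ComputesWithin {K ι ω : Type*} [Field K] (T : CompTree K ι ω)
    (inp : ι → K) (out : ω → K) (N : ℝ) : Prop :=
  ∃ n : ℕ, T.Run inp (fun _ => 0) out n ∧ (n : ℝ) ≤ N

/-! ## The cost factor of a linear system solver -/

/-- Degree `n` solutions of homogeneous linear systems over `K(x)` with `m` variables and at most
`m` equations can be computed with `n * m ^ 3 * κ (max n m)` operations in `K`: for all sizes there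
is a computation tree which, on the coefficients of any `k × m` polynomial matrix `A` with entries
of degree at most `n`, finds a nonzero polynomial vector of degree at most `n` in the kernel of `A`,
provided that there is one. -/
def SolvesLinearSystems (K : Type*) [Field K] (κ : ℕ → ℝ) : Prop :=
  ∀ n m k : ℕ, 1 ≤ n → 1 ≤ m → k ≤ m →
    ∃ T : CompTree K (Fin k × Fin m × ℕ) (Fin m × ℕ),
      ∀ A : Matrix (Fin k) (Fin m) K[X], (∀ i j, (A i j).natDegree ≤ n) →
        (∃ u : Fin m → K[X], u ≠ 0 ∧ (∀ j, (u j).natDegree ≤ n) ∧ A.mulVec u = 0) →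
        ∃ u : Fin m → K[X], u ≠ 0 ∧ (∀ j, (u j).natDegree ≤ n) ∧ A.mulVec u = 0 ∧
          T.ComputesWithin (fun s => (A s.1 s.2.1).coeff s.2.2) (fun s => (u s.1).coeff s.2)
            ((n : ℝ) * (m : ℝ) ^ 3 * κ (max n m))

/-- `κ` is sublinear: `κ t / t` is nonincreasing from some point on, that is,
`κ (l * s) ≤ l * κ s` for all large `s` and all `l ≥ 1` with `l * s` an integer. -/
def Sublinear (κ : ℕ → ℝ) : Prop :=
  ∃ t₀ : ℕ, ∀ s t : ℕ, t₀ ≤ s → s ≤ t → (s : ℝ) * κ t ≤ (t : ℝ) * κ s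

/-! ## Bivariate polynomials; `K[X][Y]` is `K[x][y]`, with `y` the outer variable -/

/-- The degree in `x`. -/
def degX {K : Type*} [Field K] (p : K[X][Y]) : ℕ :=
  p.support.sup fun j => (p.coeff j).natDegree

/-- The degree in `y`. -/
def degY {K : Type*} [Field K] (p : K[X][Y]) : ℕ :=
  p.natDegree

/-- The square free part of a bivariate polynomial (the product of its distinct irreducible
factors, one from each class of associates). -/
def sqfreePart {K : Type*} [Field K] (p : K[X][Y]) : K[X][Y] :=
  letI : NormalizationMonoid K[X][Y] := Classical.choice inferInstance
  UniqueFactorizationMonoid.radical p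

theorem sqfreePart_spec {K : Type*} [Field K] {p : K[X][Y]} (hp : p ≠ 0) :
    Squarefree (sqfreePart p) ∧ sqfreePart p ∣ p ∧
      ∀ q : K[X][Y], Irreducible q → q ∣ p → q ∣ sqfreePart p := by
  letI : NormalizationMonoid K[X][Y] := Classical.choice inferInstance
  exact ⟨UniqueFactorizationMonoid.squarefree_radical, UniqueFactorizationMonoid.radical_dvd_self,
    fun q hq h => (UniqueFactorizationMonoid.dvd_radical_iff_of_irreducible hq hp).2 h⟩

/-- A differential field extension `E` of `K(x,y)`: a field containing `K[x,y]`, with two commuting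
`K`-linear derivations that extend the partial derivations with respect to `x` and `y`. -/
structure DiffFieldExt (K : Type*) [Field K] (E : Type*) [Field E] [Algebra K E]
    [Algebra K[X][Y] E] [IsScalarTower K K[X][Y] E] where
  Dx : Derivation K E E
  Dy : Derivation K E E
  injective : Function.Injective (algebraMap K[X][Y] E)
  Dx_x : Dx (algebraMap K[X][Y] E (Polynomial.C Polynomial.X)) = 1
  Dx_y : Dx (algebraMap K[X][Y] E Polynomial.X) = 0
  Dy_x : Dy (algebraMap K[X][Y] E (Polynomial.C Polynomial.X)) = 0
  Dy_y : Dy (algebraMap K[X][Y] E Polynomial.X) = 1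
  comm : ∀ z : E, Dx (Dy z) = Dy (Dx z)

/-- A nonzero element of a differential field extension of `K(x,y)` is hyperexponential if its two
logarithmic derivatives are in `K(x,y)`. -/
def DiffFieldExt.IsHyperexponential {K : Type*} [Field K] {E : Type*} [Field E] [Algebra K E]
    [Algebra K[X][Y] E] [IsScalarTower K K[X][Y] E] (D : DiffFieldExt K E) (z : E) : Prop :=
  z ≠ 0 ∧
    (∃ s t : K[X][Y], t ≠ 0 ∧ D.Dx z / z = algebraMap K[X][Y] E s / algebraMap K[X][Y] E t) ∧
    (∃ s t : K[X][Y], t ≠ 0 ∧ D.Dy z / z = algebraMap K[X][Y] E s / algebraMap K[X][Y] E t)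

/-- A creative telescoping relation of order `r` for `h`, with telescoper `∑ i ≤ r, p i * Dx ^ i`
(the `p i` are polynomials in `x` only and `p r ≠ 0`) and with certificate `Q`. -/
def DiffFieldExt.IsCTRelation {K : Type*} [Field K] {E : Type*} [Field E] [Algebra K E]
    [Algebra K[X][Y] E] [IsScalarTower K K[X][Y] E] (D : DiffFieldExt K E) (h : E)
    (r : ℕ) (p : Fin (r + 1) → K[X]) (Q : E) : Prop :=
  p (Fin.last r) ≠ 0 ∧ (Q = 0 ∨ D.IsHyperexponential Q) ∧
    ∑ i : Fin (r + 1), algebraMap K[X][Y] E (Polynomial.C (p i)) * (D.Dx)^[(i : ℕ)] h = D.Dy Q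

/-! ## Hyperexponential terms -/

/-- The data of a term `c₀ * exp (a / b) * ∏ l, c l ^ e l` which, apart from `c₀`, depends on `x`
and on `y`. -/
structure HypTerm (K : Type*) [Field K] (L : ℕ) where
  a : K[X][Y]
  b : K[X][Y]
  c₀ : K[X][Y]
  c : Fin L → K[X][Y]
  e : Fin L → K
  b_ne : b ≠ 0
  c₀_ne : c₀ ≠ 0
  c_ne : ∀ l, c l ≠ 0
  e_ne : ∀ l, e l ≠ 0
  x_ne : max (degX a) (degX b) + ∑ l, degX (c l) ≠ 0
  y_ne : max (degY a) (degY b) + ∑ l, degY (c l) ≠ 0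

/-- The number `L` of powers and all the degrees in `x` and in `y` of the polynomials that make up
a term. -/
structure HypFormat (L : ℕ) where
  a : ℕ × ℕ
  b : ℕ × ℕ
  c₀ : ℕ × ℕ
  c : Fin L → ℕ × ℕ

/-- The positions of the input: the coefficients of `x ^ i * y ^ j` in the polynomials that make up
a term, and the exponents. -/
inductive HypInput (L : ℕ)
  | a (i j : ℕ)
  | b (i j : ℕ)
  | c₀ (i j : ℕ)
  | c (l : Fin L) (i j : ℕ)
  | e (l : Fin L)

/-- The positions of the output: the coefficient of `x ^ i` in the coefficient `p k` of the
telescoper, and the coefficients of `x ^ i * y ^ j` in numerator and denominator of the rational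
function that the certificate is a multiple of the term by. -/
inductive HypOutput (r : ℕ)
  | p (k : Fin (r + 1)) (i : ℕ)
  | num (i j : ℕ)
  | den (i j : ℕ)

/-- The outputs that represent given polynomials. -/
def HypOutput.value {K : Type*} [Field K] {r : ℕ} (p : Fin (r + 1) → K[X]) (u v : K[X][Y]) :
    HypOutput r → K
  | .p k i => (p k).coeff i
  | .num i j => (u.coeff j).coeff i
  | .den i j => (v.coeff j).coeff i

namespace HypTerm

variable {K : Type*} [Field K] {L : ℕ}

/-- The degrees of the polynomials in `H`. -/
def format (H : HypTerm K L) : HypFormat L where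
  a := (degX H.a, degY H.a)
  b := (degX H.b, degY H.b)
  c₀ := (degX H.c₀, degY H.c₀)
  c := fun l => (degX (H.c l), degY (H.c l))

/-- The input that represents `H`. -/
def value (H : HypTerm K L) : HypInput L → K
  | .a i j => (H.a.coeff j).coeff i
  | .b i j => (H.b.coeff j).coeff i
  | .c₀ i j => (H.c₀.coeff j).coeff i
  | .c l i j => ((H.c l).coeff j).coeff i
  | .e l => H.e l

/-- `H` describes the element `h` of a differential field extension: `h` is nonzero and
`Dx` and `Dy` act on it as the expression `c₀ * exp (a / b) * ∏ l, c l ^ e l` suggests. -/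
def Describes (H : HypTerm K L) {E : Type*} [Field E] [Algebra K E]
    [Algebra K[X][Y] E] [IsScalarTower K K[X][Y] E] (D : DiffFieldExt K E) (h : E) : Prop :=
  h ≠ 0 ∧ ∀ δ : Derivation K E E, δ = D.Dx ∨ δ = D.Dy →
    δ h / h =
      δ (algebraMap K[X][Y] E H.c₀) / algebraMap K[X][Y] E H.c₀ +
      δ (algebraMap K[X][Y] E H.a / algebraMap K[X][Y] E H.b) +
      ∑ l, algebraMap K E (H.e l) *
        (δ (algebraMap K[X][Y] E (H.c l)) / algebraMap K[X][Y] E (H.c l))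

/-- `H` is normalized: the `c l` are square free and pairwise without common factors, and no
exponent `e l` is a natural number. -/
def Normalized (H : HypTerm K L) : Prop :=
  (∀ l, Squarefree (H.c l)) ∧ (∀ l l', l ≠ l' → IsRelPrime (H.c l) (H.c l')) ∧
    ∀ l, ∀ n : ℕ, H.e l ≠ (n : K)

/-- `α = deg_x b* + deg_x b + ∑ deg_x c_l`. -/
def alpha (H : HypTerm K L) : ℕ :=
  degX (sqfreePart H.b) + degX H.b + ∑ l, degX (H.c l)

/-- `β = deg_x a - deg_x b - 1`. -/
def beta (H : HypTerm K L) : ℤ :=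
  (degX H.a : ℤ) - degX H.b - 1

/-- `γ = deg_y b* + max (deg_y a) (deg_y b) + ∑ deg_y c_l`. -/
def gamma (H : HypTerm K L) : ℕ :=
  degY (sqfreePart H.b) + max (degY H.a) (degY H.b) + ∑ l, degY (H.c l)

open Classical in
/-- `φ₃` is `1` if `a / b ∈ K(x)`, every `e_l` with `deg_y c_l ≠ 0` is an integer, and
`∑ e_l * deg_y c_l` (which is an integer then) is at most `deg_y c₀`; otherwise it is `0`. -/
def phi₃ (H : HypTerm K L) : ℕ :=
  if (∃ s t : K[X], t ≠ 0 ∧ H.a * Polynomial.C t = H.b * Polynomial.C s) ∧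
      (∀ l, degY (H.c l) = 0 ∨ ∃ z : ℤ, H.e l = (z : K)) ∧
      (∃ z : ℤ, ∑ l, H.e l * (degY (H.c l) : K) = (z : K) ∧ z ≤ (degY H.c₀ : ℤ))
  then 1 else 0

/-- `τ = max {α, γ, deg_x c₀, deg_y c₀}`. -/
def tau (H : HypTerm K L) : ℕ :=
  max (max H.alpha H.gamma) (max (degX H.c₀) (degY H.c₀))

end HypTerm

/-- On input `H`, the tree `T` computes, with at most `N` operations in `K`, polynomials
`p 0, …, p r` in `x` and polynomials `f` and `g ≠ 0` in `x` and `y` such that every hyperexponential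
`h = c₀ * exp (a / b) * ∏ l, c l ^ e l` has the creative telescoping relation of order `r` with
telescoper `∑ i ≤ r, p i * Dx ^ i` and certificate `(f / g) * h`. -/
def CompTree.FindsCTRelation {K : Type u} [Field K] {L r : ℕ}
    (T : CompTree K (HypInput L) (HypOutput r)) (H : HypTerm K L) (N : ℝ) : Prop :=
  ∃ (p : Fin (r + 1) → K[X]) (f g : K[X][Y]), g ≠ 0 ∧
    T.ComputesWithin H.value (HypOutput.value p f g) N ∧
    ∀ (E : Type v) [Field E] [Algebra K E] [Algebra K[X][Y] E] [IsScalarTower K K[X][Y] E]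
      (D : DiffFieldExt K E) (h : E), H.Describes D h →
        D.IsCTRelation h r p (algebraMap K[X][Y] E f / algebraMap K[X][Y] E g * h)

end

open scoped Polynomial Polynomial.Bivariate

noncomputable section

/-! ## Computations described by the functions of the input that they make available -/

/-! Write the term as `h = c₀ * z`. If `s ≠ 0` is a polynomial such that `b` divides both `s * D_x
b` and `s * D_y b` (the square free part of `b` is one), then the logarithmic derivatives of `z` are
`wx / v` and `wy / v` with `v = b * s * ∏ c_l`. Hence `D_x ^ i h = N_i * z / v ^ i` with polynomials
`N_i`, and for `Q = q * v ^ (1 - r) * z` the derivative `D_y Q` is a polynomial `T(q)` times `z / v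
^ r`. A telescoping relation thus follows from the identity `∑ p_i * N_i * v ^ (r - i) = T(q)`,
where `T` (an instance of `twist`) is `K[x]`-linear. Comparing coefficients of powers of `y` gives a
homogeneous linear system over `K(x)`. When `v` and `c₀` have degree at most `t` in `y` and `wy` has
degree less than `t`, there are `(r + 1) * t + 1` equations for the `r + 1` unknowns `p_i` and the
`r * t + 2` coefficients of `q`, so nonzero solutions exist once `r ≥ t - 1`; a count of
coefficients in `x` bounds their degree (`exists_telescoperMatrix_kernel`).

A solution is useless if all `p_i` vanish, that is, if `T(q) = 0` with `q ≠ 0`. For normalized terms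
with `φ₃ = 0` this cannot happen: it would make `D_y (a / b)` a combination of logarithmic
derivatives, pole orders would put `a / b` into `K(x)`, and residues would make the relevant `e_l`
integers (`HypTerm.eq_zero_of_twist_eq_zero`). In general `q` is made to vanish on a line `y = y₀`
on which `v` is not zero; uniqueness for first order equations then excludes `T(q) = 0` at the price
of one unknown (`eq_zero_of_twist_eq_zero`). If the operator found has order less than `r`, powers
of `D_x` are applied from the left (`isCTRelation_of_identity`).

The solver dominates the cost. At order `τ - 1 + φ₃` there is one more unknown than equations, the
degree is about `2τ³` and there are about `τ²` unknowns. At order `ρτ` the degree is about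
`ρ(ρ+1)/(ρ-1) τ²` and there are about `ρτ²` unknowns; the factor `ρ⁴(ρ+1)/(ρ-1)` of the cost is
minimal when `2ρ² = ρ + 2`.

The number `τ` depends on the square free part of `b`, which the degrees of the input do not reveal.
Therefore values `t` are tried: linear algebra either finds a denominator `s` of the degree for
which `t` leaves room, or proves `τ > t` (`Reach.logDerivatives`, `HasFormat.reach_trial`). For
polynomial time the choice `s = b` needs no trial.

Algorithms are described by `Reach`, which records the functions of the input known so far instead
of registers, and are converted to trees at the end by `Reach.exists_tree`. -/

/-- `Reach G N S V`: knowing that the input is in `S` and having the functions in `V` of the input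
available, at most `N` arithmetic operations and zero tests lead, on every branch, to a set of
possible inputs and a set of available functions that satisfy `G`. -/
inductive Reach {K Ω : Type*} [Field K] (G : Set Ω → Set (Ω → K) → Prop) :
    ℕ → Set Ω → Set (Ω → K) → Prop
  | done {N S V} : G S V → Reach G N S V
  | compute {N S V} (op : ArithOp) (f g : Ω → K) (hf : f ∈ V) (hg : g ∈ V)
      (hdiv : op = ArithOp.div → ∀ H ∈ S, g H ≠ 0)
      (hnext : Reach G N S (insert (fun H => op.apply (f H) (g H)) V)) : Reach G (N + 1) S V
  | branch {N S V} (f : Ω → K) (hf : f ∈ V)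
      (hzero : Reach G N (S ∩ {H | f H = 0}) V)
      (hnonzero : Reach G N (S ∩ {H | f H ≠ 0}) V) : Reach G (N + 1) S V

namespace Reach

variable {K Ω : Type*} [Field K] {G G' : Set Ω → Set (Ω → K) → Prop}

theorem mono_cost {N M : ℕ} {S : Set Ω} {V : Set (Ω → K)} (h : Reach G N S V) (hNM : N ≤ M) :
    Reach G M S V := by
  induction h generalizing M with
  | done h => exact .done h
  | compute op f g hf hg hdiv _ ih =>
    obtain ⟨M, rfl⟩ : ∃ M', M = M' + 1 := ⟨M - 1, by omega⟩
    exact .compute op f g hf hg hdiv (ih (by omega))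
  | branch f hf _ _ ih₁ ih₂ =>
    obtain ⟨M, rfl⟩ : ∃ M', M = M' + 1 := ⟨M - 1, by omega⟩
    exact .branch f hf (ih₁ (by omega)) (ih₂ (by omega))

theorem with_invariant {N : ℕ} {S : Set Ω} {V : Set (Ω → K)} (h : Reach G N S V) :
    Reach (fun S' V' => S' ⊆ S ∧ V ⊆ V' ∧ G S' V') N S V := by
  -- Both sets change along the computation, so the induction compares with an arbitrary fixed pair.
  have key : ∀ S₀ V₀, S ⊆ S₀ → V₀ ⊆ V →
      Reach (fun S' V' => S' ⊆ S₀ ∧ V₀ ⊆ V' ∧ G S' V') N S V := by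
    induction h with
    | done h => exact fun S₀ V₀ hS hV => .done ⟨hS, hV, h⟩
    | compute op f g hf hg hdiv _ ih =>
      exact fun S₀ V₀ hS hV =>
        .compute op f g hf hg hdiv (ih S₀ V₀ hS (hV.trans (Set.subset_insert _ _)))
    | branch f hf _ _ ih₁ ih₂ =>
      exact fun S₀ V₀ hS hV => .branch f hf (ih₁ S₀ V₀ (Set.inter_subset_left.trans hS) hV)
        (ih₂ S₀ V₀ (Set.inter_subset_left.trans hS) hV)
  exact key S V subset_rfl subset_rfl

theorem bind_of_goal {N M : ℕ} {S : Set Ω} {V : Set (Ω → K)} (h : Reach G N S V)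
    (hG : ∀ S' V', G S' V' → Reach G' M S' V') : Reach G' (N + M) S V := by
  induction h with
  | done h => exact (hG _ _ h).mono_cost (by omega)
  | compute op f g hf hg hdiv _ ih =>
    exact (Reach.compute op f g hf hg hdiv ih).mono_cost (by omega)
  | branch f hf _ _ ih₁ ih₂ => exact (Reach.branch f hf ih₁ ih₂).mono_cost (by omega)

theorem bind {N M : ℕ} {S : Set Ω} {V : Set (Ω → K)} (h : Reach G N S V)
    (hG : ∀ S' V', S' ⊆ S → V ⊆ V' → G S' V' → Reach G' M S' V') : Reach G' (N + M) S V :=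
  h.with_invariant.bind_of_goal fun S' V' h' => hG S' V' h'.1 h'.2.1 h'.2.2

theorem imp {N : ℕ} {S : Set Ω} {V : Set (Ω → K)} (h : Reach G N S V)
    (hG : ∀ S' V', S' ⊆ S → V ⊆ V' → G S' V' → G' S' V') : Reach G' N S V :=
  h.bind (M := 0) fun S' V' h₁ h₂ h₃ => .done (hG S' V' h₁ h₂ h₃)

/-- Finding the first function in a list that does not vanish. -/
theorem find_nonzero {α : Type*} (l : List α) (f : α → Ω → K) (S : Set Ω) (V : Set (Ω → K))
    (hf : ∀ i ∈ l, f i ∈ V) :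
    Reach (fun S' _ => (∀ i ∈ l, ∀ H ∈ S', f i H = 0) ∨
      ∃ l₁ i l₂, l = l₁ ++ i :: l₂ ∧ (∀ j ∈ l₁, ∀ H ∈ S', f j H = 0) ∧ ∀ H ∈ S', f i H ≠ 0)
      l.length S V := by
  induction l generalizing S with
  | nil => exact .done (Or.inl (by simp))
  | cons i l ih =>
    refine .branch (f i) (hf i (by simp)) ?_ ?_
    · refine (ih (S ∩ {H | f i H = 0}) fun j hj => hf j (by simp [hj])).imp ?_
      rintro S' V' hS - (h | ⟨l₁, j, l₂, rfl, h₁, h₂⟩)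
      · left
        intro j hj H hH
        rcases List.mem_cons.1 hj with rfl | hj
        · exact (hS hH).2
        · exact h j hj H hH
      · right
        refine ⟨i :: l₁, j, l₂, rfl, fun k hk H hH => ?_, h₂⟩
        rcases List.mem_cons.1 hk with rfl | hk
        · exact (hS hH).2
        · exact h₁ k hk H hH
    · exact .done (Or.inr ⟨[], i, l, rfl, by simp, fun H hH => hH.2⟩)

end Reach

/-! ### From computations to trees -/

/-- All work registers that occur in the operand have numbers below `n`. -/
def Operand.Below {K ι : Type*} (n : ℕ) : Operand K ι → Prop
  | .reg k => k < n
  | _ => True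

theorem Operand.Below.val_update {K ι : Type*} {n : ℕ} {s : Operand K ι} (hs : s.Below n)
    (inp : ι → K) (mem : ℕ → K) (z : K) : s.val inp (Function.update mem n z) = s.val inp mem := by
  cases s with
  | const k => rfl
  | input i => rfl
  | reg k => exact Function.update_of_ne (Nat.ne_of_lt hs) _ _

theorem Operand.Below.succ {K ι : Type*} {n : ℕ} {s : Operand K ι} (hs : s.Below n) :
    s.Below (n + 1) := by
  cases s with
  | const k => trivial
  | input i => trivial
  | reg k => exact Nat.lt_succ_of_lt hs

/-- The invariant is an assignment `o` of operands to the available functions that uses only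
registers below `n`. A new value goes into register `n`, so no operand assigned earlier changes its
value. -/
theorem Reach.exists_tree_of_operands {K ι ω Ω : Type*} [Field K] (inp : Ω → ι → K)
    (Q : Ω → (ω → K) → Prop) {N : ℕ} {S : Set Ω} {V : Set (Ω → K)}
    (h : Reach (fun S' V' => ∃ out : ω → Ω → K, (∀ w, out w ∈ V') ∧
      ∀ H ∈ S', Q H fun w => out w H) N S V)
    (n : ℕ) (o : (Ω → K) → Operand K ι) (ho : ∀ f ∈ V, (o f).Below n) :
    ∃ T : CompTree K ι ω, ∀ H ∈ S, ∀ mem : ℕ → K, (∀ f ∈ V, (o f).val (inp H) mem = f H) →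
      ∃ (res : ω → K) (k : ℕ), T.Run (inp H) mem res k ∧ k ≤ N ∧ Q H res := by
  classical
  induction h generalizing n o with
  | @done N S V hG =>
    obtain ⟨out, hout, hQ⟩ := hG
    refine ⟨.output fun w => o (out w), fun H hH mem hmem =>
      ⟨_, 0, .output _ _, Nat.zero_le _, ?_⟩⟩
    have : (fun w => (o (out w)).val (inp H) mem) = fun w => out w H :=
      funext fun w => hmem _ (hout w)
    rw [this]
    exact hQ H hH
  | @compute N S V op f g hf hg hdiv _ ih =>
    set e : Ω → K := fun H => op.apply (f H) (g H) with he
    obtain ⟨T, hT⟩ := ih (n + 1) (Function.update o e (.reg n)) (by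
      intro f' hf'
      by_cases hfe : f' = e
      · subst hfe
        simp [Operand.Below]
      · rw [Function.update_of_ne hfe]
        exact (ho f' (Set.mem_of_mem_insert_of_ne hf' hfe)).succ)
    refine ⟨.compute op (o f) (o g) n T, fun H hH mem hmem => ?_⟩
    obtain ⟨res, k, hrun, hk, hQ⟩ := hT H hH
      (Function.update mem n (op.apply ((o f).val (inp H) mem) ((o g).val (inp H) mem))) (by
        intro f' hf'
        by_cases hfe : f' = e
        · subst hfe
          rw [Function.update_self, hmem f hf, hmem g hg]
          simp [Operand.val, he]
        · rw [Function.update_of_ne hfe]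
          have := Set.mem_of_mem_insert_of_ne hf' hfe
          rw [(ho f' this).val_update, hmem f' this])
    exact ⟨res, k + 1, .compute _ _ _ _ _ _ _ _ (fun h => by rw [hmem g hg]; exact hdiv h H hH) hrun,
      by omega, hQ⟩
  | @branch N S V f hf _ _ ih₁ ih₂ =>
    obtain ⟨T₁, hT₁⟩ := ih₁ n o ho
    obtain ⟨T₂, hT₂⟩ := ih₂ n o ho
    refine ⟨.branch (o f) T₁ T₂, fun H hH mem hmem => ?_⟩
    by_cases h0 : f H = 0
    · obtain ⟨res, k, hrun, hk, hQ⟩ := hT₁ H ⟨hH, h0⟩ mem hmem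
      exact ⟨res, k + 1, .branchZero _ _ _ _ _ _ (by rw [hmem f hf, h0]) hrun, by omega, hQ⟩
    · obtain ⟨res, k, hrun, hk, hQ⟩ := hT₂ H ⟨hH, h0⟩ mem hmem
      exact ⟨res, k + 1, .branchNonzero _ _ _ _ _ _ (by rwa [hmem f hf]) hrun, by omega, hQ⟩

/-- The functions of the input that are available initially: constants and components. -/
def initialFunctions {K ι Ω : Type*} (inp : Ω → ι → K) : Set (Ω → K) :=
  {f | (∃ k, f = fun _ => k) ∨ ∃ i, f = fun H => inp H i}

theorem Reach.exists_tree {K ι ω Ω : Type*} [Field K] (inp : Ω → ι → K)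
    (Q : Ω → (ω → K) → Prop) {N : ℕ}
    (h : Reach (fun S' V' => ∃ out : ω → Ω → K, (∀ w, out w ∈ V') ∧
      ∀ H ∈ S', Q H fun w => out w H) N Set.univ (initialFunctions inp)) :
    ∃ T : CompTree K ι ω, ∀ H, ∃ res, T.ComputesWithin (inp H) res N ∧ Q H res := by
  classical
  have hex : ∀ f : Ω → K, ∃ s : Operand K ι, f ∈ initialFunctions inp →
      s.Below 0 ∧ ∀ H mem, s.val (inp H) mem = f H := by
    intro f
    by_cases hf : f ∈ initialFunctions inp
    · rcases hf with ⟨k, rfl⟩ | ⟨i, rfl⟩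
      · exact ⟨.const k, fun _ => ⟨trivial, fun _ _ => rfl⟩⟩
      · exact ⟨.input i, fun _ => ⟨trivial, fun _ _ => rfl⟩⟩
    · exact ⟨.const 0, fun h => absurd h hf⟩
  choose o ho using hex
  obtain ⟨T, hT⟩ := h.exists_tree_of_operands inp Q 0 o fun f hf => (ho f hf).1
  refine ⟨T, fun H => ?_⟩
  obtain ⟨res, k, hrun, hk, hQ⟩ := hT H trivial (fun _ => 0) fun f hf => (ho f hf).2 H _
  exact ⟨res, ⟨k, hrun, by exact_mod_cast hk⟩, hQ⟩

/-- The set of available functions contains the constants. -/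
def HasConsts {K Ω : Type*} (V : Set (Ω → K)) : Prop :=
  ∀ k : K, (fun _ => k) ∈ V

theorem HasConsts.mono {K Ω : Type*} {V V' : Set (Ω → K)} (h : HasConsts V) (hV : V ⊆ V') :
    HasConsts V' := fun k => hV (h k)

theorem hasConsts_initialFunctions {K ι Ω : Type*} (inp : Ω → ι → K) :
    HasConsts (initialFunctions inp) := fun k => Or.inl ⟨k, rfl⟩

/-- A given tree can be run on available inputs. -/
theorem Reach.of_tree {K ι ω Ω : Type*} [Field K] (T : CompTree K ι ω) (inp : Ω → ι → K)
    (Q : Ω → (ω → K) → Prop) (mem : Ω → ℕ → K) (N : ℕ) (S : Set Ω) (V : Set (Ω → K))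
    (hV : HasConsts V) (hinp : ∀ i, (fun H => inp H i) ∈ V) (hmem : ∀ n, (fun H => mem H n) ∈ V)
    (hrun : ∀ H ∈ S, ∃ (res : ω → K) (n : ℕ), T.Run (inp H) (mem H) res n ∧ n ≤ N ∧ Q H res) :
    Reach (fun S' V' => ∃ out : ω → Ω → K, (∀ w, out w ∈ V') ∧ ∀ H ∈ S', Q H fun w => out w H)
      N S V := by
  classical
  have hval : ∀ (s : Operand K ι) (V : Set (Ω → K)) (mem : Ω → ℕ → K), HasConsts V →
      (∀ i, (fun H => inp H i) ∈ V) → (∀ n, (fun H => mem H n) ∈ V) →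
      (fun H => s.val (inp H) (mem H)) ∈ V := by
    intro s V mem hV hinp hmem
    cases s with
    | const k => exact hV k
    | input i => exact hinp i
    | reg n => exact hmem n
  -- The bound `N` is only known to be large enough because some input runs through the node; a
  -- branch that no input reaches may leave `N = 0` and has to be closed separately.
  rcases S.eq_empty_or_nonempty with rfl | hS
  · exact .done ⟨fun _ _ => 0, fun _ => hV 0, fun H hH => hH.elim⟩
  induction T generalizing mem N S V with
  | output out =>
    refine .done ⟨fun w H => (out w).val (inp H) (mem H), fun w => hval _ _ _ hV hinp hmem,
      fun H hH => ?_⟩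
    obtain ⟨res, n, hr, -, hQ⟩ := hrun H hH
    cases hr
    exact hQ
  | compute op s t dst next ih =>
    have hpos : 1 ≤ N := by
      obtain ⟨H, hH⟩ := hS
      obtain ⟨res, n, hr, hn, -⟩ := hrun H hH
      cases hr
      omega
    obtain ⟨N, rfl⟩ : ∃ N', N = N' + 1 := ⟨N - 1, by omega⟩
    refine .compute op _ _ (hval s V mem hV hinp hmem) (hval t V mem hV hinp hmem) ?_ ?_
    · intro hop H hH
      obtain ⟨res, n, hr, -, -⟩ := hrun H hH
      cases hr with
      | compute _ _ _ _ _ _ _ n hdiv _ => exact hdiv hop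
    · have hsub := Set.subset_insert
        (fun H => op.apply (s.val (inp H) (mem H)) (t.val (inp H) (mem H))) V
      refine ih (fun H => Function.update (mem H) dst
        (op.apply (s.val (inp H) (mem H)) (t.val (inp H) (mem H)))) N S _ (hV.mono hsub)
        (fun i => hsub (hinp i)) ?_ ?_ hS
      · intro n
        by_cases hn : n = dst
        · subst hn
          simp
        · simpa [Function.update_of_ne hn] using hsub (hmem n)
      · intro H hH
        obtain ⟨res, n, hr, hn, hQ⟩ := hrun H hH
        cases hr with
        | compute _ _ _ _ _ _ _ n _ hnext => exact ⟨res, n, hnext, by omega, hQ⟩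
  | branch s T₁ T₂ ih₁ ih₂ =>
    have hpos : 1 ≤ N := by
      obtain ⟨H, hH⟩ := hS
      obtain ⟨res, n, hr, hn, -⟩ := hrun H hH
      cases hr <;> omega
    obtain ⟨N, rfl⟩ : ∃ N', N = N' + 1 := ⟨N - 1, by omega⟩
    refine .branch _ (hval s V mem hV hinp hmem) ?_ ?_
    · rcases (S ∩ {H | s.val (inp H) (mem H) = 0}).eq_empty_or_nonempty with h | h
      · rw [h]
        exact .done ⟨fun _ _ => 0, fun _ => hV 0, fun H hH => hH.elim⟩
      refine ih₁ mem N _ V hV hinp hmem ?_ h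
      rintro H ⟨hH, h0⟩
      obtain ⟨res, n, hr, hn, hQ⟩ := hrun H hH
      cases hr with
      | branchZero _ _ _ _ _ n _ hnext => exact ⟨res, n, hnext, by omega, hQ⟩
      | branchNonzero _ _ _ _ _ n hs _ => exact absurd h0 hs
    · rcases (S ∩ {H | s.val (inp H) (mem H) ≠ 0}).eq_empty_or_nonempty with h | h
      · rw [h]
        exact .done ⟨fun _ _ => 0, fun _ => hV 0, fun H hH => hH.elim⟩
      refine ih₂ mem N _ V hV hinp hmem ?_ h
      rintro H ⟨hH, h0⟩
      obtain ⟨res, n, hr, hn, hQ⟩ := hrun H hH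
      cases hr with
      | branchZero _ _ _ _ _ n hs _ => exact absurd hs h0
      | branchNonzero _ _ _ _ _ n _ hnext => exact ⟨res, n, hnext, by omega, hQ⟩

/-! ### Straight line computations -/

/-- From the functions in `V` the functions in `A` can be computed with at most `N` operations,
without divisions and zero tests. -/
def SLP {K Ω : Type*} [Field K] (V : Set (Ω → K)) (N : ℕ) (A : Set (Ω → K)) : Prop :=
  ∀ (G : Set Ω → Set (Ω → K) → Prop) (M : ℕ) (S : Set Ω) (V₀ : Set (Ω → K)), V ⊆ V₀ →
    (∀ V', V₀ ⊆ V' → A ⊆ V' → Reach G M S V') → Reach G (N + M) S V₀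

namespace SLP

variable {K Ω : Type*} [Field K] {V V' A A' : Set (Ω → K)} {N M : ℕ}

theorem reach (h : SLP V N A) {G : Set Ω → Set (Ω → K) → Prop} {S : Set Ω}
    (hG : ∀ V', V ⊆ V' → A ⊆ V' → Reach G M S V') : Reach G (N + M) S V :=
  h G M S V subset_rfl hG

theorem mono (h : SLP V N A) (hV : V ⊆ V') (hN : N ≤ M) (hA : A' ⊆ A) : SLP V' M A' :=
  fun G _ S V₀ hV₀ hG =>
    (h G _ S V₀ (hV.trans hV₀) fun W hW hAW => hG W hW (hA.trans hAW)).mono_cost (by omega)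

theorem of_subset (h : A ⊆ V) : SLP V N A :=
  fun _ _ _ V₀ hV hG => (hG V₀ subset_rfl (h.trans hV)).mono_cost (by omega)

theorem trans (h : SLP V N A) (h' : ∀ W, V ⊆ W → A ⊆ W → SLP W M A') : SLP V (N + M) A' := by
  intro G k S V₀ hV hG
  rw [add_assoc]
  exact h G (M + k) S V₀ hV fun W hW hA =>
    h' W (hV.trans hW) hA G k S W subset_rfl fun W' hW' hA' => hG W' (hW.trans hW') hA'

theorem union (h : SLP V N A) (h' : SLP V M A') : SLP V (N + M) (A ∪ A') := by
  refine h.trans fun W hVW hAW => ?_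
  intro G k S V₀ hV hG
  exact h' G k S V₀ (hVW.trans hV) fun W' hW' hA' =>
    hG W' hW' (Set.union_subset (hAW.trans (hV.trans hW')) hA')

theorem biUnion {α : Type*} (s : Finset α) (B : α → Set (Ω → K)) (h : ∀ i ∈ s, SLP V N (B i)) :
    SLP V (s.card * N) (⋃ i ∈ s, B i) := by
  classical
  induction s using Finset.induction_on with
  | empty => exact of_subset (by simp)
  | insert i s hi ih =>
    rw [Finset.card_insert_of_notMem hi, Finset.set_biUnion_insert]
    exact ((h i (Finset.mem_insert_self i s)).union
      (ih fun j hj => h j (Finset.mem_insert_of_mem hj))).mono subset_rfl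
        (by rw [add_mul, one_mul, add_comm]) subset_rfl

theorem op (o : ArithOp) (ho : o ≠ .div) {f g : Ω → K} (hf : f ∈ V) (hg : g ∈ V) :
    SLP V 1 {fun H => o.apply (f H) (g H)} := by
  intro G M S V₀ hV hG
  rw [add_comm]
  exact .compute o f g (hV hf) (hV hg) (fun h => absurd h ho)
    (hG _ (Set.subset_insert _ _) (Set.singleton_subset_iff.2 (Set.mem_insert _ _)))

theorem add {f g : Ω → K} (hf : f ∈ V) (hg : g ∈ V) : SLP V 1 {fun H => f H + g H} :=
  op .add (by simp) hf hg

theorem sub {f g : Ω → K} (hf : f ∈ V) (hg : g ∈ V) : SLP V 1 {fun H => f H - g H} :=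
  op .sub (by simp) hf hg

theorem mul {f g : Ω → K} (hf : f ∈ V) (hg : g ∈ V) : SLP V 1 {fun H => f H * g H} :=
  op .mul (by simp) hf hg

theorem sum_mul {α : Type*} (hV : HasConsts V) (s : Finset α) (f g : α → Ω → K)
    (hf : ∀ i ∈ s, f i ∈ V) (hg : ∀ i ∈ s, g i ∈ V) :
    SLP V (2 * s.card) {fun H => ∑ i ∈ s, f i H * g i H} := by
  classical
  induction s using Finset.induction_on with
  | empty => exact of_subset (by simpa using hV 0)
  | insert i s hi ih =>
    rw [Finset.card_insert_of_notMem hi, mul_add, mul_one]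
    refine ((ih (fun j hj => hf j (Finset.mem_insert_of_mem hj))
      fun j hj => hg j (Finset.mem_insert_of_mem hj)).trans (M := 2) fun W hVW hW => ?_)
    refine (mul (hVW (hf i (Finset.mem_insert_self i s)))
      (hVW (hg i (Finset.mem_insert_self i s)))).trans (M := 1) fun W' hWW' hW' => ?_
    refine (add (hW' rfl) (hWW' (hW rfl))).mono subset_rfl le_rfl ?_
    simp [Finset.sum_insert hi]

end SLP

/-! ## Partial derivatives and degree bounds of bivariate polynomials -/

section Bivariate

open Polynomial

variable {K : Type*} [Field K]

theorem coeff_coeff_swap (p : K[X][Y]) (i j : ℕ) :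
    ((Bivariate.swap p).coeff i).coeff j = (p.coeff j).coeff i := by
  induction p using Polynomial.induction_on' with
  | add p q hp hq => simp [map_add, hp, hq]
  | monomial n f =>
    induction f using Polynomial.induction_on' with
    | add f g hf hg => simp only [map_add, coeff_add, hf, hg]
    | monomial m r =>
      rw [Bivariate.swap_monomial_monomial]
      simp only [coeff_monomial]
      split_ifs <;> simp_all [coeff_monomial]

/-- The partial derivative with respect to `y`. -/
def dY : Derivation K K[X][Y] K[X][Y] :=
  (Polynomial.derivative' (R := K[X])).restrictScalars K

theorem dY_apply (p : K[X][Y]) : dY p = derivative p := rfl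

/-- The partial derivative with respect to `x`. -/
def dX : Derivation K K[X][Y] K[X][Y] :=
  Derivation.mk' ((Bivariate.swap (R := K)).toLinearMap ∘ₗ (dY (K := K)).toLinearMap ∘ₗ
    (Bivariate.swap (R := K)).toLinearMap) fun p q => by
      simp [map_add, map_mul, Bivariate.swap_swap_apply]

theorem dX_apply (p : K[X][Y]) : dX p = Bivariate.swap (derivative (Bivariate.swap p)) := rfl

theorem coeff_coeff_dX (p : K[X][Y]) (i j : ℕ) :
    ((dX p).coeff j).coeff i = (p.coeff j).coeff (i + 1) * (i + 1) := by
  rw [dX_apply, coeff_coeff_swap, coeff_derivative]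
  have : ((i : K[X]) + 1) = C ((i : K) + 1) := by simp
  rw [this, coeff_mul_C, coeff_coeff_swap]

theorem coeff_dX (p : K[X][Y]) (j : ℕ) : (dX p).coeff j = derivative (p.coeff j) := by
  ext i
  rw [coeff_coeff_dX, coeff_derivative]

theorem dX_C (p : K[X]) : dX (C p) = C (derivative p) := by
  ext j : 1
  rw [coeff_dX, coeff_C, coeff_C]
  split_ifs <;> simp

theorem dX_Y : dX (K := K) Y = 0 := by
  ext j : 1
  rw [coeff_dX, coeff_X]
  split_ifs <;> simp

theorem dX_C_X : dX (K := K) (C X) = 1 := by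
  simp [dX_C]

theorem coeff_coeff_dY (p : K[X][Y]) (i j : ℕ) :
    ((dY p).coeff j).coeff i = (p.coeff (j + 1)).coeff i * (j + 1) := by
  rw [dY_apply, coeff_derivative]
  have : ((j : K[X]) + 1) = C ((j : K) + 1) := by simp
  rw [this, coeff_mul_C]

/-- The degree of `p` in `x` is at most `a` and the degree in `y` is at most `b`. -/
def DegLE (p : K[X][Y]) (a b : ℕ) : Prop :=
  ∀ i j, a < i ∨ b < j → (p.coeff j).coeff i = 0

namespace DegLE

variable {p q : K[X][Y]} {a b a' b' : ℕ}

theorem mono (h : DegLE p a b) (ha : a ≤ a') (hb : b ≤ b') : DegLE p a' b' :=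
  fun i j hij => h i j (by omega)

theorem natDegree_coeff (h : DegLE p a b) (j : ℕ) : (p.coeff j).natDegree ≤ a :=
  natDegree_le_iff_coeff_eq_zero.2 fun i hi => h i j (Or.inl hi)

theorem natDegree (h : DegLE p a b) : p.natDegree ≤ b :=
  natDegree_le_iff_coeff_eq_zero.2 fun j hj => by
    ext i
    simpa using h i j (Or.inr hj)

theorem of_natDegree (h : ∀ j, (p.coeff j).natDegree ≤ a) (h' : p.natDegree ≤ b) :
    DegLE p a b := by
  rintro i j (hi | hj)
  · exact coeff_eq_zero_of_natDegree_lt ((h j).trans_lt hi)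
  · rw [coeff_eq_zero_of_natDegree_lt (h'.trans_lt hj), coeff_zero]

theorem zero : DegLE (0 : K[X][Y]) a b := fun i j _ => by simp

theorem add (hp : DegLE p a b) (hq : DegLE q a b) : DegLE (p + q) a b :=
  fun i j h => by simp [hp i j h, hq i j h]

theorem neg (hp : DegLE p a b) : DegLE (-p) a b :=
  fun i j h => by simp [hp i j h]

theorem sub (hp : DegLE p a b) (hq : DegLE q a b) : DegLE (p - q) a b :=
  fun i j h => by simp [hp i j h, hq i j h]

theorem smul (c : K) (hp : DegLE p a b) : DegLE (c • p) a b :=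
  fun i j h => by simp [hp i j h]

theorem sum {α : Type*} (s : Finset α) (f : α → K[X][Y]) (h : ∀ i ∈ s, DegLE (f i) a b) :
    DegLE (∑ i ∈ s, f i) a b := by
  classical
  induction s using Finset.induction_on with
  | empty => simpa using zero
  | insert i s hi ih =>
    rw [Finset.sum_insert hi]
    exact (h i (Finset.mem_insert_self i s)).add (ih fun j hj => h j (Finset.mem_insert_of_mem hj))

theorem mul (hp : DegLE p a b) (hq : DegLE q a' b') : DegLE (p * q) (a + a') (b + b') := by
  refine of_natDegree (fun j => ?_) (natDegree_mul_le.trans (add_le_add hp.natDegree hq.natDegree))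
  rw [coeff_mul]
  refine natDegree_sum_le_of_forall_le _ _ fun k _ => ?_
  exact natDegree_mul_le.trans (add_le_add (hp.natDegree_coeff _) (hq.natDegree_coeff _))

theorem one : DegLE (1 : K[X][Y]) 0 0 := by
  refine of_natDegree (fun j => ?_) (by simp)
  rw [coeff_one]
  split_ifs <;> simp

theorem pow (hp : DegLE p a b) (n : ℕ) : DegLE (p ^ n) (n * a) (n * b) := by
  induction n with
  | zero => simpa using one
  | succ n ih =>
    rw [pow_succ, add_mul, add_mul, one_mul, one_mul]
    exact ih.mul hp

theorem prod {α : Type*} (s : Finset α) (f : α → K[X][Y]) (m n : α → ℕ)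
    (h : ∀ i ∈ s, DegLE (f i) (m i) (n i)) :
    DegLE (∏ i ∈ s, f i) (∑ i ∈ s, m i) (∑ i ∈ s, n i) := by
  classical
  induction s using Finset.induction_on with
  | empty => simpa using one
  | insert i s hi ih =>
    rw [Finset.prod_insert hi, Finset.sum_insert hi, Finset.sum_insert hi]
    exact (h i (Finset.mem_insert_self i s)).mul (ih fun j hj => h j (Finset.mem_insert_of_mem hj))

theorem dX (hp : DegLE p a b) : DegLE (dX p) a b :=
  fun i j h => by rw [coeff_coeff_dX, hp _ _ (by omega), zero_mul]

theorem dY (hp : DegLE p a b) : DegLE (dY p) a (b - 1) :=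
  fun i j h => by rw [coeff_coeff_dY, hp _ _ (by omega), zero_mul]

theorem C {p : K[X]} (hp : p.natDegree ≤ a) : DegLE (C p) a b := by
  refine of_natDegree (fun j => ?_) (by simp)
  rw [coeff_C]
  split_ifs <;> simp [hp]

theorem X_pow (n : ℕ) : DegLE ((X : K[X][Y]) ^ n) 0 n := by
  refine of_natDegree (fun j => ?_) (by simp)
  rw [coeff_X_pow]
  split_ifs <;> simp

end DegLE

theorem degLE_degX_degY (p : K[X][Y]) : DegLE p (degX p) (degY p) := by
  refine DegLE.of_natDegree (fun j => ?_) le_rfl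
  by_cases hj : j ∈ p.support
  · exact Finset.le_sup (f := fun j => (p.coeff j).natDegree) hj
  · rw [notMem_support_iff.1 hj]
    simp

theorem degX_le_of_degLE {p : K[X][Y]} {a b : ℕ} (h : DegLE p a b) : degX p ≤ a :=
  Finset.sup_le fun j _ => h.natDegree_coeff j

/-- Exchanging the variables turns a maximum over coefficients into `natDegree`, from which
additivity on products is inherited. -/
theorem degX_eq_natDegree_swap (p : K[X][Y]) : degX p = (Bivariate.swap p).natDegree := by
  apply le_antisymm
  · refine Finset.sup_le fun j _ => natDegree_le_iff_coeff_eq_zero.2 fun i hi => ?_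
    rw [← coeff_coeff_swap, coeff_eq_zero_of_natDegree_lt hi, coeff_zero]
  · refine natDegree_le_iff_coeff_eq_zero.2 fun i hi => ?_
    ext j
    rw [coeff_coeff_swap, degLE_degX_degY p i j (Or.inl hi), coeff_zero]

theorem degX_mul {p q : K[X][Y]} (hp : p ≠ 0) (hq : q ≠ 0) : degX (p * q) = degX p + degX q := by
  rw [degX_eq_natDegree_swap, degX_eq_natDegree_swap, degX_eq_natDegree_swap, map_mul,
    natDegree_mul ((map_ne_zero_iff _ (Bivariate.swap (R := K)).injective).2 hp)
      ((map_ne_zero_iff _ (Bivariate.swap (R := K)).injective).2 hq)]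

theorem degY_mul {p q : K[X][Y]} (hp : p ≠ 0) (hq : q ≠ 0) : degY (p * q) = degY p + degY q :=
  natDegree_mul hp hq

/-- `v * d q + (w - c * d v) * q`; up to the factor `v` this is the logarithmic derivative of
`q * v ^ (-c) * h` when that of `h` is `w / v`. -/
def twist (d : Derivation K K[X][Y] K[X][Y]) (v w : K[X][Y]) (c : K) (q : K[X][Y]) : K[X][Y] :=
  v * d q + (w - c • d v) * q

theorem twist_add (d : Derivation K K[X][Y] K[X][Y]) (v w : K[X][Y]) (c : K) (p q : K[X][Y]) :
    twist d v w c (p + q) = twist d v w c p + twist d v w c q := by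
  simp only [twist, map_add]
  ring

theorem twist_sum (d : Derivation K K[X][Y] K[X][Y]) (v w : K[X][Y]) (c : K) {α : Type*}
    (s : Finset α) (f : α → K[X][Y]) :
    twist d v w c (∑ i ∈ s, f i) = ∑ i ∈ s, twist d v w c (f i) := by
  classical
  induction s using Finset.induction_on with
  | empty => simp [twist]
  | insert i s hi ih => rw [Finset.sum_insert hi, Finset.sum_insert hi, twist_add, ih]

/-- The derivation kills polynomials in `x`. This linearity over `K[x]` is what makes the search for
a certificate a linear problem. -/
theorem twist_dY_C_mul (v w : K[X][Y]) (c : K) (f : K[X]) (q : K[X][Y]) :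
    twist dY v w c (C f * q) = C f * twist dY v w c q := by
  simp only [twist, dY_apply, derivative_C_mul]
  ring

/-! ### Computing with bivariate polynomials -/

variable {Ω : Type*}

/-- The coefficient functions of a polynomial that depends on the input. -/
def coef (p : Ω → K[X][Y]) (i j : ℕ) : Ω → K := fun H => ((p H).coeff j).coeff i

/-- The set of all coefficient functions. -/
def coefs (p : Ω → K[X][Y]) : Set (Ω → K) := {f | ∃ i j, f = coef p i j}

/-- All coefficients of `p` are available. -/
def Known (V : Set (Ω → K)) (p : Ω → K[X][Y]) : Prop := coefs p ⊆ V

theorem Known.coef_mem {V : Set (Ω → K)} {p : Ω → K[X][Y]} (h : Known V p) (i j : ℕ) :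
    coef p i j ∈ V := h ⟨i, j, rfl⟩

theorem Known.mono {V V' : Set (Ω → K)} {p : Ω → K[X][Y]} (h : Known V p) (hV : V ⊆ V') :
    Known V' p := h.trans hV

theorem known_iff {V : Set (Ω → K)} {p : Ω → K[X][Y]} : Known V p ↔ ∀ i j, coef p i j ∈ V :=
  ⟨fun h => h.coef_mem, by rintro h _ ⟨i, j, rfl⟩; exact h i j⟩

theorem known_const {V : Set (Ω → K)} (hV : HasConsts V) (p : K[X][Y]) : Known V fun _ => p :=
  known_iff.2 fun _ _ => hV _

variable {V : Set (Ω → K)} {p q : Ω → K[X][Y]} {a b a' b' : ℕ}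

/-- Outside the box given by the degrees the coefficient functions are the constant zero, so only
finitely many of them cost anything. -/
theorem slp_coefs (hV : HasConsts V) (hp : ∀ H, DegLE (p H) a b) (c : ℕ)
    (h : ∀ i j, SLP V c {coef p i j}) : SLP V ((a + 1) * (b + 1) * c) (coefs p) := by
  have h₁ := SLP.biUnion (V := V) (N := c) (Finset.range (a + 1) ×ˢ Finset.range (b + 1))
    (fun s => {coef p s.1 s.2}) fun s _ => h s.1 s.2
  rw [Finset.card_product, Finset.card_range, Finset.card_range] at h₁
  refine (h₁.union (M := 0) (SLP.of_subset (Set.singleton_subset_iff.2 (hV 0)))).mono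
    subset_rfl (by omega) ?_
  rintro _ ⟨i, j, rfl⟩
  by_cases hij : a < i ∨ b < j
  · right
    funext H
    exact hp H i j hij
  · left
    push Not at hij
    exact Set.mem_biUnion (x := (i, j)) (by simp; omega) rfl

theorem slp_add (hV : HasConsts V) (hp : ∀ H, DegLE (p H) a b) (hq : ∀ H, DegLE (q H) a b)
    (kp : Known V p) (kq : Known V q) :
    SLP V ((a + 1) * (b + 1)) (coefs fun H => p H + q H) := by
  refine (slp_coefs (p := fun H => p H + q H) hV (fun H => (hp H).add (hq H)) 1
    fun i j => ?_).mono subset_rfl (by omega) subset_rfl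
  refine (SLP.add (kp.coef_mem i j) (kq.coef_mem i j)).mono subset_rfl le_rfl ?_
  rw [Set.singleton_subset_iff, Set.mem_singleton_iff]
  funext H
  simp [coef]

theorem slp_sub (hV : HasConsts V) (hp : ∀ H, DegLE (p H) a b) (hq : ∀ H, DegLE (q H) a b)
    (kp : Known V p) (kq : Known V q) :
    SLP V ((a + 1) * (b + 1)) (coefs fun H => p H - q H) := by
  refine (slp_coefs (p := fun H => p H - q H) hV (fun H => (hp H).sub (hq H)) 1
    fun i j => ?_).mono subset_rfl (by omega) subset_rfl
  refine (SLP.sub (kp.coef_mem i j) (kq.coef_mem i j)).mono subset_rfl le_rfl ?_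
  rw [Set.singleton_subset_iff, Set.mem_singleton_iff]
  funext H
  simp [coef]

theorem slp_smul (hV : HasConsts V) {c : Ω → K} (hc : c ∈ V) (hp : ∀ H, DegLE (p H) a b)
    (kp : Known V p) : SLP V ((a + 1) * (b + 1)) (coefs fun H => c H • p H) := by
  refine (slp_coefs (p := fun H => c H • p H) hV (fun H => (hp H).smul _) 1
    fun i j => ?_).mono subset_rfl (by omega) subset_rfl
  refine (SLP.mul hc (kp.coef_mem i j)).mono subset_rfl le_rfl ?_
  rw [Set.singleton_subset_iff, Set.mem_singleton_iff]
  funext H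
  simp [coef]

theorem slp_dX (hV : HasConsts V) (hp : ∀ H, DegLE (p H) a b) (kp : Known V p) :
    SLP V ((a + 1) * (b + 1)) (coefs fun H => dX (p H)) := by
  refine (slp_coefs (p := fun H => dX (p H)) hV (fun H => (hp H).dX) 1
    fun i j => ?_).mono subset_rfl (by omega) subset_rfl
  refine (SLP.mul (kp.coef_mem (i + 1) j) (hV ((i : K) + 1))).mono subset_rfl le_rfl ?_
  rw [Set.singleton_subset_iff, Set.mem_singleton_iff]
  funext H
  simp [coef, coeff_coeff_dX]

theorem slp_dY (hV : HasConsts V) (hp : ∀ H, DegLE (p H) a b) (kp : Known V p) :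
    SLP V ((a + 1) * (b + 1)) (coefs fun H => dY (p H)) := by
  refine (slp_coefs (p := fun H => dY (p H)) hV (fun H => (hp H).dY.mono le_rfl (Nat.sub_le _ _)) 1
    fun i j => ?_).mono subset_rfl (by omega) subset_rfl
  refine (SLP.mul (kp.coef_mem i (j + 1)) (hV ((j : K) + 1))).mono subset_rfl le_rfl ?_
  rw [Set.singleton_subset_iff, Set.mem_singleton_iff]
  funext H
  simp [coef, coeff_coeff_dY]

/-- The sum runs over the degree box of the first factor only, whatever the size of the second; the
cost of a product with a small factor depends on this. -/
theorem coeff_coeff_mul (p q : K[X][Y]) (hp : DegLE p a b) (i j : ℕ) :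
    ((p * q).coeff j).coeff i = ∑ s ∈ Finset.range (a + 1) ×ˢ Finset.range (b + 1),
      (p.coeff s.2).coeff s.1 *
        (if s.1 ≤ i ∧ s.2 ≤ j then (q.coeff (j - s.2)).coeff (i - s.1) else 0) := by
  rw [Finset.sum_product_right, coeff_mul, finsetSum_coeff, Finset.Nat.sum_antidiagonal_eq_sum_range_succ
    (f := fun k l => (p.coeff k * q.coeff l).coeff i)]
  have hin : ∀ k l, (p.coeff k * q.coeff l).coeff i = ∑ s ∈ Finset.range (a + 1),
      (p.coeff k).coeff s * (if s ≤ i then (q.coeff l).coeff (i - s) else 0) := by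
    intro k l
    rw [coeff_mul, Finset.Nat.sum_antidiagonal_eq_sum_range_succ
      (f := fun m n => (p.coeff k).coeff m * (q.coeff l).coeff n)]
    have e₁ : ∀ n, (∀ s, n ≤ s → (s ≤ i → (p.coeff k).coeff s = 0)) →
        ∑ s ∈ Finset.range n, (p.coeff k).coeff s * (if s ≤ i then (q.coeff l).coeff (i - s) else 0)
        = ∑ s ∈ Finset.range (max (i + 1) (a + 1)),
          (p.coeff k).coeff s * (if s ≤ i then (q.coeff l).coeff (i - s) else 0) ∨
          (max (i + 1) (a + 1)) < n := by
      intro n hn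
      by_cases h : (max (i + 1) (a + 1)) < n
      · exact Or.inr h
      left
      refine Finset.sum_subset (Finset.range_mono (not_lt.1 h)) fun s _ hs => ?_
      rw [Finset.mem_range, not_lt] at hs
      by_cases hsi : s ≤ i
      · rw [hn s hs hsi, zero_mul]
      · rw [if_neg hsi, mul_zero]
    rw [(e₁ (a + 1) fun s hs _ => hp s k (Or.inl (by omega))).resolve_right (by omega),
      ← (e₁ (i + 1) fun s hs hs' => by omega).resolve_right (by omega)]
    refine Finset.sum_congr rfl fun s hs => ?_
    rw [if_pos (by simpa [Nat.lt_succ_iff] using hs)]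
  have e₂ : ∀ n, (∀ k, n ≤ k → (k ≤ j → p.coeff k = 0)) →
      ∑ k ∈ Finset.range n, (if k ≤ j then (p.coeff k * q.coeff (j - k)).coeff i else 0)
      = ∑ k ∈ Finset.range (max (j + 1) (b + 1)),
        (if k ≤ j then (p.coeff k * q.coeff (j - k)).coeff i else 0) ∨
        (max (j + 1) (b + 1)) < n := by
    intro n hn
    by_cases h : (max (j + 1) (b + 1)) < n
    · exact Or.inr h
    left
    refine Finset.sum_subset (Finset.range_mono (not_lt.1 h)) fun k _ hk => ?_
    rw [Finset.mem_range, not_lt] at hk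
    by_cases hkj : k ≤ j
    · rw [hn k hk hkj]
      simp
    · rw [if_neg hkj]
  have e₃ : ∑ k ∈ Finset.range (j + 1), (p.coeff k * q.coeff (j - k)).coeff i =
      ∑ k ∈ Finset.range (j + 1), (if k ≤ j then (p.coeff k * q.coeff (j - k)).coeff i else 0) :=
    Finset.sum_congr rfl fun k hk => by rw [if_pos (by simpa [Nat.lt_succ_iff] using hk)]
  rw [e₃, (e₂ (j + 1) fun s hs hs' => by omega).resolve_right (by omega),
    ← (e₂ (b + 1) fun k hk _ => by
      ext s
      simpa using hp s k (Or.inr (by omega))).resolve_right (by omega)]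
  refine Finset.sum_congr rfl fun k _ => ?_
  by_cases hkj : k ≤ j
  · simp [hkj, hin]
  · simp [hkj]

/-- The bound is the number of coefficients of the product times twice the number of those of the
first factor, so the smaller factor should come first. -/
theorem slp_mul (hV : HasConsts V) (hp : ∀ H, DegLE (p H) a b) (hq : ∀ H, DegLE (q H) a' b')
    (kp : Known V p) (kq : Known V q) :
    SLP V ((a + a' + 1) * (b + b' + 1) * (2 * ((a + 1) * (b + 1)))) (coefs fun H => p H * q H) := by
  refine slp_coefs (p := fun H => p H * q H) hV (fun H => (hp H).mul (hq H)) _ fun i j => ?_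
  have h := SLP.sum_mul hV (Finset.range (a + 1) ×ˢ Finset.range (b + 1))
    (fun s => coef p s.1 s.2)
    (fun s => if s.1 ≤ i ∧ s.2 ≤ j then coef q (i - s.1) (j - s.2) else fun _ => 0)
    (fun s _ => kp.coef_mem _ _) (fun s _ => by
      split_ifs
      · exact kq.coef_mem _ _
      · exact hV 0)
  rw [Finset.card_product, Finset.card_range, Finset.card_range] at h
  refine h.mono subset_rfl le_rfl ?_
  rw [Set.singleton_subset_iff, Set.mem_singleton_iff]
  funext H
  simp only [coef]
  rw [coeff_coeff_mul _ _ (hp H)]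
  refine Finset.sum_congr rfl fun s _ => ?_
  split_ifs <;> rfl

theorem slp_derivation {d : Derivation K K[X][Y] K[X][Y]} (hd : d = dX ∨ d = dY)
    (hV : HasConsts V) (hp : ∀ H, DegLE (p H) a b) (kp : Known V p) :
    SLP V ((a + 1) * (b + 1)) (coefs fun H => d (p H)) := by
  rcases hd with rfl | rfl
  · exact slp_dX hV hp kp
  · exact slp_dY hV hp kp

theorem DegLE.derivation {d : Derivation K K[X][Y] K[X][Y]} (hd : d = _root_.dX ∨ d = _root_.dY)
    {p : K[X][Y]} (hp : DegLE p a b) : DegLE (d p) a b := by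
  rcases hd with rfl | rfl
  · exact hp.dX
  · exact hp.dY.mono le_rfl (Nat.sub_le _ _)

theorem DegLE.twist {d : Derivation K K[X][Y] K[X][Y]} (hd : d = _root_.dX ∨ d = _root_.dY)
    {v w q : K[X][Y]} (hv : DegLE v a b) (hw : DegLE w a b)
    (c : K) (hq : DegLE q a' b') : DegLE (_root_.twist d v w c q) (a + a') (b + b') :=
  (hv.mul (hq.derivation hd)).add ((hw.sub ((hv.derivation hd).smul c)).mul hq)

/-- The two products with a first factor of the size of `v` account for most of the bound;
derivatives, scalings and additions are linear in the number of coefficients. -/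
theorem slp_twist {d : Derivation K K[X][Y] K[X][Y]} (hd : d = dX ∨ d = dY) (hV : HasConsts V)
    {v w : Ω → K[X][Y]} (hv : ∀ H, DegLE (v H) a b) (hw : ∀ H, DegLE (w H) a b)
    (hq : ∀ H, DegLE (q H) a' b') (kv : Known V v) (kw : Known V w) (kq : Known V q) (c : K) :
    SLP V (9 * ((a + a' + 1) * (b + b' + 1)) * ((a + 1) * (b + 1)))
      (coefs fun H => twist d (v H) (w H) c (q H)) := by
  set P := (a + a' + 1) * (b + b' + 1) with hP
  set Q := (a + 1) * (b + 1) with hQ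
  have hQ1 : 1 ≤ Q := Nat.mul_pos (by omega) (by omega)
  have hP1 : 1 ≤ P := Nat.mul_pos (by omega) (by omega)
  have hq' : (a' + 1) * (b' + 1) ≤ P := Nat.mul_le_mul (by omega) (by omega)
  have hcost : Q + (Q + (Q + ((a' + 1) * (b' + 1) + (P * (2 * Q) + (P * (2 * Q) + P))))) ≤
      9 * P * Q := by
    have h₁ : P ≤ P * Q := Nat.le_mul_of_pos_right _ hQ1
    have h₂ : Q ≤ P * Q := Nat.le_mul_of_pos_left _ hP1
    have h₃ : P * (2 * Q) = 2 * (P * Q) := by ring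
    have h₄ : 9 * P * Q = 9 * (P * Q) := by ring
    rw [h₃, h₄]
    omega
  refine SLP.mono ?_ subset_rfl hcost subset_rfl
  refine (slp_derivation hd hV hv kv).trans fun V₁ s₁ k₁ => ?_
  refine (slp_smul (hV.mono s₁) (s₁ (hV c)) (fun H => (hv H).derivation hd) k₁).trans
    fun V₂ s₂ k₂ => ?_
  refine (slp_sub ((hV.mono s₁).mono s₂) hw (fun H => ((hv H).derivation hd).smul c)
    (kw.mono (s₁.trans s₂)) k₂).trans fun V₃ s₃ k₃ => ?_
  have t₃ := s₁.trans (s₂.trans s₃)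
  refine (slp_derivation hd (hV.mono t₃) hq (kq.mono t₃)).trans fun V₄ s₄ k₄ => ?_
  have t₄ := t₃.trans s₄
  refine (slp_mul (hV.mono t₄) hv (fun H => (hq H).derivation hd) (kv.mono t₄) k₄).trans
    fun V₅ s₅ k₅ => ?_
  have t₅ := t₄.trans s₅
  refine (slp_mul (hV.mono t₅) (fun H => (hw H).sub (((hv H).derivation hd).smul c)) hq
    (Set.Subset.trans k₃ (s₄.trans s₅)) (kq.mono t₅)).trans fun V₆ s₆ k₆ => ?_
  exact slp_add (hV.mono (t₅.trans s₆)) (fun H => (hv H).mul ((hq H).derivation hd))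
    (fun H => ((hw H).sub (((hv H).derivation hd).smul c)).mul (hq H)) (Set.Subset.trans k₅ s₆) k₆

/-- Multiplication by evaluation and interpolation in `x`. -/
theorem slp_mul_interpolation [CharZero K] (hV : HasConsts V) (hp : ∀ H, DegLE (p H) a b)
    (hq : ∀ H, DegLE (q H) a' b') (kp : Known V p) (kq : Known V q) {N : ℕ}
    (ha : a + a' < N) (hb : b + b' < N) : SLP V (8 * N ^ 3) (coefs fun H => p H * q H) := by
  -- The powers of the nodes are constants, hence free. Each of the `N ^ 2` values costs `2 * N`
  -- operations, and so does each coefficient in the convolution and in the interpolation below.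
  have heval : ∀ (W : Set (Ω → K)) (r : Ω → K[X][Y]), HasConsts W → Known W r →
      (∀ H j, ((r H).coeff j).natDegree < N) →
      SLP W (2 * N ^ 3) (⋃ s ∈ Finset.range N ×ˢ Finset.range N,
        {fun H => ((r H).coeff s.1).eval (s.2 : K)}) := by
    intro W r hW kr hr
    refine (SLP.biUnion (Finset.range N ×ˢ Finset.range N) _ fun s _ =>
      (SLP.sum_mul hW (Finset.range N) (fun i => coef r i s.1) (fun i _ => (s.2 : K) ^ i)
        (fun i _ => kr.coef_mem _ _) fun i _ => hW _).mono (A' := {fun H =>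
          ((r H).coeff s.1).eval (s.2 : K)}) subset_rfl le_rfl ?_).mono subset_rfl ?_ subset_rfl
    · rw [Set.singleton_subset_iff, Set.mem_singleton_iff]
      funext H
      rw [eval_eq_sum_range' (hr H s.1)]
      rfl
    · simp only [Finset.card_product, Finset.card_range]
      exact le_of_eq (by ring)
  have hmem : ∀ {j k : ℕ}, j < N → k < N → (j, k) ∈ Finset.range N ×ˢ Finset.range N := by
    intro j k hj hk
    simp [hj, hk]
  refine SLP.mono ?_ subset_rfl (show 2 * N ^ 3 + (2 * N ^ 3 + (2 * N ^ 3 + 2 * N ^ 3)) ≤ 8 * N ^ 3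
    by omega) subset_rfl
  refine (heval V p hV kp fun H j => ((hp H).natDegree_coeff j).trans_lt (by omega)).trans
    fun V₁ s₁ k₁ => ?_
  refine (heval V₁ q (hV.mono s₁) (kq.mono s₁)
    fun H j => ((hq H).natDegree_coeff j).trans_lt (by omega)).trans fun V₂ s₂ k₂ => ?_
  have hV₂ := (hV.mono s₁).mono s₂
  have hprod : SLP V₂ (2 * N ^ 3) (⋃ s ∈ Finset.range N ×ˢ Finset.range N,
      {fun H => ((p H * q H).coeff s.1).eval (s.2 : K)}) := by
    refine (SLP.biUnion (Finset.range N ×ˢ Finset.range N) _ fun s hs =>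
      (SLP.sum_mul hV₂ (Finset.range N) (fun l H => ((p H).coeff l).eval (s.2 : K))
        (fun l => if l ≤ s.1 then fun H => ((q H).coeff (s.1 - l)).eval (s.2 : K) else fun _ => 0)
        (fun l hl => s₂ (k₁ ?_)) fun l hl => ?_).mono (A' := {fun H =>
          ((p H * q H).coeff s.1).eval (s.2 : K)}) subset_rfl le_rfl ?_).mono subset_rfl ?_ subset_rfl
    · rw [Finset.mem_product, Finset.mem_range, Finset.mem_range] at hs
      exact Set.mem_biUnion (hmem (Finset.mem_range.1 hl) hs.2) rfl
    · rw [Finset.mem_product, Finset.mem_range, Finset.mem_range] at hs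
      split_ifs
      · exact k₂ (Set.mem_biUnion (hmem (Nat.lt_of_le_of_lt (Nat.sub_le _ _) hs.1) hs.2) rfl)
      · exact hV₂ 0
    · rw [Finset.mem_product, Finset.mem_range, Finset.mem_range] at hs
      rw [Set.singleton_subset_iff, Set.mem_singleton_iff]
      funext H
      rw [coeff_mul, Finset.Nat.sum_antidiagonal_eq_sum_range_succ
        (f := fun k l => (p H).coeff k * (q H).coeff l), eval_finsetSum]
      rw [← Finset.sum_subset (Finset.range_mono (show s.1 + 1 ≤ N by omega))]
      · refine Finset.sum_congr rfl fun l hl => ?_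
        rw [if_pos (by simpa [Nat.lt_succ_iff] using hl), eval_mul]
      · intro l _ hl
        rw [if_neg (by simpa [Nat.lt_succ_iff] using hl), mul_zero]
    · simp only [Finset.card_product, Finset.card_range]
      exact le_of_eq (by ring)
  refine hprod.trans fun V₃ s₃ k₃ => ?_
  have hV₃ := hV₂.mono s₃
  have hpq : ∀ H, DegLE (p H * q H) (N - 1) (N - 1) := fun H =>
    ((hp H).mul (hq H)).mono (by omega) (by omega)
  -- The coefficients of the Lagrange basis are constants too, so interpolation needs no divisions.
  -- The nodes are distinct in characteristic zero.
  have h₁ := SLP.biUnion (V := V₃) (N := 2 * N) (Finset.range N ×ˢ Finset.range N)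
    (fun s => {coef (fun H => p H * q H) s.1 s.2}) (by
      intro s hs
      rw [Finset.mem_product, Finset.mem_range, Finset.mem_range] at hs
      have := SLP.sum_mul hV₃ (Finset.range N)
        (fun k H => ((p H * q H).coeff s.2).eval (k : K))
        (fun k _ => (Lagrange.basis (Finset.range N) (fun n : ℕ => (n : K)) k).coeff s.1)
        (fun k hk => k₃ (Set.mem_biUnion (hmem hs.2 (Finset.mem_range.1 hk)) rfl))
        fun k _ => hV₃ _
      rw [Finset.card_range] at this
      refine this.mono subset_rfl le_rfl ?_
      rw [Set.singleton_subset_iff, Set.mem_singleton_iff]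
      funext H
      have hd : ((p H * q H).coeff s.2).degree < (Finset.range N).card := by
        rw [Finset.card_range]
        refine (degree_le_of_natDegree_le ((hpq H).natDegree_coeff s.2)).trans_lt ?_
        exact_mod_cast (by omega : N - 1 < N)
      have := Lagrange.eq_interpolate (s := Finset.range N) (v := fun n : ℕ => (n : K))
        (fun _ _ _ _ h => Nat.cast_injective h) hd
      unfold coef
      conv_lhs => rw [this]
      rw [Lagrange.interpolate_apply, finsetSum_coeff]
      exact Finset.sum_congr rfl fun k _ => by rw [coeff_C_mul])
  refine (h₁.union (M := 0) (SLP.of_subset (Set.singleton_subset_iff.2 (hV₃ 0)))).mono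
    subset_rfl ?_ ?_
  · simp only [Finset.card_product, Finset.card_range]
    exact le_of_eq (by ring)
  · rintro _ ⟨i, j, rfl⟩
    by_cases hij : N - 1 < i ∨ N - 1 < j
    · right
      funext H
      exact hpq H i j hij
    · left
      push Not at hij
      exact Set.mem_biUnion (x := (i, j)) (by simp; omega) rfl

end Bivariate

/-! ## Gaussian elimination -/

section Gauss

variable {K Ω : Type*} [Field K]

/-- This is one step of elimination. The pivot row is not removed but becomes zero, so the row index
type stays the same and an induction on the number of columns is possible. -/
theorem mulVec_eq_zero_iff_of_pivot {ρ : Type*} {m : ℕ} (A : Matrix ρ (Fin (m + 1)) K) {p : ρ}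
    (hp : A p 0 ≠ 0) (u : Fin (m + 1) → K) :
    A.mulVec u = 0 ↔
      (Matrix.of fun i (j : Fin m) => A i j.succ - A i 0 / A p 0 * A p j.succ).mulVec
        (fun j => u j.succ) = 0 ∧
      u 0 = (0 - ∑ j : Fin m, A p j.succ * u j.succ) / A p 0 := by
  have hrow : ∀ i, A.mulVec u i = A i 0 * u 0 + ∑ j : Fin m, A i j.succ * u j.succ := fun i => by
    simp [Matrix.mulVec, dotProduct, Fin.sum_univ_succ]
  have hrow' : ∀ i, (Matrix.of fun i (j : Fin m) =>
      A i j.succ - A i 0 / A p 0 * A p j.succ).mulVec (fun j => u j.succ) i =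
      ∑ j : Fin m, A i j.succ * u j.succ - A i 0 / A p 0 * ∑ j : Fin m, A p j.succ * u j.succ := by
    intro i
    simp only [Matrix.mulVec, dotProduct, Matrix.of_apply, sub_mul, Finset.sum_sub_distrib,
      Finset.mul_sum, mul_assoc]
  constructor
  · intro h
    have h0 : u 0 = (0 - ∑ j : Fin m, A p j.succ * u j.succ) / A p 0 := by
      have := congrFun h p
      rw [hrow, Pi.zero_apply] at this
      rw [eq_div_iff hp]
      linear_combination this
    refine ⟨funext fun i => ?_, h0⟩
    have := congrFun h i
    rw [hrow, h0, Pi.zero_apply] at this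
    rw [hrow', Pi.zero_apply]
    linear_combination this
  · rintro ⟨h, h0⟩
    funext i
    have := congrFun h i
    rw [hrow', Pi.zero_apply] at this
    rw [hrow, h0, Pi.zero_apply]
    linear_combination this

/-- Computing a nonzero element of the kernel of a matrix, or showing that there is none. -/
theorem Reach.exists_kernel {ρ : Type*} [Fintype ρ] (m : ℕ) (A : Ω → Matrix ρ (Fin m) K)
    (S : Set Ω) (V : Set (Ω → K)) (hV : HasConsts V) (hA : ∀ i j, (fun H => A H i j) ∈ V) :
    Reach (fun S' V' => (∀ H ∈ S', ∀ u, (A H).mulVec u = 0 → u = 0) ∨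
      ∃ u : Fin m → Ω → K, (∀ j, u j ∈ V') ∧
        ∀ H ∈ S', (fun j => u j H) ≠ 0 ∧ (A H).mulVec (fun j => u j H) = 0)
      (m * (4 * (Fintype.card ρ + 1) * (m + 1))) S V := by
  classical
  induction m generalizing S V with
  | zero => exact .done (Or.inl fun H _ u _ => Subsingleton.elim _ _)
  | succ m ih =>
    set k := Fintype.card ρ with hk
    have hcost : k + (k * 1 + (k * m * 2 + (m * (4 * (k + 1) * (m + 1)) + (2 * m + 2)))) ≤
        (m + 1) * (4 * (k + 1) * (m + 1 + 1)) := by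
      have h₁ : (m + 1) * (4 * (k + 1) * (m + 1 + 1)) =
          m * (4 * (k + 1) * (m + 1)) + 8 * (k * m) + 8 * k + 8 * m + 8 := by ring
      have h₂ : k * m * 2 = 2 * (k * m) := by ring
      rw [h₁, h₂]
      omega
    refine Reach.mono_cost ?_ hcost
    have hfind := Reach.find_nonzero (Finset.univ : Finset ρ).toList (fun i H => A H i 0) S V
      fun i _ => hA i 0
    rw [Finset.length_toList, Finset.card_univ, ← hk] at hfind
    refine hfind.bind fun S₁ V₁ hS₁ hV₁ hgoal => ?_
    rcases hgoal with h | ⟨l₁, p, l₂, -, -, hp⟩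
    -- If the first column vanishes, the first unit vector is in the kernel.
    · refine .done (Or.inr ⟨fun j _ => if j = 0 then 1 else 0, fun j => (hV.mono hV₁) _,
        fun H hH => ⟨fun h0 => ?_, ?_⟩⟩)
      · simpa using congrFun h0 0
      · funext i
        simpa [Matrix.mulVec, dotProduct] using h i (by simp) H hH
    · -- the quotients `A i 0 / A p 0`
      have hquot : ∀ s : Finset ρ, ∀ (M : ℕ) (G : Set Ω → Set (Ω → K) → Prop) (V₀ : Set (Ω → K)),
          V₁ ⊆ V₀ → (∀ V', V₀ ⊆ V' → (∀ i ∈ s, (fun H => A H i 0 / A H p 0) ∈ V') →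
            Reach G M S₁ V') → Reach G (s.card + M) S₁ V₀ := by
        intro s
        induction s using Finset.induction_on with
        | empty =>
          intro M G V₀ hV₀ hG
          exact (hG V₀ subset_rfl (by simp)).mono_cost (by simp)
        | insert i s hi ih' =>
          intro M G V₀ hV₀ hG
          rw [Finset.card_insert_of_notMem hi, add_assoc]
          refine ih' (1 + M) G V₀ hV₀ fun V' hV' hmem => ?_
          rw [add_comm]
          refine .compute .div (fun H => A H i 0) (fun H => A H p 0)
            (hV' (hV₀ (hV₁ (hA i 0)))) (hV' (hV₀ (hV₁ (hA p 0)))) (fun _ => hp) ?_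
          refine hG _ (hV'.trans (Set.subset_insert _ _)) fun j hj => ?_
          rcases Finset.mem_insert.1 hj with rfl | hj
          · exact Set.mem_insert _ _
          · exact Set.mem_insert_of_mem _ (hmem j hj)
      have hq := hquot Finset.univ (k * m * 2 + (m * (4 * (k + 1) * (m + 1)) + (2 * m + 2)))
      rw [Finset.card_univ, ← hk] at hq
      rw [mul_one]
      refine hq _ V₁ subset_rfl fun V₂ hV₂ hmem₂ => ?_
      have hc₂ := (hV.mono hV₁).mono hV₂
      have hA₂ : ∀ i j, (fun H => A H i j) ∈ V₂ := fun i j => hV₂ (hV₁ (hA i j))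
      have helim := SLP.biUnion (V := V₂) (N := 2) (Finset.univ : Finset (ρ × Fin m))
        (fun s => {fun H => A H s.1 s.2.succ - A H s.1 0 / A H p 0 * A H p s.2.succ}) (by
          intro s _
          refine (SLP.mul (hmem₂ s.1 (Finset.mem_univ _)) (hA₂ p s.2.succ)).trans
            (M := 1) fun W hW hm => ?_
          exact SLP.sub (hW (hA₂ s.1 s.2.succ)) (hm rfl))
      rw [Finset.card_univ, Fintype.card_prod, Fintype.card_fin, ← hk] at helim
      refine helim.reach fun V₃ hV₃ hmem₃ => ?_
      refine (ih (fun H => Matrix.of fun i (j : Fin m) =>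
        A H i j.succ - A H i 0 / A H p 0 * A H p j.succ) S₁ V₃ (hc₂.mono hV₃) fun i j => hmem₃
          (Set.mem_biUnion (x := (i, j)) (Finset.mem_coe.2 (Finset.mem_univ _)) rfl)).bind
            fun S₄ V₄ hS₄ hV₄ hgoal => ?_
      rcases hgoal with h | ⟨u, hu, hker⟩
      · refine .done (Or.inl fun H hH u hu => ?_)
        rw [mulVec_eq_zero_iff_of_pivot _ (hp H (hS₄ hH))] at hu
        have h' := h H hH _ hu.1
        have hs : ∀ j : Fin m, u j.succ = 0 := fun j => congrFun h' j
        funext j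
        refine Fin.cases ?_ hs j
        simpa [hs] using hu.2
      · have hA₄ : ∀ i j, (fun H => A H i j) ∈ V₄ := fun i j => hV₄ (hV₃ (hA₂ i j))
        have hc₄ := (hc₂.mono hV₃).mono hV₄
        have hsum := SLP.sum_mul hc₄ (Finset.univ : Finset (Fin m)) (fun j H => A H p j.succ) u
          (fun j _ => hA₄ p j.succ) fun j _ => hu j
        rw [Finset.card_univ, Fintype.card_fin] at hsum
        refine hsum.reach fun V₅ hV₅ hmem₅ => ?_
        refine .compute .sub (fun _ => 0) _ (hV₅ (hc₄ 0)) (hmem₅ rfl) (by simp) ?_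
        refine .compute .div _ (fun H => A H p 0) (Set.mem_insert _ _)
          (Set.mem_insert_of_mem _ (hV₅ (hA₄ p 0))) (fun _ H hH => hp H (hS₄ hH)) ?_
        refine .done (Or.inr ⟨Fin.cons (fun H =>
          (0 - ∑ j : Fin m, A H p j.succ * u j H) / A H p 0) u, fun j => ?_, fun H hH => ?_⟩)
        · refine Fin.cases ?_ (fun j => ?_) j
          · exact Set.mem_insert _ _
          · exact Set.mem_insert_of_mem _ (Set.mem_insert_of_mem _ (hV₅ (hu j)))
        · obtain ⟨h1, h2⟩ := hker H hH
          constructor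
          · intro h0
            exact h1 (funext fun j => by simpa using congrFun h0 j.succ)
          · rw [mulVec_eq_zero_iff_of_pivot _ (hp H (hS₄ hH))]
            exact ⟨by simpa using h2, by simp⟩

end Gauss

/-! ## Creative telescoping relations from polynomial identities -/

section Relations

open Polynomial

variable {K : Type*} [Field K]

section Extension

variable {E : Type*} [Field E] [Algebra K E] [Algebra K[X][Y] E] [IsScalarTower K K[X][Y] E]

theorem derivation_algebraMap (δ : Derivation K E E) (d : Derivation K K[X][Y] K[X][Y])
    (hx : δ (algebraMap K[X][Y] E (C X)) = algebraMap K[X][Y] E (d (C X)))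
    (hy : δ (algebraMap K[X][Y] E Y) = algebraMap K[X][Y] E (d Y)) (p : K[X][Y]) :
    δ (algebraMap K[X][Y] E p) = algebraMap K[X][Y] E (d p) := by
  have hmul : ∀ {p q : K[X][Y]}, δ (algebraMap K[X][Y] E p) = algebraMap K[X][Y] E (d p) →
      δ (algebraMap K[X][Y] E q) = algebraMap K[X][Y] E (d q) →
      δ (algebraMap K[X][Y] E (p * q)) = algebraMap K[X][Y] E (d (p * q)) := by
    intro p q hp hq
    simp only [map_mul, Derivation.leibniz, smul_eq_mul, hp, hq, map_add]
  have hpow : ∀ {p : K[X][Y]}, δ (algebraMap K[X][Y] E p) = algebraMap K[X][Y] E (d p) →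
      ∀ n : ℕ, δ (algebraMap K[X][Y] E (p ^ n)) = algebraMap K[X][Y] E (d (p ^ n)) := by
    intro p hp n
    induction n with
    | zero => simp
    | succ n ih =>
      rw [pow_succ]
      exact hmul ih hp
  have hc : ∀ c : K, δ (algebraMap K[X][Y] E (C (C c))) = algebraMap K[X][Y] E (d (C (C c))) := by
    intro c
    have h₁ : (C (C c) : K[X][Y]) = algebraMap K K[X][Y] c := rfl
    rw [h₁, ← IsScalarTower.algebraMap_apply, Derivation.map_algebraMap, Derivation.map_algebraMap,
      map_zero]
  induction p using Polynomial.induction_on' with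
  | add p q hp hq => simp only [map_add, hp, hq]
  | monomial n f =>
    rw [← C_mul_X_pow_eq_monomial]
    refine hmul ?_ (hpow hy n)
    induction f using Polynomial.induction_on' with
    | add f g hf hg => simp only [map_add, hf, hg]
    | monomial m r =>
      rw [← C_mul_X_pow_eq_monomial, map_mul, map_pow]
      exact hmul (hc r) (hpow hx m)

theorem DiffFieldExt.Dx_algebraMap (D : DiffFieldExt K E) (p : K[X][Y]) :
    D.Dx (algebraMap K[X][Y] E p) = algebraMap K[X][Y] E (dX p) :=
  derivation_algebraMap D.Dx dX (by rw [D.Dx_x, dX_C_X, map_one]) (by rw [D.Dx_y, dX_Y, map_zero]) p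

theorem DiffFieldExt.Dy_algebraMap (D : DiffFieldExt K E) (p : K[X][Y]) :
    D.Dy (algebraMap K[X][Y] E p) = algebraMap K[X][Y] E (dY p) :=
  derivation_algebraMap D.Dy dY (by rw [D.Dy_x, dY_apply, derivative_C, map_zero])
    (by rw [D.Dy_y, dY_apply, derivative_X, map_one]) p

/-- The logarithmic derivatives of `z` are `wx / v` and `wy / v`. -/
structure DiffFieldExt.HasLogDerivs (D : DiffFieldExt K E) (z : E) (v wx wy : K[X][Y]) : Prop where
  z_ne : z ≠ 0
  v_ne : v ≠ 0
  Dx_eq : D.Dx z = algebraMap K[X][Y] E wx / algebraMap K[X][Y] E v * z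
  Dy_eq : D.Dy z = algebraMap K[X][Y] E wy / algebraMap K[X][Y] E v * z

theorem DiffFieldExt.algebraMap_ne (D : DiffFieldExt K E) {p : K[X][Y]} (hp : p ≠ 0) :
    algebraMap K[X][Y] E p ≠ 0 :=
  (map_ne_zero_iff _ D.injective).2 hp

-- Multiplication by `a` avoids the exponent `n - 1`, which would be truncated at `n = 0`.
omit [Algebra K[X][Y] E] [IsScalarTower K K[X][Y] E] in
theorem derivation_pow (δ : Derivation K E E) (a : E) (n : ℕ) :
    a * δ (a ^ n) = n * a ^ n * δ a := by
  induction n with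
  | zero => simp
  | succ n ih =>
    rw [pow_succ, Derivation.leibniz, smul_eq_mul, smul_eq_mul]
    push_cast
    linear_combination a * ih

/-- Differentiating `q * v ^ (1 - s) * z` produces `δ q`, `(1 - s) * q * δ v / v` and `q * w / v` as
coefficients of `v ^ (1 - s) * z`. The extra factor `v` on the left keeps the denominator at `v ^ s`
after differentiation. The iterated derivatives of the term and the derivatives of certificates are
both of this shape. -/
theorem derivation_twist (D : DiffFieldExt K E) {δ : Derivation K E E}
    {d : Derivation K K[X][Y] K[X][Y]}
    (hδ : ∀ p, δ (algebraMap K[X][Y] E p) = algebraMap K[X][Y] E (d p)) {z : E} {v w : K[X][Y]}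
    (hv : v ≠ 0) (hz : δ z = algebraMap K[X][Y] E w / algebraMap K[X][Y] E v * z)
    (s : ℕ) (c : K) (hc : c = (s : K) - 1) (q : K[X][Y]) :
    δ (algebraMap K[X][Y] E (q * v) * z / algebraMap K[X][Y] E v ^ s) =
      algebraMap K[X][Y] E (twist d v w c q) * z / algebraMap K[X][Y] E v ^ s := by
  have hv' := D.algebraMap_ne hv
  set φ := algebraMap K[X][Y] E
  have hvs : φ v ^ s ≠ 0 := pow_ne_zero s hv'
  have hsm : φ (c • d v) = ((s : E) - 1) * φ (d v) := by
    rw [Algebra.smul_def, map_mul, ← IsScalarTower.algebraMap_apply, hc]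
    simp
  have h₁ : φ v ^ s * (φ (q * v) * z / φ v ^ s) = φ (q * v) * z := by field_simp
  have h₂ := congrArg δ h₁
  rw [Derivation.leibniz, Derivation.leibniz, smul_eq_mul, smul_eq_mul, smul_eq_mul, smul_eq_mul,
    hδ, Derivation.leibniz, smul_eq_mul, smul_eq_mul, hz] at h₂
  have h₃ := derivation_pow δ (φ v) s
  rw [hδ] at h₃
  set y := δ (φ (q * v) * z / φ v ^ s)
  set y' := δ (φ v ^ s)
  have h₄ : φ v * (φ v ^ s * y) = φ v * (φ (twist d v w c q) * z) := by
    have h₅ : φ v * (φ (q * v) * z / φ v ^ s * y') =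
        φ (q * v) * z * (s * φ (d v)) := by
      rw [show φ v * (φ (q * v) * z / φ v ^ s * y') = φ (q * v) * z / φ v ^ s * (φ v * y') by ring,
        h₃]
      field_simp
    have h₆ : φ v * (φ (q * v) * (φ w / φ v * z)) = φ (q * v) * φ w * z := by field_simp
    simp only [twist, map_add, map_mul, map_sub, hsm] at h₂ h₅ h₆ ⊢
    linear_combination φ v * h₂ - h₅ + h₆
  rw [eq_div_iff hvs, mul_comm y]
  exact mul_left_cancel₀ hv' h₄

/-- The numerators of the derivatives with respect to `x`. -/
def numerators (c₀ v wx : K[X][Y]) : ℕ → K[X][Y]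
  | 0 => c₀
  | i + 1 => twist dX v wx i (numerators c₀ v wx i)

/-- The coefficients of the operator `∑ i, p i * Dx ^ i` multiplied by `Dx ^ k` from the left. -/
def raisedOperator (p : ℕ → K[X]) : ℕ → ℕ → K[X]
  | 0, i => p i
  | k + 1, 0 => derivative (raisedOperator p k 0)
  | k + 1, i + 1 => derivative (raisedOperator p k (i + 1)) + raisedOperator p k i

/-- The numerators of the derivatives with respect to `x` of a certificate. -/
def raisedCertificate (v wx : K[X][Y]) (r : ℕ) (q : K[X][Y]) : ℕ → K[X][Y]
  | 0 => q
  | k + 1 => twist dX v wx ((r + k : ℕ) - 1) (raisedCertificate v wx r q k)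

theorem raisedOperator_eq_zero (p : ℕ → K[X]) (n : ℕ) (hp : ∀ i, n < i → p i = 0) (k i : ℕ)
    (hi : n + k < i) : raisedOperator p k i = 0 := by
  induction k generalizing i with
  | zero => exact hp i hi
  | succ k ih =>
    obtain ⟨i, rfl⟩ : ∃ i', i = i' + 1 := ⟨i - 1, by omega⟩
    rw [raisedOperator, ih _ (by omega), ih _ (by omega)]
    simp

theorem raisedOperator_top (p : ℕ → K[X]) (n : ℕ) (hp : ∀ i, n < i → p i = 0) (k : ℕ) :
    raisedOperator p k (n + k) = p n := by
  induction k with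
  | zero => rfl
  | succ k ih =>
    rw [← add_assoc, raisedOperator, ih, raisedOperator_eq_zero p n hp k _ (by omega)]
    simp

theorem iterate_Dx_eq (D : DiffFieldExt K E) {z : E} {v wx wy c₀ : K[X][Y]}
    (hz : D.HasLogDerivs z v wx wy) (i : ℕ) :
    (D.Dx)^[i] (algebraMap K[X][Y] E c₀ * z) =
      algebraMap K[X][Y] E (numerators c₀ v wx i) * z / algebraMap K[X][Y] E v ^ i := by
  have hv := D.algebraMap_ne hz.v_ne
  induction i with
  | zero => simp [numerators]
  | succ i ih =>
    rw [Function.iterate_succ_apply', ih, numerators]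
    rw [← derivation_twist D D.Dx_algebraMap hz.v_ne hz.Dx_eq (i + 1) (i : K) (by push_cast; ring)]
    congr 1
    rw [map_mul, pow_succ]
    field_simp

/-- A polynomial identity gives a creative telescoping relation. -/
theorem isCTRelation_of_identity (D : DiffFieldExt K E) {z : E} {v wx wy c₀ : K[X][Y]}
    (hc₀ : c₀ ≠ 0) (hz : D.HasLogDerivs z v wx wy) (n k : ℕ) (p : ℕ → K[X]) (q : K[X][Y])
    (hp : ∀ i, n < i → p i = 0) (hpn : p n ≠ 0)
    (hrel : ∑ i ∈ Finset.range (n + k + 1), C (p i) * (numerators c₀ v wx i * v ^ (n + k - i)) =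
      twist dY v wy ((n + k : ℕ) - 1) q) :
    D.IsCTRelation (algebraMap K[X][Y] E c₀ * z) (n + k) (fun i => raisedOperator p k i)
      (algebraMap K[X][Y] E (raisedCertificate v wx (n + k) q k * v) /
        algebraMap K[X][Y] E (c₀ * v ^ (n + k + k)) * (algebraMap K[X][Y] E c₀ * z)) := by
  have hv := D.algebraMap_ne hz.v_ne
  have hc := D.algebraMap_ne hc₀
  set φ := algebraMap K[X][Y] E with hφ
  set r := n + k with hr
  set h := φ c₀ * z with hh
  -- The certificates are brought into the form that `derivation_twist` differentiates.
  have hQ : ∀ j, φ (raisedCertificate v wx r q j * v) / φ (c₀ * v ^ (r + j)) * h =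
      φ (raisedCertificate v wx r q j * v) * z / φ v ^ (r + j) := by
    intro j
    rw [map_mul φ c₀, map_pow, hh]
    field_simp
  rw [hQ]
  refine ⟨?_, ?_, ?_⟩
  · change raisedOperator p k r ≠ 0
    rw [hr, raisedOperator_top p n hp]
    exact hpn
  · by_cases h0 : raisedCertificate v wx r q k = 0
    · left
      rw [h0]
      simp
    · right
      have hq := D.algebraMap_ne h0
      have hz0 := hz.z_ne
      have hQ0 : φ (raisedCertificate v wx r q k * v) * z / φ v ^ (r + k) ≠ 0 := by
        rw [map_mul]
        exact div_ne_zero (mul_ne_zero (mul_ne_zero hq hv) hz0) (pow_ne_zero _ hv)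
      refine ⟨hQ0, ⟨twist dX v wx ((r + k : ℕ) - 1) (raisedCertificate v wx r q k),
        raisedCertificate v wx r q k * v, mul_ne_zero h0 hz.v_ne, ?_⟩,
        ⟨twist dY v wy ((r + k : ℕ) - 1) (raisedCertificate v wx r q k), raisedCertificate v wx r q k * v, mul_ne_zero h0 hz.v_ne, ?_⟩⟩
      · rw [derivation_twist D D.Dx_algebraMap hz.v_ne hz.Dx_eq (r + k) _ rfl, map_mul, ← hφ]
        field_simp
      · rw [derivation_twist D D.Dy_algebraMap hz.v_ne hz.Dy_eq (r + k) _ rfl, map_mul, ← hφ]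
        field_simp
  -- Applying `Dx` to the relation of stage `j` gives that of stage `j + 1`, because `Dx` commutes
  -- with `Dy`.
  · have key : ∀ j, j ≤ k → ∑ i ∈ Finset.range (r + 1),
        φ (C (raisedOperator p j i)) * (D.Dx)^[i] h =
        D.Dy (φ (raisedCertificate v wx r q j * v) * z / φ v ^ (r + j)) := by
      intro j hj
      induction j with
      | zero =>
        rw [raisedCertificate, add_zero,
          derivation_twist D D.Dy_algebraMap hz.v_ne hz.Dy_eq r _ rfl, ← hrel, map_sum,
          Finset.sum_mul, Finset.sum_div]
        refine Finset.sum_congr rfl fun i hi => ?_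
        rw [hh, iterate_Dx_eq D hz, raisedOperator, map_mul, map_mul, map_pow]
        have : φ v ^ r = φ v ^ (r - i) * φ v ^ i := by
          rw [← pow_add, Nat.sub_add_cancel (by simpa [Nat.lt_succ_iff] using hi)]
        rw [this, ← hφ]
        field_simp
      | succ j ih =>
        have ih := congrArg D.Dx (ih (by omega))
        rw [D.comm, derivation_twist D D.Dx_algebraMap hz.v_ne hz.Dx_eq (r + j) _ rfl] at ih
        have e : φ (twist dX v wx ((r + j : ℕ) - 1) (raisedCertificate v wx r q j)) * z /
            φ v ^ (r + j) = φ (raisedCertificate v wx r q (j + 1) * v) * z / φ v ^ (r + (j + 1)) := by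
          rw [raisedCertificate, map_mul, ← add_assoc, pow_succ]
          field_simp
        rw [e] at ih
        rw [← ih, map_sum]
        have hterm : ∀ i, D.Dx (φ (C (raisedOperator p j i)) * (D.Dx)^[i] h) =
            φ (C (derivative (raisedOperator p j i))) * (D.Dx)^[i] h +
            φ (C (raisedOperator p j i)) * (D.Dx)^[i + 1] h := by
          intro i
          rw [Derivation.leibniz, smul_eq_mul, smul_eq_mul, D.Dx_algebraMap, dX_C,
            Function.iterate_succ_apply']
          ring
        -- At stage `j < k` the operator has order at most `n + j < r`, so the term with `Dx ^ (r +
        -- 1)` created by the shift has coefficient zero and the range of summation need not grow.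
        rw [Finset.sum_congr rfl fun i _ => hterm i, Finset.sum_add_distrib,
          Finset.sum_range_succ (fun i => φ (C (raisedOperator p j i)) * (D.Dx)^[i + 1] h) r,
          raisedOperator_eq_zero p n hp j r (by omega), Finset.sum_range_succ',
          Finset.sum_range_succ' (fun i => φ (C (derivative (raisedOperator p j i))) *
            (D.Dx)^[i] h)]
        simp only [raisedOperator, map_add, add_mul, Finset.sum_add_distrib, map_zero, zero_mul,
          add_zero]
        ring
    have := key k le_rfl
    rw [← this, Finset.sum_range]

end Extension

/-- A solution of a first order equation is determined by its value at a regular point. -/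
theorem eq_zero_of_twist_eq_zero [CharZero K] {v w q : K[X][Y]} {c : K} (y₀ : K[X])
    (hv : v.eval y₀ ≠ 0) (hq : q.eval y₀ = 0) (h : twist dY v w c q = 0) : q = 0 := by
  by_contra hq0
  obtain ⟨g, hg, hndvd⟩ := q.exists_eq_pow_rootMultiplicity_mul_and_not_dvd hq0 y₀
  have hpos : 0 < q.rootMultiplicity y₀ := (rootMultiplicity_pos hq0).2 hq
  obtain ⟨n, hn⟩ : ∃ n, q.rootMultiplicity y₀ = n + 1 := ⟨_, (Nat.succ_pred_eq_of_pos hpos).symm⟩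
  rw [hn] at hg
  have hgev : g.eval y₀ ≠ 0 := fun h0 => hndvd (dvd_iff_isRoot.2 h0)
  set W := w - c • dY v with hW
  -- With `q = (y - y₀) ^ (n + 1) * g`, after cancelling `(y - y₀) ^ n` and evaluating at `y₀`, only
  -- `v * (n + 1) * g` remains. All its factors are nonzero in characteristic zero.
  have h1 : (X - C y₀) ^ n * (v * ((n + 1 : ℕ) : K[X][Y]) * g +
      (X - C y₀) * (v * derivative g + W * g)) = 0 := by
    rw [← h, twist, ← hW, hg, dY_apply, derivative_mul, derivative_pow]
    simp
    ring
  have h2 := (mul_eq_zero.1 h1).resolve_left (pow_ne_zero _ (X_sub_C_ne_zero y₀))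
  have h3 := congrArg (eval y₀) h2
  simp only [eval_add, eval_mul, eval_sub, eval_X, eval_C, sub_self, zero_mul, add_zero, eval_zero,
    eval_natCast] at h3
  rcases mul_eq_zero.1 h3 with h4 | h4
  · rcases mul_eq_zero.1 h4 with h5 | h5
    · exact hv h5
    · exact Nat.cast_ne_zero.2 n.succ_ne_zero h5
  · exact hgev h4

/-- Nonzero solutions of low degree of a homogeneous linear system exist if there are more unknown
coefficients than equations for them. -/
theorem exists_kernel_of_count {k m : ℕ} (A : Matrix (Fin k) (Fin m) K[X]) (d : Fin m → ℕ) (e : ℕ)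
    (hA : ∀ i j, (A i j).natDegree + d j ≤ e) (hlt : k * e < ∑ j, d j) :
    ∃ u : Fin m → K[X], u ≠ 0 ∧ (∀ j, (u j).natDegree < d j ∨ u j = 0) ∧ A.mulVec u = 0 := by
  -- The degree hypothesis leaves only the first `e` coefficients of each row of the product to be
  -- killed, so the target has dimension `k * e`, below the dimension of the source.
  let f : ((j : Fin m) → degreeLT K (d j)) →ₗ[K] (Fin k × Fin e → K) :=
    { toFun := fun u s => (∑ j, A s.1 j * (u j : K[X])).coeff s.2
      map_add' := fun u u' => by
        funext s
        simp [mul_add, Finset.sum_add_distrib]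
      map_smul' := fun c u => by
        funext s
        simp only [Pi.smul_apply, SetLike.val_smul, mul_smul_comm, ← Finset.smul_sum, coeff_smul,
          RingHom.id_apply] }
  have hfin : ∀ j, Module.Finite K (degreeLT K (d j)) := fun j =>
    Module.Finite.equiv (degreeLTEquiv K (d j)).symm
  have hker : LinearMap.ker f ≠ ⊥ := by
    refine f.ker_ne_bot_of_finrank_lt ?_
    rw [Module.finrank_fintype_fun_eq_card, Fintype.card_prod, Fintype.card_fin, Fintype.card_fin,
      Module.finrank_pi_fintype]
    refine hlt.trans_le (Finset.sum_le_sum fun j _ => ?_)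
    rw [(degreeLTEquiv K (d j)).finrank_eq, Module.finrank_fintype_fun_eq_card, Fintype.card_fin]
  obtain ⟨u, hu, hu0⟩ := Submodule.exists_mem_ne_zero_of_ne_bot hker
  have hdeg : ∀ j, (u j : K[X]).natDegree < d j ∨ (u j : K[X]) = 0 := by
    intro j
    by_cases h0 : (u j : K[X]) = 0
    · exact Or.inr h0
    · left
      have := mem_degreeLT.1 (u j).2
      rwa [degree_eq_natDegree h0, Nat.cast_lt] at this
  refine ⟨fun j => u j, fun h => hu0 (funext fun j => Subtype.ext (congrFun h j)), hdeg, ?_⟩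
  funext i
  ext s
  simp only [Matrix.mulVec, dotProduct, Pi.zero_apply, coeff_zero]
  by_cases hs : s < e
  · exact congrFun (LinearMap.mem_ker.1 hu) (i, ⟨s, hs⟩)
  · rw [finsetSum_coeff]
    refine Finset.sum_eq_zero fun j _ => ?_
    rcases hdeg j with h | h
    · refine coeff_eq_zero_of_natDegree_lt (natDegree_mul_le.trans_lt ?_)
      have := hA i j
      omega
    · rw [h, mul_zero, coeff_zero]

end Relations

/-! ## Logarithmic derivatives of polynomials -/

section LogDerivs

open Polynomial

/-- For a prime power `p ^ i` the derivative contains `p ^ (i - 1)` and the radical supplies the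
missing factor; coprime products follow from the Leibniz rule. So the square free part suffices as
denominator of a logarithmic derivative. -/
theorem dvd_radical_mul_derivation {K R : Type*} [CommRing K] [CommRing R] [IsDomain R]
    [Algebra K R] [UniqueFactorizationMonoid R] [NormalizationMonoid R] (d : Derivation K R R)
    (p : R) : p ∣ UniqueFactorizationMonoid.radical p * d p := by
  induction p using UniqueFactorizationMonoid.induction_on_coprime with
  | h0 => simp
  | h1 hx => exact hx.dvd
  | @hpr p i hp =>
    rcases Nat.eq_zero_or_pos i with rfl | hi
    · simp
    · rw [UniqueFactorizationMonoid.radical_pow_of_prime hp hi.ne', Derivation.leibniz_pow]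
      have h₁ : p ∣ normalize p := (normalize_associated p).symm.dvd
      obtain ⟨i, rfl⟩ : ∃ i', i = i' + 1 := ⟨i - 1, by omega⟩
      obtain ⟨c, hc⟩ := h₁
      refine ⟨c * ((i + 1 : ℕ) * d p), ?_⟩
      rw [hc, Nat.add_sub_cancel, nsmul_eq_mul, smul_eq_mul]
      ring
  | @hcp x y hxy hx hy =>
    rw [UniqueFactorizationMonoid.radical_mul hxy, Derivation.leibniz, smul_eq_mul, smul_eq_mul]
    obtain ⟨f, hf⟩ := hx
    obtain ⟨g, hg⟩ := hy
    obtain ⟨x', hx'⟩ := UniqueFactorizationMonoid.radical_dvd_self (a := x)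
    refine ⟨UniqueFactorizationMonoid.radical x * g + UniqueFactorizationMonoid.radical y * f, ?_⟩
    linear_combination UniqueFactorizationMonoid.radical x * x * hg +
      UniqueFactorizationMonoid.radical y * y * hf

variable {K : Type*} [Field K]

theorem dvd_sqfreePart_mul_derivation (d : Derivation K K[X][Y] K[X][Y]) (p : K[X][Y]) :
    p ∣ sqfreePart p * d p :=
  let _ : NormalizationMonoid K[X][Y] := Classical.choice inferInstance
  dvd_radical_mul_derivation d p

/-- Degrees in both variables are additive and `f` is no larger than `b`, hence `s = z * f / b` is
no larger than `z`. -/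
theorem degLE_of_mul_eq {b z s f : K[X][Y]} (hb : b ≠ 0) (h : b * s = z * f)
    (hf : DegLE f (degX b) (degY b)) : DegLE s (degX z) (degY z) := by
  by_cases hs : s = 0
  · rw [hs]
    exact DegLE.zero
  have hle : DegLE (b * s) (degX z + degX b) (degY z + degY b) := h ▸ (degLE_degX_degY z).mul hf
  have hx := degX_le_of_degLE hle
  have hy := hle.natDegree
  rw [degX_mul hb hs] at hx
  change degY (b * s) ≤ _ at hy
  rw [degY_mul hb hs] at hy
  exact (degLE_degX_degY s).mono (by omega) (by omega)

/-- Differentiation lowers the degree in `y`; the alternative `s = 0` covers `b` free of `y`. The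
strict inequality makes the numerator of the logarithmic derivative in `y` smaller than the
denominator, which gives room for one more unknown. -/
theorem natDegree_lt_of_mul_dY_eq {b z s : K[X][Y]} (hb : b ≠ 0) (h : b * s = z * dY b) :
    s = 0 ∨ degY s < degY z := by
  by_cases hs : s = 0
  · exact Or.inl hs
  right
  have h0 : z * dY b ≠ 0 := h ▸ mul_ne_zero hb hs
  have hdb : derivative b ≠ 0 := right_ne_zero_of_mul h0
  have hpos : b.natDegree ≠ 0 := fun h' => hdb (by
    rw [eq_C_of_natDegree_eq_zero h', derivative_C])
  have h₁ := congrArg degY h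
  rw [degY_mul hb hs, degY_mul (left_ne_zero_of_mul h0) (right_ne_zero_of_mul h0), dY_apply] at h₁
  have h₂ := natDegree_derivative_lt hpos
  unfold degY at *
  omega

/-- The logarithmic derivative with respect to `y`. -/
def logDerivY (f : K[X][Y]) : FractionRing K[X][Y] :=
  algebraMap _ (FractionRing K[X][Y]) (dY f) / algebraMap _ (FractionRing K[X][Y]) f

local notation "ι" => algebraMap K[X][Y] (FractionRing K[X][Y])

theorem fraction_ne_zero {f : K[X][Y]} (hf : f ≠ 0) : ι f ≠ 0 :=
  (map_ne_zero_iff _ (IsFractionRing.injective K[X][Y] (FractionRing K[X][Y]))).2 hf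

theorem logDerivY_mul {f g : K[X][Y]} (hf : f ≠ 0) (hg : g ≠ 0) :
    logDerivY (f * g) = logDerivY f + logDerivY g := by
  have := fraction_ne_zero hf
  have := fraction_ne_zero hg
  simp only [logDerivY, Derivation.leibniz, smul_eq_mul, map_add, map_mul]
  field_simp
  ring

theorem logDerivY_pow {f : K[X][Y]} (hf : f ≠ 0) (n : ℕ) :
    logDerivY (f ^ n) = n * logDerivY f := by
  induction n with
  | zero => simp [logDerivY]
  | succ n ih =>
    rw [pow_succ, logDerivY_mul (pow_ne_zero n hf) hf, ih]
    push_cast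
    ring

/-- The rational functions without a pole at the prime `π`. -/
def regularAt {π : K[X][Y]} (hπ : Prime π) : Subalgebra K (FractionRing K[X][Y]) where
  carrier := {x | ∃ s t, ¬ π ∣ t ∧ x = ι s / ι t}
  add_mem' := by
    rintro _ _ ⟨s, t, ht, rfl⟩ ⟨s', t', ht', rfl⟩
    have h₁ := fraction_ne_zero (f := t) fun h => ht (h ▸ dvd_zero π)
    have h₂ := fraction_ne_zero (f := t') fun h => ht' (h ▸ dvd_zero π)
    refine ⟨s * t' + s' * t, t * t', fun h => (hπ.dvd_or_dvd h).elim ht ht', ?_⟩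
    simp only [map_add, map_mul]
    field_simp
  mul_mem' := by
    rintro _ _ ⟨s, t, ht, rfl⟩ ⟨s', t', ht', rfl⟩
    refine ⟨s * s', t * t', fun h => (hπ.dvd_or_dvd h).elim ht ht', ?_⟩
    simp only [map_mul, div_mul_div_comm]
  algebraMap_mem' c := ⟨algebraMap K K[X][Y] c, 1, hπ.not_dvd_one, by
    rw [map_one, div_one, ← IsScalarTower.algebraMap_apply]⟩

theorem algebraMap_mem_regularAt {π : K[X][Y]} (hπ : Prime π) (f : K[X][Y]) :
    ι f ∈ regularAt hπ := ⟨f, 1, hπ.not_dvd_one, by simp⟩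

theorem not_dvd_dY [CharZero K] {π : K[X][Y]} (h : dY π ≠ 0) : ¬ π ∣ dY π := by
  intro hdvd
  have h' : derivative π ≠ 0 := h
  have hpos : π.natDegree ≠ 0 := fun h0 => h' (by rw [eq_C_of_natDegree_eq_zero h0, derivative_C])
  have h₁ := natDegree_le_of_dvd hdvd h
  have h₂ := natDegree_derivative_lt hpos
  rw [dY_apply] at h₁
  omega

/-- A prime does not divide its nonzero derivative, whose degree in `y` is smaller. Hence its
logarithmic derivative has a pole of order exactly one, which only a multiple of `π` can cancel. -/
theorem dvd_of_mul_logDerivY_mem [CharZero K] {π : K[X][Y]} (hπ : Prime π) (h : dY π ≠ 0)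
    {f : K[X][Y]} (hf : ι f * logDerivY π ∈ regularAt hπ) : π ∣ f := by
  obtain ⟨s, t, ht, hst⟩ := hf
  have h₁ := fraction_ne_zero (f := t) fun h => ht (h ▸ dvd_zero π)
  have h₂ := fraction_ne_zero hπ.ne_zero
  rw [logDerivY, ← mul_div_assoc, div_eq_div_iff h₂ h₁, ← map_mul, ← map_mul, ← map_mul] at hst
  have h₃ := IsFractionRing.injective K[X][Y] (FractionRing K[X][Y]) hst
  have h₄ : π ∣ f * dY π * t := ⟨s, by rw [h₃, mul_comm]⟩
  exact (hπ.dvd_or_dvd ((hπ.dvd_or_dvd h₄).resolve_right ht)).resolve_right (not_dvd_dY h)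

/-- A nonzero constant is a unit and cannot be divisible by `π`. This makes the residue, the
coefficient of `logDerivY π` modulo regular functions, well defined when `π` involves `y`. -/
theorem eq_zero_of_smul_logDerivY_mem [CharZero K] {π : K[X][Y]} (hπ : Prime π) (h : dY π ≠ 0)
    {c : K} (hc : c • logDerivY π ∈ regularAt hπ) : c = 0 := by
  by_contra h0
  have : ι (algebraMap K K[X][Y] c) * logDerivY π ∈ regularAt hπ := by
    rwa [← IsScalarTower.algebraMap_apply, ← Algebra.smul_def]
  exact hπ.not_isUnit (isUnit_of_dvd_unit (dvd_of_mul_logDerivY_mem hπ h this)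
    ((isUnit_iff_ne_zero.2 h0).map (algebraMap K K[X][Y])))

theorem logDerivY_mem_regularAt {π : K[X][Y]} (hπ : Prime π) {f : K[X][Y]} (hf : ¬ π ∣ f) :
    logDerivY f ∈ regularAt hπ := ⟨_, _, hf, rfl⟩

/-- The number `n` is the multiplicity of `π` in `f`: the residue of a logarithmic derivative is an
order of vanishing. -/
theorem exists_logDerivY_sub_mem {π : K[X][Y]} (hπ : Prime π) {f : K[X][Y]} (hf : f ≠ 0) :
    ∃ n : ℕ, logDerivY f - (n : K) • logDerivY π ∈ regularAt hπ ∧ (π ∣ f → n ≠ 0) ∧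
      (Squarefree f → n ≤ 1) := by
  obtain ⟨n, g, hg, rfl⟩ := WfDvdMonoid.max_power_factor hf hπ.irreducible
  refine ⟨n, ?_, ?_, fun hsq => ?_⟩
  · rw [logDerivY_mul (pow_ne_zero n hπ.ne_zero) (right_ne_zero_of_mul hf),
      logDerivY_pow hπ.ne_zero, Algebra.smul_def, map_natCast, add_sub_cancel_left]
    exact logDerivY_mem_regularAt hπ hg
  · rintro h rfl
    rw [pow_zero, one_mul] at h
    exact hg h
  · by_contra hn
    obtain ⟨k, rfl⟩ : ∃ k, n = k + 2 := ⟨n - 2, by omega⟩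
    exact hπ.not_isUnit (hsq π ⟨π ^ k * g, by ring⟩)

/-- The rational functions with at most a simple pole of a special kind at `π`. -/
def simplePoleAt {π : K[X][Y]} (hπ : Prime π) : Submodule K (FractionRing K[X][Y]) :=
  Subalgebra.toSubmodule (regularAt hπ) ⊔ K ∙ logDerivY π

theorem mem_simplePoleAt {π : K[X][Y]} (hπ : Prime π) {x : FractionRing K[X][Y]} :
    x ∈ simplePoleAt hπ ↔ ∃ c : K, x - c • logDerivY π ∈ regularAt hπ := by
  rw [simplePoleAt, Submodule.mem_sup]
  constructor
  · rintro ⟨y, hy, z, hz, rfl⟩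
    obtain ⟨c, rfl⟩ := Submodule.mem_span_singleton.1 hz
    exact ⟨c, by rw [add_sub_cancel_right]; exact hy⟩
  · rintro ⟨c, hc⟩
    exact ⟨_, hc, _, Submodule.smul_mem _ c (Submodule.mem_span_singleton_self _), by simp⟩

theorem logDerivY_mem_simplePoleAt {π : K[X][Y]} (hπ : Prime π) {f : K[X][Y]} (hf : f ≠ 0) :
    logDerivY f ∈ simplePoleAt hπ := by
  obtain ⟨n, hn, -⟩ := exists_logDerivY_sub_mem hπ hf
  exact (mem_simplePoleAt hπ).2 ⟨n, hn⟩

variable (K) in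
/-- The rational functions that have a negative degree in `y` or vanish. -/
def properY : Submodule K (FractionRing K[X][Y]) where
  carrier := {x | ∃ s t : K[X][Y], t ≠ 0 ∧ s.degree < t.degree ∧ x = ι s / ι t}
  zero_mem' := ⟨0, 1, one_ne_zero, by simp, by simp⟩
  add_mem' := by
    rintro _ _ ⟨s, t, ht, hd, rfl⟩ ⟨s', t', ht', hd', rfl⟩
    have h₁ := fraction_ne_zero ht
    have h₂ := fraction_ne_zero ht'
    refine ⟨s * t' + s' * t, t * t', mul_ne_zero ht ht', ?_, ?_⟩
    · rw [degree_mul]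
      refine (degree_add_le _ _).trans_lt (max_lt ?_ ?_)
      · rw [degree_mul]
        exact WithBot.add_lt_add_right (degree_eq_bot.not.2 ht') hd
      · rw [degree_mul, add_comm]
        exact WithBot.add_lt_add_left (degree_eq_bot.not.2 ht) hd'
    · simp only [map_add, map_mul]
      field_simp
  smul_mem' := by
    rintro c _ ⟨s, t, ht, hd, rfl⟩
    refine ⟨algebraMap K K[X][Y] c * s, t, ht, ?_, ?_⟩
    · have : algebraMap K K[X][Y] c * s = c • s := (Algebra.smul_def _ _).symm
      rw [this]
      exact (degree_smul_le _ _).trans_lt hd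
    · rw [map_mul, ← IsScalarTower.algebraMap_apply, Algebra.smul_def, mul_div_assoc]

theorem logDerivY_mem_properY {f : K[X][Y]} (hf : f ≠ 0) : logDerivY f ∈ properY K :=
  ⟨_, f, hf, degree_derivative_lt hf, rfl⟩

theorem dY_eq_zero_of_forall_prime (f : K[X][Y]) (hf : f ≠ 0)
    (h : ∀ π, Prime π → π ∣ f → dY π = 0) : dY f = 0 := by
  induction f using UniqueFactorizationMonoid.induction_on_prime with
  | h₁ => exact absurd rfl hf
  | h₂ x hx =>
    rw [dY_apply, eq_C_of_natDegree_eq_zero (natDegree_eq_zero_of_isUnit hx), derivative_C]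
  | h₃ a p ha hp ih =>
    rw [Derivation.leibniz, h p hp (dvd_mul_right p a), ih ha fun π hπ hd => h π hπ (hd.mul_left p)]
    simp

theorem exists_C_of_dY_eq_zero [CharZero K] {f : K[X][Y]} (h : dY f = 0) : ∃ s, f = C s :=
  ⟨_, eq_C_of_natDegree_eq_zero (derivative_eq_zero.1 h)⟩

/-- If the derivative of a rational function is a combination of logarithmic derivatives, then it
does not depend on `y`. -/
theorem not_dependent_of_derivative_eq [CharZero K] {a b : K[X][Y]} (hb : b ≠ 0)
    {T : FractionRing K[X][Y]} (hT : T ∈ properY K)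
    (hT' : ∀ π (hπ : Prime π), T ∈ simplePoleAt hπ)
    (h : ι (dY a * b - a * dY b) / ι b ^ 2 = T) :
    T = 0 ∧ ∃ s t : K[X], t ≠ 0 ∧ a * C t = b * C s := by
  obtain ⟨b₁, a₁, g, hrel, hgb, hga⟩ := UniqueFactorizationMonoid.exists_reduced_factors b hb a
  have hb₁ : b₁ ≠ 0 := fun h0 => hb (by rw [← hgb, h0, mul_zero])
  have hg : g ≠ 0 := fun h0 => hb (by rw [← hgb, h0, zero_mul])
  have hib₁ := fraction_ne_zero hb₁
  have hig := fraction_ne_zero hg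
  -- This is the derivative of the reduced fraction, multiplied by its denominator `b₁`.
  have h₁ : ι (dY a₁) - ι a₁ * logDerivY b₁ = ι b₁ * T := by
    rw [← h, ← hga, ← hgb, logDerivY]
    simp only [Derivation.leibniz, smul_eq_mul, map_mul, map_sub, map_add]
    field_simp
    ring
  have hprime : ∀ π, Prime π → π ∣ b₁ → dY π = 0 := by
    intro π hπ hdvd
    by_contra hdπ
    have hiπ := fraction_ne_zero hπ.ne_zero
    obtain ⟨c, hc⟩ := (mem_simplePoleAt hπ).1 (hT' π hπ)
    -- Since `π` divides `b₁`, it cancels the simple pole of `T`. Then `a₁ * logDerivY b₁` is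
    -- regular as well, so the multiplicity of `π` in `b₁` times `a₁` is divisible by `π`. This
    -- contradicts coprimality: the derivative of a fraction with a pole has a pole of order at
    -- least two.
    have h₂ : ι b₁ * T ∈ regularAt hπ := by
      have h₃ : ι b₁ * T = ι b₁ * (T - c • logDerivY π) + c • (ι b₁ * logDerivY π) := by
        rw [mul_sub, mul_smul_comm, sub_add_cancel]
      rw [h₃]
      refine add_mem (mul_mem (algebraMap_mem_regularAt hπ _) hc) (Subalgebra.smul_mem _ ?_ _)
      obtain ⟨f, rfl⟩ := hdvd
      have : ι (π * f) * logDerivY π = ι (f * dY π) := by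
        rw [logDerivY]
        simp only [map_mul]
        field_simp
      rw [this]
      exact algebraMap_mem_regularAt hπ _
    have h₃ : ι a₁ * logDerivY b₁ ∈ regularAt hπ := by
      have : ι a₁ * logDerivY b₁ = ι (dY a₁) - ι b₁ * T := by rw [← h₁]; ring
      rw [this]
      exact sub_mem (algebraMap_mem_regularAt hπ _) h₂
    obtain ⟨n, hn, hn0, -⟩ := exists_logDerivY_sub_mem hπ hb₁
    have h₄ : ι ((n : K[X][Y]) * a₁) * logDerivY π ∈ regularAt hπ := by
      have : ι ((n : K[X][Y]) * a₁) * logDerivY π =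
          ι a₁ * logDerivY b₁ - ι a₁ * (logDerivY b₁ - (n : K) • logDerivY π) := by
        rw [Algebra.smul_def, map_natCast, map_mul, map_natCast]
        ring
      rw [this]
      exact sub_mem h₃ (mul_mem (algebraMap_mem_regularAt hπ _) hn)
    rcases hπ.dvd_or_dvd (dvd_of_mul_logDerivY_mem hπ hdπ h₄) with h₅ | h₅
    · have hn' : IsUnit (n : K[X][Y]) := by
        have : (n : K[X][Y]) = C (C (n : K)) := by simp
        rw [this]
        exact ((isUnit_iff_ne_zero.2 (Nat.cast_ne_zero.2 (hn0 hdvd))).map C).map C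
      exact hπ.not_isUnit (isUnit_of_dvd_unit h₅ hn')
    · exact hπ.not_isUnit (hrel hdvd h₅)
  have hdb₁ := dY_eq_zero_of_forall_prime b₁ hb₁ hprime
  have hlog : logDerivY b₁ = 0 := by rw [logDerivY, hdb₁, map_zero, zero_div]
  obtain ⟨t, ht⟩ := exists_C_of_dY_eq_zero hdb₁
  -- Now `b₁` is free of `y`, so the derivative of `a₁` is a nonzero element of `K[x]` times the
  -- proper function `T`; but a nonzero polynomial has no negative degree in `y`.
  have hda₁ : dY a₁ = 0 := by
    by_contra h0
    obtain ⟨U, V, hV, hdeg, rfl⟩ := hT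
    have hiV := fraction_ne_zero hV
    have h₂ : dY a₁ * V = b₁ * U := by
      apply IsFractionRing.injective K[X][Y] (FractionRing K[X][Y])
      rw [hlog, mul_zero, sub_zero] at h₁
      rw [map_mul, map_mul, h₁]
      field_simp
    have ht0 : t ≠ 0 := by
      rintro rfl
      exact hb₁ (by simp [ht])
    have h₃ := congrArg degree h₂
    rw [degree_mul, degree_mul, ht, degree_C ht0, zero_add] at h₃
    rw [← h₃] at hdeg
    refine absurd hdeg (not_lt.2 ?_)
    refine le_add_of_nonneg_left ?_
    rw [degree_eq_natDegree h0]
    exact_mod_cast Nat.zero_le _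
  obtain ⟨s, hs⟩ := exists_C_of_dY_eq_zero hda₁
  constructor
  · rw [hlog, hda₁, map_zero, mul_zero, sub_zero] at h₁
    exact (mul_eq_zero.1 h₁.symm).resolve_left hib₁
  · refine ⟨s, t, ?_, ?_⟩
    · rintro rfl
      exact hb₁ (by simp [ht])
    · rw [← ht, ← hs, ← hga, ← hgb]
      ring

end LogDerivs

/-! ### Logarithmic derivatives of a term, and the case `φ₃ = 0` -/

section Terms

open Polynomial

variable {K : Type*} [Field K] {L : ℕ}

namespace HypTerm

/-- The factors `c l` that are not constant. -/
def proper (F : HypFormat L) : Finset (Fin L) :=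
  Finset.univ.filter fun l => (F.c l).1 + (F.c l).2 ≠ 0

/-- The derivative of the product of the powers of the nonconstant factors, up to a factor. -/
def powersNumerator (H : HypTerm K L) (d : Derivation K K[X][Y] K[X][Y]) : K[X][Y] :=
  ∑ l ∈ proper H.format, H.e l • (d (H.c l) * ∏ k ∈ (proper H.format).erase l, H.c k)

/-- A common denominator of the logarithmic derivatives of `exp (a / b) * ∏ l, c l ^ e l`. -/
def denominator (H : HypTerm K L) (z : K[X][Y]) : K[X][Y] :=
  H.b * z * ∏ l ∈ proper H.format, H.c l

/-- The numerator of a logarithmic derivative of `exp (a / b) * ∏ l, c l ^ e l`, when `s / z` is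
the logarithmic derivative of `b`. -/
def numerator (H : HypTerm K L) (d : Derivation K K[X][Y] K[X][Y]) (z s : K[X][Y]) : K[X][Y] :=
  (d H.a * z - H.a * s) * ∏ l ∈ proper H.format, H.c l + H.b * z * H.powersNumerator d

theorem derivation_eq_zero_of_not_proper (H : HypTerm K L) {l : Fin L} (hl : l ∉ proper H.format)
    {d : Derivation K K[X][Y] K[X][Y]} (hd : d = dX ∨ d = dY) : d (H.c l) = 0 := by
  have hl' : degX (H.c l) + degY (H.c l) = 0 := by simpa [proper, format] using hl
  have h₁ := degLE_degX_degY (H.c l)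
  rw [show degX (H.c l) = 0 by omega, show degY (H.c l) = 0 by omega] at h₁
  ext j i
  rw [coeff_zero, coeff_zero]
  rcases hd with rfl | rfl
  · rw [coeff_coeff_dX, h₁ _ _ (by omega), zero_mul]
  · rw [coeff_coeff_dY, h₁ _ _ (by omega), zero_mul]

theorem denominator_ne_zero (H : HypTerm K L) {z : K[X][Y]} (hz : z ≠ 0) : H.denominator z ≠ 0 :=
  mul_ne_zero (mul_ne_zero H.b_ne hz) (Finset.prod_ne_zero_iff.2 fun l _ => H.c_ne l)

/-- The field `F` is arbitrary because this is needed both in a differential extension and, for the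
analysis of poles, in the fraction field of `K[x,y]`. -/
theorem numerator_div_denominator (H : HypTerm K L) {F : Type*} [Field F] [Algebra K F]
    [Algebra K[X][Y] F] [IsScalarTower K K[X][Y] F]
    (hinj : Function.Injective (algebraMap K[X][Y] F)) {d : Derivation K K[X][Y] K[X][Y]}
    (hd : d = dX ∨ d = dY) {z s : K[X][Y]} (hz : z ≠ 0) (hs : H.b * s = z * d H.b) :
    algebraMap K[X][Y] F (H.numerator d z s) / algebraMap K[X][Y] F (H.denominator z) =
      algebraMap K[X][Y] F (d H.a * H.b - H.a * d H.b) / algebraMap K[X][Y] F H.b ^ 2 +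
      ∑ l, algebraMap K F (H.e l) *
        (algebraMap K[X][Y] F (d (H.c l)) / algebraMap K[X][Y] F (H.c l)) := by
  set φ := algebraMap K[X][Y] F with hφ
  have hne : ∀ {p : K[X][Y]}, p ≠ 0 → φ p ≠ 0 := fun hp => (map_ne_zero_iff _ hinj).2 hp
  have hsum : ∑ l, algebraMap K F (H.e l) * (φ (d (H.c l)) / φ (H.c l)) =
      φ (H.powersNumerator d) / φ (∏ l ∈ proper H.format, H.c l) := by
    rw [powersNumerator, map_sum, Finset.sum_div,
      ← Finset.sum_subset (Finset.subset_univ (proper H.format))]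
    · refine Finset.sum_congr rfl fun l hl => ?_
      have h₁ := hne (H.c_ne l)
      have h₂ : φ (∏ k ∈ (proper H.format).erase l, H.c k) ≠ 0 :=
        hne (Finset.prod_ne_zero_iff.2 fun l _ => H.c_ne l)
      rw [← Finset.mul_prod_erase _ _ hl, Algebra.smul_def, map_mul, map_mul, map_mul,
        ← IsScalarTower.algebraMap_apply]
      field_simp
    · intro l _ hl
      rw [H.derivation_eq_zero_of_not_proper hl hd, map_zero, zero_div, mul_zero]
  have hb := hne H.b_ne
  have hz' := hne hz
  have hP : φ (∏ l ∈ proper H.format, H.c l) ≠ 0 :=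
    hne (Finset.prod_ne_zero_iff.2 fun l _ => H.c_ne l)
  have hs' := congrArg φ hs
  rw [hsum, numerator, denominator]
  simp only [map_mul, map_add, map_sub] at hs' ⊢
  field_simp
  linear_combination (-φ (∏ l ∈ proper H.format, H.c l) * φ H.a) * hs'

theorem Describes.hasLogDerivs {H : HypTerm K L} {E : Type*} [Field E] [Algebra K E]
    [Algebra K[X][Y] E] [IsScalarTower K K[X][Y] E] {D : DiffFieldExt K E} {h : E}
    (hh : H.Describes D h) {z sx sy : K[X][Y]} (hz : z ≠ 0) (hsx : H.b * sx = z * dX H.b)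
    (hsy : H.b * sy = z * dY H.b) :
    D.HasLogDerivs (h / algebraMap K[X][Y] E H.c₀) (H.denominator z) (H.numerator dX z sx)
      (H.numerator dY z sy) := by
  have hc₀ := D.algebraMap_ne H.c₀_ne
  have hb := D.algebraMap_ne H.b_ne
  obtain ⟨hh0, hδ⟩ := hh
  have key : ∀ (δ : Derivation K E E) (d : Derivation K K[X][Y] K[X][Y]), δ = D.Dx ∨ δ = D.Dy →
      d = dX ∨ d = dY → (∀ p, δ (algebraMap K[X][Y] E p) = algebraMap K[X][Y] E (d p)) →
      ∀ s, H.b * s = z * d H.b → δ (h / algebraMap K[X][Y] E H.c₀) =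
        algebraMap K[X][Y] E (H.numerator d z s) / algebraMap K[X][Y] E (H.denominator z) *
          (h / algebraMap K[X][Y] E H.c₀) := by
    intro δ d h₁ hd hδd s hs
    rw [H.numerator_div_denominator D.injective hd hz hs]
    have h₂ := hδ δ h₁
    simp only [hδd, Derivation.leibniz_div, smul_eq_mul] at h₂ ⊢
    rw [div_eq_iff hh0] at h₂
    rw [h₂]
    simp only [map_sub, map_mul]
    field_simp
    ring
  exact ⟨div_ne_zero hh0 hc₀, H.denominator_ne_zero hz,
    key D.Dx dX (Or.inl rfl) (Or.inl rfl) D.Dx_algebraMap sx hsx,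
    key D.Dy dY (Or.inr rfl) (Or.inr rfl) D.Dy_algebraMap sy hsy⟩

/-- For a normalized term with `φ₃ = 0` there is no certificate of the zero operator. -/
theorem eq_zero_of_twist_eq_zero [CharZero K] (H : HypTerm K L) (hn : H.Normalized)
    (hφ : H.phi₃ = 0) {z s : K[X][Y]} (hz : z ≠ 0) (hs : H.b * s = z * dY H.b) (n : ℕ)
    {q : K[X][Y]} (hq : twist dY (H.denominator z) (H.numerator dY z s) ((n : K) - 1) q = 0) :
    q = 0 := by
  by_contra hq0
  have hv := H.denominator_ne_zero hz
  have hiv := fraction_ne_zero hv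
  have hiq := fraction_ne_zero hq0
  set v := H.denominator z with hvdef
  have hinj := IsFractionRing.injective K[X][Y] (FractionRing K[X][Y])
  have h₁ := H.numerator_div_denominator hinj (Or.inr rfl : dY = dX ∨ dY = dY) hz hs
  set T : FractionRing K[X][Y] := ((n : K) - 1) • logDerivY v - logDerivY q -
    ∑ l, H.e l • logDerivY (H.c l) with hT
  -- Division of the equation `hq` by `v * q` isolates the derivative of `a / b` and leaves
  -- logarithmic derivatives, which are proper in `y` and have simple poles.
  have h₂ : algebraMap K[X][Y] (FractionRing K[X][Y]) (dY H.a * H.b - H.a * dY H.b) /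
      algebraMap K[X][Y] (FractionRing K[X][Y]) H.b ^ 2 = T := by
    have h₃ := congrArg (algebraMap K[X][Y] (FractionRing K[X][Y])) hq
    have h₄ : ∑ l, H.e l • logDerivY (H.c l) = ∑ l, algebraMap K (FractionRing K[X][Y]) (H.e l) *
        (algebraMap K[X][Y] (FractionRing K[X][Y]) (dY (H.c l)) /
          algebraMap K[X][Y] (FractionRing K[X][Y]) (H.c l)) :=
      Finset.sum_congr rfl fun l _ => Algebra.smul_def _ _
    rw [hT, h₄, eq_sub_iff_add_eq, ← h₁, ← hvdef]
    rw [twist, Algebra.smul_def] at h₃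
    simp only [map_add, map_mul, map_sub, map_zero, ← IsScalarTower.algebraMap_apply] at h₃
    rw [Algebra.smul_def, logDerivY, logDerivY]
    simp only [map_sub]
    field_simp
    linear_combination h₃
  obtain ⟨hT0, hab⟩ := not_dependent_of_derivative_eq H.b_ne (T := T)
    (sub_mem (sub_mem (Submodule.smul_mem _ _ (logDerivY_mem_properY hv))
      (logDerivY_mem_properY hq0)) (Submodule.sum_mem _ fun l _ =>
        Submodule.smul_mem _ _ (logDerivY_mem_properY (H.c_ne l))))
    (fun π hπ => sub_mem (sub_mem (Submodule.smul_mem _ _ (logDerivY_mem_simplePoleAt hπ hv))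
      (logDerivY_mem_simplePoleAt hπ hq0)) (Submodule.sum_mem _ fun l _ =>
        Submodule.smul_mem _ _ (logDerivY_mem_simplePoleAt hπ (H.c_ne l)))) h₂
  -- At a prime factor `π` of `c l` that involves `y`, the residue of `T = 0` is `(n - 1) * m₁ - m₂
  -- - e l` with integers `m₁`, `m₂`: the other `c k` are coprime to `c l`, and `π` occurs in the
  -- square free `c l` exactly once.
  have hint : ∀ l, degY (H.c l) ≠ 0 → ∃ k : ℤ, H.e l = k := by
    intro l hl
    have hdc : dY (H.c l) ≠ 0 := fun h0 => hl (derivative_eq_zero.1 h0)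
    obtain ⟨π, hπ, hdvd, hdπ⟩ : ∃ π, Prime π ∧ π ∣ H.c l ∧ dY π ≠ 0 := by
      by_contra hcon
      push Not at hcon
      exact hdc (dY_eq_zero_of_forall_prime _ (H.c_ne l) hcon)
    obtain ⟨m₁, hm₁, -⟩ := exists_logDerivY_sub_mem hπ hv
    obtain ⟨m₂, hm₂, -⟩ := exists_logDerivY_sub_mem hπ hq0
    obtain ⟨m₃, hm₃, hm₃0, hm₃1⟩ := exists_logDerivY_sub_mem hπ (H.c_ne l)
    have hm₃' : m₃ = 1 := by
      have := hm₃0 hdvd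
      have := hm₃1 (hn.1 l)
      omega
    subst hm₃'
    have hrest : ∑ k ∈ Finset.univ.erase l, H.e k • logDerivY (H.c k) ∈ regularAt hπ := by
      refine sum_mem fun k hk => Subalgebra.smul_mem _ (logDerivY_mem_regularAt hπ fun hdvd' => ?_) _
      exact hπ.not_isUnit (hn.2.1 k l (Finset.ne_of_mem_erase hk) hdvd' hdvd)
    rw [hT, ← Finset.add_sum_erase _ _ (Finset.mem_univ l)] at hT0
    have hreg : ((((n : K) - 1) * m₁ - m₂) - H.e l) • logDerivY π ∈ regularAt hπ := by
      have : ((((n : K) - 1) * m₁ - m₂) - H.e l) • logDerivY π =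
          -(((n : K) - 1) • (logDerivY v - (m₁ : K) • logDerivY π)) +
          (logDerivY q - (m₂ : K) • logDerivY π) +
          H.e l • (logDerivY (H.c l) - ((1 : ℕ) : K) • logDerivY π) +
          ∑ k ∈ Finset.univ.erase l, H.e k • logDerivY (H.c k) := by
        simp only [sub_smul, smul_sub, mul_smul, Nat.cast_one, one_smul] at hT0 ⊢
        linear_combination hT0
      rw [this]
      exact add_mem (add_mem (add_mem (neg_mem (Subalgebra.smul_mem _ hm₁ _)) hm₂)
        (Subalgebra.smul_mem _ hm₃ _)) hrest
    have := eq_zero_of_smul_logDerivY_mem hπ hdπ hreg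
    refine ⟨((n : ℤ) - 1) * m₁ - m₂, ?_⟩
    push_cast
    linear_combination -this
  have hphi : H.phi₃ = 1 := by
    refine if_pos ⟨hab, fun l => ?_, ?_⟩
    · by_cases hl : degY (H.c l) = 0
      · exact Or.inl hl
      · exact Or.inr (hint l hl)
    -- An integer exponent that is not a natural number is negative, so every summand is at most
    -- zero and the degree condition in `φ₃` holds automatically.
    · have hex : ∀ l, ∃ k : ℤ, k ≤ 0 ∧ H.e l * (degY (H.c l) : K) = (k : K) := by
        intro l
        by_cases hl : degY (H.c l) = 0
        · exact ⟨0, le_rfl, by simp [hl]⟩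
        · obtain ⟨k, hk⟩ := hint l hl
          refine ⟨k * degY (H.c l), ?_, by rw [hk]; push_cast; ring⟩
          have : k ≤ 0 := by
            by_contra hpos
            push Not at hpos
            refine hn.2.2 l k.toNat ?_
            rw [hk]
            have : ((k.toNat : ℤ) : K) = (k : K) := by rw [Int.toNat_of_nonneg hpos.le]
            exact_mod_cast this.symm
          exact mul_nonpos_of_nonpos_of_nonneg this (by positivity)
      choose f hf₁ hf₂ using hex
      refine ⟨∑ l, f l, ?_, ?_⟩
      · rw [Finset.sum_congr rfl fun l _ => hf₂ l]
        push_cast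
        rfl
      · exact (Finset.sum_nonpos fun l _ => hf₁ l).trans (by positivity)
  omega

end HypTerm

end Terms

/-! ## Computing a telescoper from the logarithmic derivatives -/

section Core

open Polynomial

variable {K Ω : Type*} [Field K]

theorem slp_iterate {V : Set (Ω → K)} (p : ℕ → Ω → K[X][Y]) (m c : ℕ) (h₀ : Known V (p 0))
    (h : ∀ i, i < m → ∀ W, V ⊆ W → Known W (p i) → SLP W c (coefs (p (i + 1)))) :
    SLP V (m * c) {f | ∃ i, i ≤ m ∧ f ∈ coefs (p i)} := by
  induction m with
  | zero =>
    refine SLP.of_subset ?_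
    rintro f ⟨i, hi, hf⟩
    obtain rfl : i = 0 := by omega
    exact h₀ hf
  | succ m ih =>
    rw [add_mul, one_mul]
    have ih := ih fun i hi => h i (by omega)
    refine ih.trans fun W hVW hW => ?_
    refine ((h m (by omega) W hVW fun f hf => hW ⟨m, le_rfl, hf⟩).union (M := 0)
      (SLP.of_subset hW)).mono subset_rfl le_rfl ?_
    rintro f ⟨i, hi, hf⟩
    rcases Nat.lt_or_ge m i with hmi | hmi
    · obtain rfl : i = m + 1 := by omega
      exact Or.inl hf
    · exact Or.inr ⟨i, hmi, hf⟩

/-- The correctness of the solver is only known for inputs that satisfy the hypotheses. Truncating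
its output at degree `n` yields vectors with bounded degrees for all inputs and changes nothing
where the output is correct. -/
theorem Reach.solve {κ : ℕ → ℝ} (hκ : SolvesLinearSystems K κ) {n m k : ℕ} (hn : 1 ≤ n)
    (hm : 1 ≤ m) (hkm : k ≤ m) (A : Ω → Matrix (Fin k) (Fin m) K[X]) (S : Set Ω)
    (V : Set (Ω → K)) (hV : HasConsts V) (hA : ∀ i j a, (fun H => (A H i j).coeff a) ∈ V)
    (hdeg : ∀ H ∈ S, ∀ i j, (A H i j).natDegree ≤ n)
    (hex : ∀ H ∈ S, ∃ u : Fin m → K[X], u ≠ 0 ∧ (∀ j, (u j).natDegree ≤ n) ∧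
      (A H).mulVec u = 0) :
    Reach (fun S' V' => ∃ w : Fin m → Ω → K[X], (∀ j a, (fun H => (w j H).coeff a) ∈ V') ∧
      (∀ j H, (w j H).natDegree ≤ n) ∧
      ∀ H ∈ S', (fun j => w j H) ≠ 0 ∧ (A H).mulVec (fun j => w j H) = 0)
      ⌊(n : ℝ) * (m : ℝ) ^ 3 * κ (max n m)⌋₊ S V := by
  obtain ⟨T, hT⟩ := hκ n m k hn hm hkm
  have h := Reach.of_tree T (fun H s => (A H s.1 s.2.1).coeff s.2.2)
    (fun H out => ∃ w : Fin m → K[X], w ≠ 0 ∧ (∀ j, (w j).natDegree ≤ n) ∧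
      (A H).mulVec w = 0 ∧ out = fun s => (w s.1).coeff s.2) (fun _ _ => 0)
    ⌊(n : ℝ) * (m : ℝ) ^ 3 * κ (max n m)⌋₊ S V hV (fun s => hA _ _ _) (fun _ => hV 0) (by
      intro H hH
      obtain ⟨w, hw0, hwd, hwA, k, hrun, hk⟩ := hT (A H) (hdeg H hH) (hex H hH)
      exact ⟨_, k, hrun, Nat.le_floor hk, w, hw0, hwd, hwA, rfl⟩)
  refine h.bind (M := 0) fun S' V' _ hVV' hG => ?_
  obtain ⟨out, hout, hQ⟩ := hG
  set w : Fin m → Ω → K[X] := fun j H => ∑ a ∈ Finset.range (n + 1), monomial a (out (j, a) H)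
    with hw
  have hcoeff : ∀ j H a, (w j H).coeff a = if a ≤ n then out (j, a) H else 0 := by
    intro j H a
    simp only [hw, finsetSum_coeff, coeff_monomial, Finset.sum_ite_eq', Finset.mem_range,
      Nat.lt_succ_iff]
  refine .done ⟨w, fun j a => ?_, fun j H => ?_, fun H hH => ?_⟩
  · by_cases ha : a ≤ n
    · simpa [hcoeff, ha] using hout (j, a)
    · simpa [hcoeff, ha] using (hV.mono hVV') 0
  · refine natDegree_le_iff_coeff_eq_zero.2 fun a ha => ?_
    rw [hcoeff, if_neg (by omega)]
  · obtain ⟨w', h0, hd, hA', heq⟩ := hQ H hH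
    have : (fun j => w j H) = w' := by
      funext j
      ext a
      rw [hcoeff]
      have := congrFun heq (j, a)
      dsimp only at this
      rw [this]
      split_ifs with ha
      · rfl
      · exact (coeff_eq_zero_of_natDegree_lt ((hd j).trans_lt (by omega))).symm
    rw [this]
    exact ⟨h0, hA'⟩

/-! ### The linear system -/

/-- Each summand has one factor whose degree in `y` drops: the derivative of `q` in one, `w - c *
∂v` in the other. So the degree grows by at most `t - 1`. -/
theorem natDegree_twist_dY {v w q : K[X][Y]} {c : K} {t b : ℕ} (hv : v.natDegree ≤ t)
    (hw : w.natDegree < t) (hq : q.natDegree ≤ b + 1) :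
    (twist dY v w c q).natDegree ≤ t + b := by
  refine (natDegree_add_le _ _).trans (max_le ?_ ?_)
  · refine natDegree_mul_le.trans ?_
    have := natDegree_derivative_le q
    rw [dY_apply]
    omega
  · refine natDegree_mul_le.trans ?_
    have h₁ : (w - c • dY v).natDegree ≤ t - 1 := by
      refine (natDegree_sub_le _ _).trans (max_le (by omega) ?_)
      refine (natDegree_smul_le _ _).trans ((natDegree_derivative_le v).trans (by omega))
    omega

theorem DegLE.numerators {c₀ v wx : K[X][Y]} {a t : ℕ} (hc : DegLE c₀ a t) (hv : DegLE v a t)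
    (hw : DegLE wx a t) (i : ℕ) : DegLE (numerators c₀ v wx i) ((i + 1) * a) ((i + 1) * t) := by
  induction i with
  | zero => simpa [_root_.numerators] using hc
  | succ i ih => exact (DegLE.twist (Or.inl rfl) hv hw _ ih).mono (le_of_eq (by ring)) (le_of_eq (by ring))

theorem DegLE.numerators_mul_pow {c₀ v wx : K[X][Y]} {a t : ℕ} (hc : DegLE c₀ a t)
    (hv : DegLE v a t) (hw : DegLE wx a t) {r i : ℕ} (hi : i ≤ r) :
    DegLE (_root_.numerators c₀ v wx i * v ^ (r - i)) ((r + 1) * a) ((r + 1) * t) := by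
  obtain ⟨k, rfl⟩ := Nat.exists_eq_add_of_le hi
  rw [Nat.add_sub_cancel_left]
  exact ((hc.numerators hv hw i).mul (hv.pow k)).mono (le_of_eq (by ring)) (le_of_eq (by ring))

/-- The matrix of the linear system for the coefficients of a telescoper of order `r` and of a
certificate with numerator a multiple of `g`. -/
def telescoperMatrix (c₀ v wx wy g : K[X][Y]) (r k J : ℕ) :
    Matrix (Fin k) (Fin (r + 1 + J)) K[X] :=
  fun e => Fin.append
    (fun i : Fin (r + 1) => (numerators c₀ v wx i * v ^ (r - i)).coeff e)
    (fun j : Fin J => (twist dY v wy ((r : K) - 1) (g * Y ^ (j : ℕ))).coeff e)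

/-- The polynomial in `y` with given coefficients. -/
def certificatePolynomial {J : ℕ} (w : Fin J → K[X]) : K[X][Y] :=
  ∑ j : Fin J, C (w j) * Y ^ (j : ℕ)

theorem coeff_certificatePolynomial {J : ℕ} (w : Fin J → K[X]) (j : ℕ) :
    (certificatePolynomial w).coeff j = if h : j < J then w ⟨j, h⟩ else 0 := by
  simp only [certificatePolynomial, finsetSum_coeff, coeff_C_mul_X_pow]
  split_ifs with h
  · rw [Finset.sum_eq_single ⟨j, h⟩]
    · simp
    · intro i _ hi
      rw [if_neg fun h' => hi (Fin.ext h'.symm)]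
    · simp
  · refine Finset.sum_eq_zero fun i _ => if_neg ?_
    have := i.2
    omega

/-- Coefficients beyond `y ^ ((r + 1) * t)` vanish on both sides for reasons of degree, so finitely
many equations imply the full identity. The sign of `g` moves the certificate to the other side. -/
theorem telescoperMatrix_mulVec {c₀ v wx wy g : K[X][Y]} {r k J a t b : ℕ} (hc : DegLE c₀ a t)
    (hv : DegLE v a t) (hwx : DegLE wx a t) (hwy : wy.natDegree < t) (hg : DegLE g 0 b)
    (hk : (r + 1) * t < k) (hJ : J + b ≤ r * t + 2) {w : Fin (r + 1 + J) → K[X]}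
    (hw : (telescoperMatrix c₀ v wx wy g r k J).mulVec w = 0) :
    ∑ i : Fin (r + 1), C (w (Fin.castAdd J i)) * (numerators c₀ v wx i * v ^ (r - i)) =
      twist dY v wy ((r : K) - 1)
        (-g * certificatePolynomial fun j => w (Fin.natAdd (r + 1) j)) := by
  have h₁ : twist dY v wy ((r : K) - 1)
        (-g * certificatePolynomial fun j => w (Fin.natAdd (r + 1) j)) =
      - ∑ j : Fin J, C (w (Fin.natAdd (r + 1) j)) *
        twist dY v wy ((r : K) - 1) (g * Y ^ (j : ℕ)) := by
    rw [certificatePolynomial, Finset.mul_sum, twist_sum, ← Finset.sum_neg_distrib]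
    refine Finset.sum_congr rfl fun j _ => ?_
    rw [show -g * (C (w (Fin.natAdd (r + 1) j)) * Y ^ (j : ℕ)) =
      C (-w (Fin.natAdd (r + 1) j)) * (g * Y ^ (j : ℕ)) by rw [C_neg]; ring, twist_dY_C_mul,
      C_neg]
    ring
  rw [h₁, eq_neg_iff_add_eq_zero]
  ext1 e
  rw [coeff_add, finsetSum_coeff, finsetSum_coeff, coeff_zero]
  by_cases he : e < k
  · have h₂ : ∑ j, telescoperMatrix c₀ v wx wy g r k J ⟨e, he⟩ j * w j = 0 :=
      congrFun hw ⟨e, he⟩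
    rw [Fin.sum_univ_add] at h₂
    simp only [telescoperMatrix, Fin.append_left, Fin.append_right] at h₂
    rw [← h₂]
    congr 1 <;> exact Finset.sum_congr rfl fun i _ => by rw [coeff_C_mul, mul_comm]
  · have h₂ : ∀ i : Fin (r + 1),
        (C (w (Fin.castAdd J i)) * (numerators c₀ v wx i * v ^ (r - i))).coeff e = 0 := by
      intro i
      have := (hc.numerators_mul_pow hv hwx (Nat.lt_succ_iff.1 i.2)).natDegree
      rw [coeff_C_mul, coeff_eq_zero_of_natDegree_lt (by omega), mul_zero]
    have h₃ : ∀ j : Fin J, (C (w (Fin.natAdd (r + 1) j)) *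
        twist dY v wy ((r : K) - 1) (g * Y ^ (j : ℕ))).coeff e = 0 := by
      intro j
      have h₄ : (g * Y ^ (j : ℕ)).natDegree ≤ r * t + 1 := by
        have := (hg.mul (DegLE.X_pow (j : ℕ))).natDegree
        have := j.2
        omega
      rcases Nat.eq_zero_or_pos (r * t) with h0 | h0
      · rw [h0] at h₄
        have := natDegree_twist_dY (c := (r : K) - 1) hv.natDegree hwy h₄
        have h5 : t ≤ (r + 1) * t := Nat.le_mul_of_pos_left _ (by omega)
        rw [coeff_C_mul, coeff_eq_zero_of_natDegree_lt (by omega), mul_zero]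
      · have := natDegree_twist_dY (c := (r : K) - 1) hv.natDegree hwy h₄
        have h5 : (r + 1) * t = r * t + t := by ring
        rw [coeff_C_mul, coeff_eq_zero_of_natDegree_lt (by omega), mul_zero]
    simp [h₂, h₃]

/-- The columns of the certificate have much smaller degree than those of the telescoper; the degree
count below exploits this. -/
theorem natDegree_telescoperMatrix {c₀ v wx wy g : K[X][Y]} {r k J a t b : ℕ} (hc : DegLE c₀ a t)
    (hv : DegLE v a t) (hwx : DegLE wx a t) (hwy : DegLE wy a t) (hg : DegLE g 0 b) (e : Fin k)
    (j : Fin (r + 1 + J)) : (telescoperMatrix c₀ v wx wy g r k J e j).natDegree ≤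
      Fin.append (fun _ : Fin (r + 1) => (r + 1) * a) (fun _ : Fin J => a) j := by
  refine Fin.addCases (fun i => ?_) (fun j => ?_) j
  · rw [telescoperMatrix, Fin.append_left, Fin.append_left]
    exact (hc.numerators_mul_pow hv hwx (Nat.lt_succ_iff.1 i.2)).natDegree_coeff _
  · rw [telescoperMatrix, Fin.append_right, Fin.append_right]
    exact (DegLE.twist (Or.inr rfl) hv hwy _ (hg.mul (DegLE.X_pow _))).natDegree_coeff _

/-- The degree of the solutions of the linear system. -/
def solutionDegree (a t r ε : ℕ) : ℕ :=
  a * ((t - 1 + ε) * (r + 1) + (r * t + 2 - ε)) / (r + 2 - ε - t) + (r + 1) * a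

/-- The telescoper gets degree at most `d`, and the certificate degree at most `d + r * a`, to
compensate for its smaller columns. Each equation then has `d + 1 + (r + 1) * a` coefficients. After
cancellation, having more unknown coefficients than conditions means `s * (d + 1) > Z`, where `s` is
the surplus of unknowns over equations; `d = Z / s` is chosen for this. -/
theorem exists_telescoperMatrix_kernel {c₀ v wx wy g : K[X][Y]} {r a t ε : ℕ} (ht : 1 ≤ t)
    (hε : ε ≤ 1) (hr : t + ε ≤ r + 1) (hc : DegLE c₀ a t)
    (hv : DegLE v a t) (hwx : DegLE wx a t) (hwy : DegLE wy a t) (hg : DegLE g 0 ε) :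
    ∃ w : Fin (r + 1 + (r * t + 2 - ε)) → K[X], w ≠ 0 ∧
      (∀ j, (w j).natDegree ≤ solutionDegree a t r ε) ∧
      (telescoperMatrix c₀ v wx wy g r ((r + 1) * t + 1) (r * t + 2 - ε)).mulVec w = 0 := by
  set J := r * t + 2 - ε with hJ
  set s := r + 2 - ε - t with hs
  set Z := a * ((t - 1 + ε) * (r + 1) + J) with hZ
  set d := Z / s with hd
  obtain ⟨w, hw0, hwd, hwA⟩ := exists_kernel_of_count
    (telescoperMatrix c₀ v wx wy g r ((r + 1) * t + 1) J)
    (Fin.append (fun _ : Fin (r + 1) => d + 1) (fun _ : Fin J => d + 1 + r * a))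
    (d + 1 + (r + 1) * a) (by
      intro i j
      refine (Nat.add_le_add_right (natDegree_telescoperMatrix hc hv hwx hwy hg i j) _).trans ?_
      refine Fin.addCases (fun i => ?_) (fun j => ?_) j
      · rw [Fin.append_left, Fin.append_left]
        omega
      · rw [Fin.append_right, Fin.append_right, add_mul]
        omega) (by
      rw [Fin.sum_univ_add]
      simp only [Fin.append_left, Fin.append_right, Finset.sum_const, Finset.card_univ,
        Fintype.card_fin, smul_eq_mul]
      have h₁ : Z < s * (d + 1) := Nat.lt_mul_div_succ Z (by omega)
      have e₁ : ((r + 1) * t + 1) + s = r + 1 + J := by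
        have : (r + 1) * t = r * t + t := by ring
        omega
      -- The number of equations is `J + (t - 1 + ε)`; the part `J * r` is balanced by the larger
      -- degree of the certificate, and the rest is `Z / a`.
      have e₂ : ((r + 1) * t + 1) * (r + 1) = J * r + J + (t - 1 + ε) * (r + 1) := by
        have : (r + 1) * t + 1 = J + (t - 1 + ε) := by
          have : (r + 1) * t = r * t + t := by ring
          omega
        rw [this]
        ring
      calc ((r + 1) * t + 1) * (d + 1 + (r + 1) * a)
          = ((r + 1) * t + 1) * (d + 1) + (((r + 1) * t + 1) * (r + 1)) * a := by ring
        _ = ((r + 1) * t + 1) * (d + 1) + J * (r * a) + Z := by rw [e₂, hZ]; ring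
        _ < ((r + 1) * t + 1) * (d + 1) + J * (r * a) + s * (d + 1) := by omega
        _ = (((r + 1) * t + 1) + s) * (d + 1) + J * (r * a) := by ring
        _ = (r + 1) * (d + 1) + J * (d + 1 + r * a) := by rw [e₁]; ring)
  refine ⟨w, hw0, fun j => ?_, hwA⟩
  have h₁ : solutionDegree a t r ε = d + (r + 1) * a := rfl
  rw [h₁]
  have h₂ : Fin.append (fun _ : Fin (r + 1) => d + 1) (fun _ : Fin J => d + 1 + r * a) j ≤
      d + 1 + r * a := by
    refine Fin.addCases (fun i => ?_) (fun j => ?_) j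
    · rw [Fin.append_left]
      omega
    · rw [Fin.append_right]
  have h₃ : (r + 1) * a = r * a + a := by ring
  rcases hwd j with h | h
  · omega
  · rw [h, natDegree_zero]
    omega

end Core

/-! ### Cost of setting up the system and of the output -/

section CoreComputation

open Polynomial

/-- `∑ i, p i * Dx ^ i` is a telescoper for all `c₀ * z` with `z` having the logarithmic derivatives
`wx / v` and `wy / v`, and `f / g` times this element is a certificate. -/
def Telescopes {K : Type u} [Field K] (c₀ v wx wy : K[X][Y]) (r : ℕ) (p : Fin (r + 1) → K[X])
    (f g : K[X][Y]) : Prop :=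
  ∀ (E : Type v) [Field E] [Algebra K E] [Algebra K[X][Y] E] [IsScalarTower K K[X][Y] E]
    (D : DiffFieldExt K E) (z : E), D.HasLogDerivs z v wx wy →
      D.IsCTRelation (algebraMap K[X][Y] E c₀ * z) r p
        (algebraMap K[X][Y] E f / algebraMap K[X][Y] E g * (algebraMap K[X][Y] E c₀ * z))

variable {K : Type u} {Ω : Type*} [Field K]

theorem known_C {V : Set (Ω → K)} (hV : HasConsts V) {p : Ω → K[X]} :
    Known V (fun H => C (p H)) ↔ ∀ i, (fun H => (p H).coeff i) ∈ V := by
  rw [known_iff]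
  constructor
  · intro h i
    have := h i 0
    unfold coef at this
    simpa only [coeff_C_zero] using this
  · intro h i j
    unfold coef
    by_cases hj : j = 0
    · subst hj
      simpa only [coeff_C_zero] using h i
    · simpa only [coeff_C, hj, if_false, coeff_zero] using hV 0

theorem add_mul_succ_le {a i D : ℕ} (ha : a + 2 ≤ D) (hi : i + 2 ≤ D) :
    a + (i + 1) * a + 2 ≤ D ^ 2 := by
  nlinarith [Nat.mul_le_mul_right a hi, Nat.mul_le_mul_left D ha]

section Setup

variable {V : Set (Ω → K)} {c₀ v wx wy : Ω → K[X][Y]} {a t r D : ℕ}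

theorem slp_numerators (hV : HasConsts V) (ha : a + 2 ≤ D) (ht : t + 2 ≤ D) (hr : r + 2 ≤ D)
    (hc : ∀ H, DegLE (c₀ H) a t) (hv : ∀ H, DegLE (v H) a t) (hw : ∀ H, DegLE (wx H) a t)
    (kc : Known V c₀) (kv : Known V v) (kw : Known V wx) :
    SLP V (9 * D ^ 7)
      {f | ∃ i, i ≤ r ∧ f ∈ coefs fun H => numerators (c₀ H) (v H) (wx H) i} := by
  refine (slp_iterate (fun i H => numerators (c₀ H) (v H) (wx H) i) r (9 * D ^ 6) kc
    fun i hi W hVW kN => ?_).mono subset_rfl ?_ subset_rfl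
  · refine (slp_twist (Or.inl rfl) (hV.mono hVW) hv hw
      (fun H => (hc H).numerators (hv H) (hw H) i) (kv.mono hVW) (kw.mono hVW) kN (i : K)).mono
        subset_rfl ?_ subset_rfl
    have h₁ : a + (i + 1) * a + 1 ≤ D ^ 2 := by
      have := add_mul_succ_le (i := i) ha (by omega)
      omega
    have h₂ : t + (i + 1) * t + 1 ≤ D ^ 2 := by
      have := add_mul_succ_le (i := i) ht (by omega)
      omega
    calc _ ≤ 9 * (D ^ 2 * D ^ 2) * (D * D) := by gcongr <;> omega
      _ = 9 * D ^ 6 := by ring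
  · calc r * (9 * D ^ 6) ≤ D * (9 * D ^ 6) := by gcongr; omega
      _ = 9 * D ^ 7 := by ring

/-- Used with `k = 1` for the powers in the matrix and with `k = 2` for the denominator of the
raised certificate, whose exponent may reach `2 * r`. -/
theorem slp_powers (hV : HasConsts V) (ha : a + 2 ≤ D) (ht : t + 2 ≤ D) {m k : ℕ}
    (hm : m ≤ k * r) (hr : r + 2 ≤ D) (hk : 1 ≤ k)
    (hv : ∀ H, DegLE (v H) a t) (kv : Known V v) :
    SLP V (2 * k ^ 3 * D ^ 7) {f | ∃ i, i ≤ m ∧ f ∈ coefs fun H => v H ^ i} := by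
  refine (slp_iterate (fun i H => v H ^ i) m (2 * k ^ 2 * D ^ 6)
    (by simpa using known_const hV (1 : K[X][Y])) fun i hi W hVW kN => ?_).mono
      subset_rfl ?_ subset_rfl
  · have h := slp_mul (hV.mono hVW) hv (fun H => (hv H).pow i) (kv.mono hVW) kN
    simp only [← pow_succ'] at h
    refine h.mono subset_rfl ?_ subset_rfl
    have aux : ∀ b, b + 2 ≤ D → b + i * b + 1 ≤ k * D ^ 2 := by
      intro b hb
      calc b + i * b + 1 = (i + 1) * b + 1 := by ring
        _ ≤ (k * D) * b + 1 := by
          have : i + 1 ≤ k * D := by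
            have h1 : k * r ≤ k * D := Nat.mul_le_mul_left _ (by omega)
            omega
          gcongr
        _ ≤ (k * D) * b + k * D := by
          have : 1 ≤ k * D := Nat.mul_pos hk (by omega)
          omega
        _ = k * D * (b + 1) := by ring
        _ ≤ k * D * D := by gcongr; omega
        _ = k * D ^ 2 := by ring
    calc _ ≤ (k * D ^ 2) * (k * D ^ 2) * (2 * (D * D)) := by
          gcongr
          · exact aux a ha
          · exact aux t ht
          · omega
          · omega
      _ = 2 * k ^ 2 * D ^ 6 := by ring
  · calc m * (2 * k ^ 2 * D ^ 6) ≤ (k * D) * (2 * k ^ 2 * D ^ 6) := by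
          gcongr
          exact hm.trans (Nat.mul_le_mul_left _ (by omega))
      _ = 2 * k ^ 3 * D ^ 7 := by ring

/-- The products of numerators and powers of `v` have about `D ^ 4` coefficients in both factors.
The direct method would take about `D ^ 8` operations for each of the `r + 1` products and exceed
the error terms; interpolation with `N = D ^ 2` takes `8 * D ^ 6`. The other columns involve factors
of the size of `v` only, and `D ^ 5` operations each. -/
theorem slp_telescoperMatrix [CharZero K] (hV : HasConsts V) (ha : a + 2 ≤ D) (ht : t + 2 ≤ D)
    (hr : r + 2 ≤ D) {g : K[X][Y]} {ε J : ℕ} (hg : DegLE g 0 ε) (hJ : J + ε ≤ r * t + 2) (k : ℕ)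
    (hc : ∀ H, DegLE (c₀ H) a t) (hv : ∀ H, DegLE (v H) a t) (hwx : ∀ H, DegLE (wx H) a t)
    (hwy : ∀ H, DegLE (wy H) a t)
    (kc : Known V c₀) (kv : Known V v) (kwx : Known V wx) (kwy : Known V wy) :
    SLP V (28 * D ^ 7) {f | ∃ i j b, f = fun H =>
      (telescoperMatrix (c₀ H) (v H) (wx H) (wy H) g r k J i j).coeff b} := by
  refine SLP.mono ?_ subset_rfl
    (show 9 * D ^ 7 + (2 * 1 ^ 3 * D ^ 7 + (8 * D ^ 7 + 9 * D ^ 7)) ≤ 28 * D ^ 7 by omega) subset_rfl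
  refine (slp_numerators hV ha ht hr hc hv hwx kc kv kwx).trans fun V₁ s₁ k₁ => ?_
  refine (slp_powers (hV.mono s₁) ha ht (m := r) (by omega) hr le_rfl hv (kv.mono s₁)).trans
    fun V₂ s₂ k₂ => ?_
  have hV₂ := (hV.mono s₁).mono s₂
  have hM : SLP V₂ (8 * D ^ 7) {f | ∃ i, i ≤ r ∧
      f ∈ coefs fun H => numerators (c₀ H) (v H) (wx H) i * v H ^ (r - i)} := by
    have h := SLP.biUnion (V := V₂) (N := 8 * (D ^ 2) ^ 3) (Finset.range (r + 1))
      (fun i => coefs fun H => numerators (c₀ H) (v H) (wx H) i * v H ^ (r - i)) (by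
        intro i hi
        rw [Finset.mem_range] at hi
        refine slp_mul_interpolation hV₂ (fun H => (hc H).numerators (hv H) (hwx H) i)
          (fun H => (hv H).pow (r - i)) (fun f hf => s₂ (k₁ ⟨i, by omega, hf⟩))
          (fun f hf => k₂ ⟨r - i, by omega, hf⟩) ?_ ?_
        · obtain ⟨l, rfl⟩ := Nat.exists_eq_add_of_le (Nat.lt_succ_iff.1 hi)
          have := add_mul_succ_le (i := i + l) ha hr
          have e : (i + 1) * a + (i + l - i) * a = (i + l + 1) * a := by
            rw [Nat.add_sub_cancel_left]
            ring
          omega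
        · obtain ⟨l, rfl⟩ := Nat.exists_eq_add_of_le (Nat.lt_succ_iff.1 hi)
          have := add_mul_succ_le (i := i + l) ht hr
          have e : (i + 1) * t + (i + l - i) * t = (i + l + 1) * t := by
            rw [Nat.add_sub_cancel_left]
            ring
          omega)
    rw [Finset.card_range] at h
    refine h.mono subset_rfl ?_ ?_
    · calc (r + 1) * (8 * (D ^ 2) ^ 3) ≤ D * (8 * (D ^ 2) ^ 3) := by gcongr; omega
        _ = 8 * D ^ 7 := by ring
    · rintro f ⟨i, hi, hf⟩
      exact Set.mem_biUnion (x := i) (by simp; omega) hf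
  refine hM.trans fun V₃ s₃ k₃ => ?_
  have t₃ := s₁.trans (s₂.trans s₃)
  have hV₃ := hV₂.mono s₃
  have hP : SLP V₃ (9 * D ^ 7) {f | ∃ j, j < J ∧
      f ∈ coefs fun H => twist dY (v H) (wy H) ((r : K) - 1) (g * Y ^ j)} := by
    have hrt : r * t + 2 + t ≤ D ^ 2 := by nlinarith
    have h := SLP.biUnion (V := V₃) (N := 9 * D ^ 5) (Finset.range J)
      (fun j => coefs fun H => twist dY (v H) (wy H) ((r : K) - 1) (g * Y ^ j)) (by
        intro j hj
        rw [Finset.mem_range] at hj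
        refine (slp_twist (Or.inr rfl) hV₃ hv hwy (fun _ => hg.mul (DegLE.X_pow j))
          (kv.mono t₃) (kwy.mono t₃) (known_const hV₃ _) _).mono subset_rfl ?_ subset_rfl
        calc _ ≤ 9 * (D * D ^ 2) * (D * D) := by gcongr <;> omega
          _ = 9 * D ^ 5 := by ring)
    rw [Finset.card_range] at h
    refine h.mono subset_rfl ?_ ?_
    · calc J * (9 * D ^ 5) ≤ D ^ 2 * (9 * D ^ 5) := by gcongr; omega
        _ = 9 * D ^ 7 := by ring
    · rintro f ⟨j, hj, hf⟩
      exact Set.mem_biUnion (x := j) (by simpa using hj) hf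
  refine (hP.union (M := 0) (SLP.of_subset k₃)).mono subset_rfl (by omega) ?_
  rintro _ ⟨i, j, b, rfl⟩
  refine Fin.addCases (fun l => ?_) (fun l => ?_) j
  · right
    simp only [telescoperMatrix, Fin.append_left]
    exact ⟨l, Nat.lt_succ_iff.1 l.2, b, i, rfl⟩
  · left
    simp only [telescoperMatrix, Fin.append_right]
    exact ⟨l, l.2, b, i, rfl⟩

theorem DegLE.raisedCertificate {v wx q : K[X][Y]} {b c : ℕ} (hv : DegLE v a t)
    (hw : DegLE wx a t) (hq : DegLE q b c) (k : ℕ) :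
    DegLE (raisedCertificate v wx r q k) (b + k * a) (c + k * t) := by
  induction k with
  | zero => simpa [_root_.raisedCertificate] using hq
  | succ k ih =>
    exact (DegLE.twist (Or.inl rfl) hv hw _ ih).mono (le_of_eq (by ring)) (le_of_eq (by ring))

/-- By `hb` the degree in `x` at most about doubles while `k ≤ r` derivatives are taken, so the cost
stays linear in `b + 1`. -/
theorem slp_raisedCertificate (hV : HasConsts V) (ha : a + 2 ≤ D) (ht : t + 2 ≤ D)
    (hr : r + 2 ≤ D) {k : ℕ} (hk : k ≤ r) (hv : ∀ H, DegLE (v H) a t)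
    (hw : ∀ H, DegLE (wx H) a t) {q : Ω → K[X][Y]} {b : ℕ} (hb : (r + 1) * a ≤ b)
    (hq : ∀ H, DegLE (q H) b (r * t + 2)) (kv : Known V v) (kw : Known V wx) (kq : Known V q) :
    SLP V (36 * (b + 1) * D ^ 5) (coefs fun H => raisedCertificate (v H) (wx H) r (q H) k) := by
  have h := slp_iterate (V := V) (fun i H => raisedCertificate (v H) (wx H) r (q H) i) k
    (36 * (b + 1) * D ^ 4) kq fun i hi W hVW kN => by
      refine (slp_twist (Or.inl rfl) (hV.mono hVW) hv hw
        (fun H => (hv H).raisedCertificate (hw H) (hq H) i) (kv.mono hVW) (kw.mono hVW) kN _).mono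
          subset_rfl ?_ subset_rfl
      have h₁ : a + (b + i * a) + 1 ≤ 2 * (b + 1) := by
        have : (i + 1) * a ≤ (r + 1) * a := Nat.mul_le_mul_right a (by omega)
        rw [add_mul, one_mul] at this
        omega
      have h₂ : t + (r * t + 2 + i * t) + 1 ≤ 2 * D ^ 2 := by
        have : (i + 1) * t ≤ (r + 1) * t := Nat.mul_le_mul_right t (by omega)
        nlinarith [Nat.mul_le_mul hr ht]
      calc _ ≤ 9 * ((2 * (b + 1)) * (2 * D ^ 2)) * (D * D) := by gcongr <;> omega
        _ = 36 * (b + 1) * D ^ 4 := by ring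
  refine h.mono subset_rfl ?_ fun f hf => ⟨k, le_rfl, hf⟩
  calc k * (36 * (b + 1) * D ^ 4) ≤ D * (36 * (b + 1) * D ^ 4) := by gcongr; omega
    _ = 36 * (b + 1) * D ^ 5 := by ring

theorem natDegree_raisedOperator {p : ℕ → K[X]} {n : ℕ} (hp : ∀ i, (p i).natDegree ≤ n) (k i : ℕ) :
    (raisedOperator p k i).natDegree ≤ n := by
  have hd : ∀ f : K[X], f.natDegree ≤ n → (derivative f).natDegree ≤ n := fun f hf =>
    (natDegree_derivative_le f).trans ((Nat.sub_le _ _).trans hf)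
  induction k generalizing i with
  | zero => exact hp i
  | succ k ih =>
    cases i with
    | zero => exact hd _ (ih 0)
    | succ i => exact (natDegree_add_le _ _).trans (max_le (hd _ (ih _)) (ih i))

theorem slp_raisedOperator (hV : HasConsts V) {p : Ω → ℕ → K[X]} {n : ℕ}
    (hp : ∀ H i, (p H i).natDegree ≤ n) (hr : r + 2 ≤ D) {k : ℕ} (hk : k ≤ r)
    (kp : ∀ i, Known V fun H => C (p H i)) :
    SLP V (2 * (n + 1) * D ^ 2)
      {f | ∃ i, i ≤ r ∧ f ∈ coefs fun H => C (raisedOperator (p H) k i)} := by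
  have key : SLP V (k * ((r + 1) * (2 * (n + 1))))
      {f | ∃ i, i ≤ r ∧ f ∈ coefs fun H => C (raisedOperator (p H) k i)} := by
    clear hk
    induction k with
    | zero =>
      refine SLP.of_subset ?_
      rintro f ⟨i, -, hf⟩
      exact kp i hf
    | succ k ih =>
      rw [add_mul, one_mul]
      refine ih.trans fun W hVW kW => ?_
      have hW := hV.mono hVW
      have h := SLP.biUnion (V := W) (N := 2 * (n + 1)) (Finset.range (r + 1))
        (fun i => coefs fun H => C (raisedOperator (p H) (k + 1) i)) (by
          intro i hi
          rw [Finset.mem_range] at hi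
          have hdeg : ∀ i H, DegLE (C (raisedOperator (p H) k i)) n 0 := fun i H =>
            DegLE.C (natDegree_raisedOperator (hp H) k i)
          have h₁ := slp_dX hW (hdeg i) (fun f hf => kW ⟨i, by omega, hf⟩)
          simp only [dX_C, zero_add, mul_one] at h₁
          cases i with
          | zero => exact h₁.mono subset_rfl (by omega) subset_rfl
          | succ i =>
            rw [two_mul]
            refine h₁.trans fun W' hWW' kW' => ?_
            have h₂ := slp_add (hW.mono hWW')
              (p := fun H => C (derivative (raisedOperator (p H) k (i + 1))))
              (fun H => by
                have := (hdeg (i + 1) H).dX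
                rwa [dX_C] at this) (hdeg i) kW'
              (fun f hf => hWW' (kW ⟨i, by omega, hf⟩))
            simp only [zero_add, mul_one, ← C_add] at h₂
            exact h₂)
      rw [Finset.card_range] at h
      refine h.mono subset_rfl le_rfl ?_
      rintro f ⟨i, hi, hf⟩
      exact Set.mem_biUnion (x := i) (by simp; omega) hf
  refine key.mono subset_rfl ?_ subset_rfl
  calc k * ((r + 1) * (2 * (n + 1))) ≤ D * (D * (2 * (n + 1))) := by gcongr <;> omega
    _ = 2 * (n + 1) * D ^ 2 := by ring

end Setup

/-- Finding the last polynomial in a sequence that does not vanish. -/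
theorem Reach.find_last (p : ℕ → Ω → K[X]) (n m : ℕ) (hn : ∀ i H, (p i H).natDegree ≤ n)
    (S : Set Ω) (V : Set (Ω → K)) (kp : ∀ i a, (fun H => (p i H).coeff a) ∈ V) :
    Reach (fun S' _ => (∀ i, i < m → ∀ H ∈ S', p i H = 0) ∨
      ∃ k, k < m ∧ (∀ i, k < i → i < m → ∀ H ∈ S', p i H = 0) ∧ ∀ H ∈ S', p k H ≠ 0)
      (m * (n + 1)) S V := by
  induction m generalizing S V with
  | zero => exact .done (Or.inl fun i hi => absurd hi (Nat.not_lt_zero i))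
  | succ m ih =>
    refine Reach.mono_cost ?_ (show (n + 1) + m * (n + 1) ≤ (m + 1) * (n + 1) by
      rw [add_mul, one_mul, add_comm])
    have h := Reach.find_nonzero (List.range (n + 1)) (fun a H => (p m H).coeff a) S V
      fun a _ => kp m a
    rw [List.length_range] at h
    refine h.bind fun S₁ V₁ _ hV₁ hG => ?_
    rcases hG with hG | ⟨-, a, -, -, -, hG⟩
    · have hzero : ∀ H ∈ S₁, p m H = 0 := by
        intro H hH
        ext a
        by_cases ha : a < n + 1
        · simpa using hG a (List.mem_range.2 ha) H hH
        · rw [coeff_eq_zero_of_natDegree_lt ((hn m H).trans_lt (by omega)), coeff_zero]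
      refine (ih S₁ V₁ fun i a => hV₁ (kp i a)).imp fun S₂ V₂ hS₂ _ hG => ?_
      rcases hG with hG | ⟨k, hk, h₁, h₂⟩
      · refine Or.inl fun i hi H hH => ?_
        rcases Nat.lt_succ_iff_lt_or_eq.1 hi with hi | rfl
        · exact hG i hi H hH
        · exact hzero H (hS₂ hH)
      · refine Or.inr ⟨k, by omega, fun i hki hi H hH => ?_, h₂⟩
        rcases Nat.lt_succ_iff_lt_or_eq.1 hi with hi | rfl
        · exact h₁ i hki hi H hH
        · exact hzero H (hS₂ hH)
    · refine .done (Or.inr ⟨m, by omega, fun i h₁ h₂ => by omega, fun H hH h0 => hG H hH ?_⟩)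
      rw [h0, coeff_zero]

/-- Goal of the computations: the output of a telescoper and a certificate is available. -/
def TelescoperFound (c₀ v wx wy : Ω → K[X][Y]) (r : ℕ) (S : Set Ω) (V : Set (Ω → K)) : Prop :=
  ∃ out : HypOutput r → Ω → K, (∀ w, out w ∈ V) ∧ ∀ H ∈ S,
    ∃ (p : Fin (r + 1) → K[X]) (f g : K[X][Y]), g ≠ 0 ∧
      (fun w => out w H) = HypOutput.value p f g ∧
      Telescopes.{u, v} (c₀ H) (v H) (wx H) (wy H) r p f g

theorem TelescoperFound.of_empty {V : Set (Ω → K)} (hV : HasConsts V)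
    (c₀ v wx wy : Ω → K[X][Y]) (r : ℕ) {S : Set Ω} (hS : ∀ H, H ∉ S) :
    TelescoperFound.{u, v} c₀ v wx wy r S V :=
  ⟨fun _ _ => 0, fun _ => hV 0, fun H hH => absurd hH (hS H)⟩

end CoreComputation

/-! ### From a solution of the system to a telescoper -/

section CoreTheorem

open Polynomial

variable {K : Type u} {Ω : Type*} [Field K]

/-- A polynomial identity is turned into the output of the computation. -/
theorem Reach.output_of_identity {V : Set (Ω → K)} {S : Set Ω} {c₀ v wx wy : Ω → K[X][Y]}
    {a t r D n : ℕ} (ha : a + 2 ≤ D) (ht : t + 2 ≤ D) (hr : r + 2 ≤ D) (hn : (r + 1) * a ≤ n)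
    (hV : HasConsts V) (hc : ∀ H, DegLE (c₀ H) a t) (hv : ∀ H, DegLE (v H) a t)
    (hwx : ∀ H, DegLE (wx H) a t) (kc : Known V c₀) (kv : Known V v) (kwx : Known V wx)
    (hc0 : ∀ H ∈ S, c₀ H ≠ 0) (hv0 : ∀ H ∈ S, v H ≠ 0)
    (p : ℕ → Ω → K[X]) (hp : ∀ i H, (p i H).natDegree ≤ n)
    (kp : ∀ i b, (fun H => (p i H).coeff b) ∈ V) (q : Ω → K[X][Y])
    (hq : ∀ H, DegLE (q H) n (r * t + 2)) (kq : Known V q)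
    (hsol : ∀ H ∈ S, ∑ i ∈ Finset.range (r + 1),
      C (p i H) * (numerators (c₀ H) (v H) (wx H) i * v H ^ (r - i)) =
        twist dY (v H) (wy H) ((r : K) - 1) (q H))
    (hne : ∀ H ∈ S, ∃ i, i ≤ r ∧ p i H ≠ 0) (hpr : ∀ i, r < i → ∀ H, p i H = 0) :
    Reach (TelescoperFound.{u, v} c₀ v wx wy r) (47 * (n + 1) * D ^ 5 + 32 * D ^ 7) S V := by
  have hD2 : 2 ≤ D := by omega
  have hcost : (r + 1) * (n + 1) + (2 * (n + 1) * D ^ 2 + (36 * (n + 1) * D ^ 5 +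
      (8 * (n + 1) * D ^ 4 + (16 * D ^ 7 + 16 * D ^ 7)))) ≤ 47 * (n + 1) * D ^ 5 + 32 * D ^ 7 := by
    have h₁ : (r + 1) * (n + 1) ≤ (n + 1) * D ^ 5 := by
      rw [mul_comm]
      gcongr
      calc r + 1 ≤ D := by omega
        _ = D ^ 1 := (pow_one D).symm
        _ ≤ D ^ 5 := Nat.pow_le_pow_right (by omega) (by omega)
    have h₂ : 2 * (n + 1) * D ^ 2 ≤ 2 * (n + 1) * D ^ 5 := by
      gcongr
      · omega
      · omega
    have h₃ : 8 * (n + 1) * D ^ 4 ≤ 8 * (n + 1) * D ^ 5 := by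
      gcongr
      · omega
      · omega
    have e₁ : 47 * (n + 1) * D ^ 5 = 47 * ((n + 1) * D ^ 5) := by ring
    have e₂ : 2 * (n + 1) * D ^ 5 = 2 * ((n + 1) * D ^ 5) := by ring
    have e₃ : 8 * (n + 1) * D ^ 5 = 8 * ((n + 1) * D ^ 5) := by ring
    have e₄ : 36 * (n + 1) * D ^ 5 = 36 * ((n + 1) * D ^ 5) := by ring
    omega
  refine Reach.mono_cost ?_ hcost
  -- The order `m` of the operator found depends on the input. Branching on it makes `m` and `k = r
  -- - m` constants on each branch.
  refine (Reach.find_last p n (r + 1) hp S V kp).bind fun S₁ V₁ hS₁ hV₁ hG => ?_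
  rcases hG with hG | ⟨m, hm, hzero, hlead⟩
  · refine .done (TelescoperFound.of_empty (hV.mono hV₁) _ _ _ _ _ fun H hH => ?_)
    obtain ⟨i, hi, h0⟩ := hne H (hS₁ hH)
    exact h0 (hG i (by omega) H hH)
  obtain ⟨k, rfl⟩ := Nat.exists_eq_add_of_le (Nat.lt_succ_iff.1 hm)
  have hc₁ := hV.mono hV₁
  refine (slp_raisedOperator hc₁ (p := fun H i => p i H) (fun H i => hp i H) hr
    (Nat.le_add_left k m) fun i => (known_C hc₁).2 fun b => hV₁ (kp i b)).reach
      fun V₂ s₂ k₂ => ?_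
  have t₂ := hV₁.trans s₂
  refine (slp_raisedCertificate (hV.mono t₂) ha ht hr (Nat.le_add_left k m) hv hwx hn hq
    (kv.mono t₂) (kwx.mono t₂) (kq.mono t₂)).reach fun V₃ s₃ k₃ => ?_
  have t₃ := t₂.trans s₃
  have hnum : SLP V₃ (8 * (n + 1) * D ^ 4)
      (coefs fun H => raisedCertificate (v H) (wx H) (m + k) (q H) k * v H) := by
    have h := slp_mul (hV.mono t₃) hv (fun H => (hv H).raisedCertificate (hwx H) (hq H) k)
      (kv.mono t₃) k₃
    have e : (fun H => raisedCertificate (v H) (wx H) (m + k) (q H) k * v H) =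
        fun H => v H * raisedCertificate (v H) (wx H) (m + k) (q H) k :=
      funext fun H => mul_comm _ _
    rw [e]
    refine h.mono subset_rfl ?_ subset_rfl
    have h₁ : a + (n + k * a) + 1 ≤ 2 * (n + 1) := by
      have : (k + 1) * a ≤ (m + k + 1) * a := Nat.mul_le_mul_right a (by omega)
      rw [add_mul, one_mul] at this
      omega
    have h₂ : t + ((m + k) * t + 2 + k * t) + 1 ≤ 2 * D ^ 2 := by
      have : (k + 1) * t ≤ (m + k + 1) * t := Nat.mul_le_mul_right t (by omega)
      nlinarith [Nat.mul_le_mul hr ht]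
    calc _ ≤ (2 * (n + 1)) * (2 * D ^ 2) * (2 * (D * D)) := by gcongr <;> omega
      _ = 8 * (n + 1) * D ^ 4 := by ring
  refine hnum.reach fun V₄ s₄ k₄ => ?_
  have t₄ := t₃.trans s₄
  refine (slp_powers (hV.mono t₄) ha ht (m := m + k + k) (k := 2) (r := m + k) (by omega) hr
    (by omega) hv (kv.mono t₄)).reach fun V₅ s₅ k₅ => ?_
  have t₅ := t₄.trans s₅
  have hden : SLP V₅ (16 * D ^ 7) (coefs fun H => c₀ H * v H ^ (m + k + k)) := by
    refine (slp_mul (hV.mono t₅) hc (fun H => (hv H).pow (m + k + k)) (kc.mono t₅)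
      fun f hf => k₅ ⟨_, le_rfl, hf⟩).mono subset_rfl ?_ subset_rfl
    have aux : ∀ b, b + 2 ≤ D → b + (m + k + k) * b + 1 ≤ 2 * D ^ 2 := by
      intro b hb
      have h1 := add_mul_succ_le (i := m + k) hb hr
      have h2 : k * b ≤ (m + k + 1) * b := Nat.mul_le_mul_right b (by omega)
      have h3 : (m + k + k) * b ≤ (m + k + 1) * b + k * b := by
        rw [← add_mul]
        exact Nat.mul_le_mul_right b (by omega)
      omega
    calc _ ≤ (2 * D ^ 2) * (2 * D ^ 2) * (2 * (D * D)) := by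
          gcongr
          · exact aux a ha
          · exact aux t ht
          · omega
          · omega
      _ = 8 * D ^ 6 := by ring
      _ ≤ 16 * D ^ 7 := by
        rw [pow_succ D 6]
        nlinarith [Nat.le_mul_of_pos_right (D ^ 6) (show 0 < D by omega)]
  refine Reach.mono_cost (hden.reach (M := 0) fun V₆ s₆ k₆ => ?_) (by omega)
  have t₆ := t₅.trans s₆
  refine .done ⟨fun w => match w with
    | .p i b => fun H => (raisedOperator (fun i => p i H) k i).coeff b
    | .num i j => coef (fun H => raisedCertificate (v H) (wx H) (m + k) (q H) k * v H) i j
    | .den i j => coef (fun H => c₀ H * v H ^ (m + k + k)) i j, fun w => ?_, fun H hH => ?_⟩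
  · cases w with
    | p i b =>
      have : (fun H => (raisedOperator (fun i => p i H) k i).coeff b) ∈ V₂ :=
        (known_C (hV.mono t₂)).1 (fun f hf => k₂ ⟨i, Nat.lt_succ_iff.1 i.2, hf⟩) b
      exact s₆ (s₅ (s₄ (s₃ this)))
    | num i j => exact s₆ (s₅ (k₄ ⟨i, j, rfl⟩))
    | den i j => exact k₆ ⟨i, j, rfl⟩
  · have hHS := hS₁ hH
    refine ⟨fun i => raisedOperator (fun i => p i H) k i,
      raisedCertificate (v H) (wx H) (m + k) (q H) k * v H, c₀ H * v H ^ (m + k + k),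
      mul_ne_zero (hc0 H hHS) (pow_ne_zero _ (hv0 H hHS)), ?_, ?_⟩
    · funext w
      cases w <;> rfl
    · intro E _ _ _ _ D z hz
      refine isCTRelation_of_identity D (hc0 H hHS) hz m k (fun i => p i H) (q H) (fun i hi => ?_)
        (hlead H hH) (hsol H hHS)
      by_cases hir : i < m + k + 1
      · exact hzero i hi hir H hH
      · exact hpr i (by omega) H

/-- The number of unknowns of the linear system. -/
def systemSize (t r ε : ℕ) : ℕ := r + 1 + (r * t + 2 - ε)

/-- Only multiples of `g` are admitted as numerators of certificates, and `hinj` says that none of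
them but zero is a certificate of the zero operator. So a nonzero kernel vector has a nonzero
telescoper part. -/
theorem Reach.telescoper [CharZero K] {κ : ℕ → ℝ} (hκ : SolvesLinearSystems K κ)
    {V : Set (Ω → K)} {S : Set Ω} {c₀ v wx wy : Ω → K[X][Y]} {g : K[X][Y]}
    {a t r ε D : ℕ} (h1a : 1 ≤ a) (h1t : 1 ≤ t) (hε : ε ≤ 1) (hrt : t + ε ≤ r + 1)
    (ha : a + 2 ≤ D) (ht : t + 2 ≤ D) (hr : r + 2 ≤ D) (hg : DegLE g 0 ε)
    (hV : HasConsts V) (hc : ∀ H, DegLE (c₀ H) a t) (hv : ∀ H, DegLE (v H) a t)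
    (hwx : ∀ H, DegLE (wx H) a t) (hwy : ∀ H, DegLE (wy H) a t)
    (hwy' : ∀ H ∈ S, (wy H).natDegree < t)
    (kc : Known V c₀) (kv : Known V v) (kwx : Known V wx) (kwy : Known V wy)
    (hc0 : ∀ H ∈ S, c₀ H ≠ 0) (hv0 : ∀ H ∈ S, v H ≠ 0)
    (hinj : ∀ H ∈ S, ∀ q, twist dY (v H) (wy H) ((r : K) - 1) (g * q) = 0 → q = 0) :
    Reach (TelescoperFound.{u, v} c₀ v wx wy r)
      (⌊(solutionDegree a t r ε : ℝ) * (systemSize t r ε : ℝ) ^ 3 *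
        κ (max (solutionDegree a t r ε) (systemSize t r ε))⌋₊ +
        100 * (D ^ 7 + (solutionDegree a t r ε + 1) * D ^ 5)) S V := by
  set n := solutionDegree a t r ε with hn
  set J := r * t + 2 - ε with hJ
  have hm : systemSize t r ε = r + 1 + J := rfl
  rw [hm]
  have hna : (r + 1) * a ≤ n := Nat.le_add_left _ _
  have hn1 : 1 ≤ n := le_trans (Nat.mul_pos (by omega) h1a) hna
  set E := (r + 1) * t + 1 with hE
  have hEm : E ≤ r + 1 + J := by
    have : (r + 1) * t = r * t + t := by ring
    omega
  have hcost : 28 * D ^ 7 + (⌊(n : ℝ) * ((r + 1 + J : ℕ) : ℝ) ^ 3 * κ (max n (r + 1 + J))⌋₊ +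
      (4 * (n + 1) * D ^ 2 + (47 * (n + 1) * D ^ 5 + 32 * D ^ 7))) ≤
      ⌊(n : ℝ) * ((r + 1 + J : ℕ) : ℝ) ^ 3 * κ (max n (r + 1 + J))⌋₊ +
        100 * (D ^ 7 + (n + 1) * D ^ 5) := by
    have h₁ : 4 * (n + 1) * D ^ 2 ≤ 4 * (n + 1) * D ^ 5 := by
      gcongr
      · omega
      · omega
    have e₁ : 47 * (n + 1) * D ^ 5 = 47 * ((n + 1) * D ^ 5) := by ring
    have e₂ : 4 * (n + 1) * D ^ 5 = 4 * ((n + 1) * D ^ 5) := by ring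
    omega
  refine Reach.mono_cost ?_ hcost
  refine (slp_telescoperMatrix hV ha ht hr hg (J := J) (by omega) E hc hv hwx hwy kc kv kwx
    kwy).reach fun V₁ s₁ k₁ => ?_
  have hV₁ := hV.mono s₁
  -- The bound `n` also exceeds the degrees of the matrix entries, which are at most `(r + 1) * a`,
  -- so one number serves for entries and solution.
  refine (Reach.solve hκ hn1 (by omega : 1 ≤ r + 1 + J) hEm
    (fun H => telescoperMatrix (c₀ H) (v H) (wx H) (wy H) g r E J) S V₁ hV₁
    (fun i j b => k₁ ⟨i, j, b, rfl⟩) (fun H hH i j => ?_) fun H hH =>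
      exists_telescoperMatrix_kernel h1t hε hrt (hc H) (hv H) (hwx H) (hwy H) hg).bind
        fun S₂ V₂ hS₂ hV₂ hG => ?_
  · refine (natDegree_telescoperMatrix (hc H) (hv H) (hwx H) (hwy H) hg i j).trans ?_
    refine le_trans ?_ hna
    refine Fin.addCases (fun l => ?_) (fun l => ?_) j
    · rw [Fin.append_left]
    · rw [Fin.append_right]
      exact Nat.le_mul_of_pos_left a (by omega)
  obtain ⟨w, kw, hwn, hw⟩ := hG
  have hc₂ := hV₁.mono hV₂
  set U : Ω → K[X][Y] := fun H => certificatePolynomial fun j => w (Fin.natAdd (r + 1) j) H with hU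
  have hUd : ∀ H, DegLE (U H) n (r * t + 1 + (1 - ε)) := by
    intro H i j hij
    rw [hU]
    dsimp only
    rw [coeff_certificatePolynomial]
    split_ifs with hj
    · rcases hij with hi | hi
      · exact coeff_eq_zero_of_natDegree_lt ((hwn _ H).trans_lt hi)
      · omega
    · exact coeff_zero i
  have kU : Known V₂ U := by
    rw [known_iff]
    intro i j
    unfold coef
    simp only [hU, coeff_certificatePolynomial]
    by_cases hj : j < J
    · simp only [hj, dite_true]
      exact kw _ i
    · simp only [hj, dite_false, coeff_zero]
      exact hc₂ 0
  have hgU : SLP V₂ (4 * (n + 1) * D ^ 2) (coefs fun H => -g * U H) := by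
    refine (slp_mul hc₂ (fun _ => hg.neg) hUd (known_const hc₂ _) kU).mono subset_rfl ?_ subset_rfl
    have h₁ : ε + (r * t + 1 + (1 - ε)) + 1 ≤ D ^ 2 := by
      have := add_mul_succ_le (i := r) ht hr
      have e : (r + 1) * t = r * t + t := by ring
      omega
    calc _ ≤ (n + 1) * D ^ 2 * (2 * ((0 + 1) * (1 + 1))) := by
          gcongr
          omega
      _ = 4 * (n + 1) * D ^ 2 := by ring
  refine hgU.reach fun V₃ s₃ k₃ => ?_
  have t₃ := s₁.trans (hV₂.trans s₃)
  set p : ℕ → Ω → K[X] := fun i H => if h : i < r + 1 then w (Fin.castAdd J ⟨i, h⟩) H else 0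
    with hp
  have hident : ∀ H ∈ S₂, ∑ i ∈ Finset.range (r + 1),
      C (p i H) * (numerators (c₀ H) (v H) (wx H) i * v H ^ (r - i)) =
        twist dY (v H) (wy H) ((r : K) - 1) (-g * U H) := by
    intro H hH
    rw [← telescoperMatrix_mulVec (hc H) (hv H) (hwx H) (hwy' H (hS₂ hH)) hg (Nat.lt_succ_self _)
      (by omega) (hw H hH).2, Finset.sum_range]
    refine Finset.sum_congr rfl fun i _ => ?_
    simp only [hp, i.2, dite_true]
  refine Reach.output_of_identity ha ht hr hna (hV.mono t₃) hc hv hwx (kc.mono t₃)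
    (kv.mono t₃) (kwx.mono t₃) (fun H hH => hc0 H (hS₂ hH)) (fun H hH => hv0 H (hS₂ hH)) p
    (fun i H => ?_) (fun i b => ?_) (fun H => -g * U H)
    (fun H => (hg.neg.mul (hUd H)).mono (by omega) (by omega)) k₃ hident (fun H hH => ?_)
    fun i hi H => ?_
  · simp only [hp]
    split_ifs
    · exact hwn _ H
    · simp
  · simp only [hp]
    split_ifs
    · exact s₃ (kw _ b)
    · simpa using s₃ (hc₂ 0)
  -- If all `p i` vanish, the identity says that `-g * U` is in the kernel of `twist`; then `U` and
  -- with it the whole vector are zero.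
  · by_contra hcon
    push Not at hcon
    have h₀ := hident H hH
    rw [Finset.sum_eq_zero fun i hi => by
      rw [hcon i (Nat.lt_succ_iff.1 (Finset.mem_range.1 hi)), C_0, zero_mul]] at h₀
    have hU0 : U H = 0 := by
      refine neg_eq_zero.1 (hinj H (hS₂ hH) (-U H) ?_)
      rw [h₀]
      congr 1
      ring
    refine (hw H hH).1 (funext fun j => ?_)
    refine Fin.addCases (fun i => ?_) (fun j => ?_) j
    · have := hcon i (Nat.lt_succ_iff.1 i.2)
      simp only [hp, i.2, dite_true] at this
      exact this
    · have := congrArg (fun f : K[X][Y] => f.coeff j) hU0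
      simp only [hU, coeff_certificatePolynomial, j.2, dite_true, coeff_zero] at this
      exact this
  · simp only [hp]
    rw [dif_neg (by omega)]

end CoreTheorem

/-! ## Computing the logarithmic derivatives of a term -/

section TermComputation

open Polynomial

namespace HypFormat

variable {L : ℕ}

/-- The degree in `x` of `b * ∏ l, c l`. -/
def sizeX (F : HypFormat L) : ℕ := F.b.1 + ∑ l, (F.c l).1

/-- The sum of the maximal degree in `y` of `a` and `b` and of the degree in `y` of `∏ l, c l`. -/
def sizeY (F : HypFormat L) : ℕ := max F.a.2 F.b.2 + ∑ l, (F.c l).2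

/-- Constant `c l` add nothing to the degrees, so `L` itself is not bounded in terms of `τ`.
Restricting to nonconstant factors keeps `L` out of the operation counts. -/
theorem card_proper_le (F : HypFormat L) :
    (HypTerm.proper F).card ≤ ∑ l, (F.c l).1 + ∑ l, (F.c l).2 := by
  rw [← Finset.sum_add_distrib, Finset.card_eq_sum_ones]
  refine (Finset.sum_le_sum fun l hl => ?_).trans
    (Finset.sum_le_sum_of_subset (Finset.subset_univ (HypTerm.proper F)))
  have := (Finset.mem_filter.1 hl).2
  omega

end HypFormat

variable {K : Type u} {Ω : Type*} [Field K] {L : ℕ} {V : Set (Ω → K)}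

theorem slp_mul_of_le (hV : HasConsts V) {p q : Ω → K[X][Y]} {a b a' b' D : ℕ}
    (hp : ∀ H, DegLE (p H) a b) (hq : ∀ H, DegLE (q H) a' b') (kp : Known V p) (kq : Known V q)
    (ha : a + a' + 1 ≤ D) (hb : b + b' + 1 ≤ D) : SLP V (2 * D ^ 4) (coefs fun H => p H * q H) := by
  refine (slp_mul hV hp hq kp kq).mono subset_rfl ?_ subset_rfl
  calc _ ≤ D * D * (2 * (D * D)) := by gcongr <;> omega
    _ = 2 * D ^ 4 := by ring

theorem mul_succ_le_sq {a b D : ℕ} (ha : a + 1 ≤ D) (hb : b + 1 ≤ D) :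
    (a + 1) * (b + 1) ≤ D ^ 2 := by
  rw [sq]
  exact Nat.mul_le_mul ha hb

theorem slp_prod (hV : HasConsts V) {α : Type*} (s : Finset α) (c : α → Ω → K[X][Y])
    (m n : α → ℕ) {D : ℕ} (hc : ∀ i ∈ s, ∀ H, DegLE (c i H) (m i) (n i))
    (kc : ∀ i ∈ s, Known V (c i)) (hm : ∑ i ∈ s, m i + 1 ≤ D) (hn : ∑ i ∈ s, n i + 1 ≤ D) :
    SLP V (s.card * (2 * D ^ 4)) (coefs fun H => ∏ i ∈ s, c i H) := by
  classical
  induction s using Finset.induction_on with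
  | empty =>
    simp only [Finset.prod_empty, Finset.card_empty, zero_mul]
    exact SLP.of_subset (known_const hV 1)
  | insert i s hi ih =>
    rw [Finset.sum_insert hi] at hm hn
    simp only [Finset.prod_insert hi]
    rw [Finset.card_insert_of_notMem hi, add_mul, one_mul]
    refine (ih (fun j hj => hc j (Finset.mem_insert_of_mem hj))
      (fun j hj => kc j (Finset.mem_insert_of_mem hj)) (by omega) (by omega)).trans
        fun W hVW kW => ?_
    exact slp_mul_of_le (hV.mono hVW) (hc i (Finset.mem_insert_self i s))
      (fun H => DegLE.prod s (fun j => c j H) m n fun j hj => hc j (Finset.mem_insert_of_mem hj) H)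
      ((kc i (Finset.mem_insert_self i s)).mono hVW) kW (by omega) (by omega)

theorem slp_sum (hV : HasConsts V) {α : Type*} (s : Finset α) (f : α → Ω → K[X][Y]) {a b : ℕ}
    (hf : ∀ i ∈ s, ∀ H, DegLE (f i H) a b) (kf : ∀ i ∈ s, Known V (f i)) :
    SLP V (s.card * ((a + 1) * (b + 1))) (coefs fun H => ∑ i ∈ s, f i H) := by
  classical
  induction s using Finset.induction_on with
  | empty =>
    simp only [Finset.sum_empty, Finset.card_empty, zero_mul]
    exact SLP.of_subset (known_const hV 0)
  | insert i s hi ih =>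
    simp only [Finset.sum_insert hi]
    rw [Finset.card_insert_of_notMem hi, add_mul, one_mul]
    refine (ih (fun j hj => hf j (Finset.mem_insert_of_mem hj))
      (fun j hj => kf j (Finset.mem_insert_of_mem hj))).trans fun W hVW kW => ?_
    exact slp_add (hV.mono hVW) (hf i (Finset.mem_insert_self i s))
      (fun H => DegLE.sum s (fun j => f j H) fun j hj => hf j (Finset.mem_insert_of_mem hj) H)
      ((kf i (Finset.mem_insert_self i s)).mono hVW) kW

/-- Everything that makes up the terms is available. -/
structure KnownTerm (V : Set (Ω → K)) (H : Ω → HypTerm K L) : Prop where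
  consts : HasConsts V
  a : Known V fun ω => (H ω).a
  b : Known V fun ω => (H ω).b
  c₀ : Known V fun ω => (H ω).c₀
  c : ∀ l, Known V fun ω => (H ω).c l
  e : ∀ l, (fun ω => (H ω).e l) ∈ V

theorem KnownTerm.mono {V' : Set (Ω → K)} {H : Ω → HypTerm K L} (h : KnownTerm V H) (hV : V ⊆ V') :
    KnownTerm V' H :=
  ⟨h.consts.mono hV, h.a.mono hV, h.b.mono hV, h.c₀.mono hV, fun l => (h.c l).mono hV,
    fun l => hV (h.e l)⟩

theorem knownTerm_initialFunctions (H : Ω → HypTerm K L) :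
    KnownTerm (initialFunctions fun ω => (H ω).value) H :=
  ⟨hasConsts_initialFunctions _, known_iff.2 fun i j => Or.inr ⟨.a i j, rfl⟩,
    known_iff.2 fun i j => Or.inr ⟨.b i j, rfl⟩, known_iff.2 fun i j => Or.inr ⟨.c₀ i j, rfl⟩,
    fun l => known_iff.2 fun i j => Or.inr ⟨.c l i j, rfl⟩, fun l => Or.inr ⟨.e l, rfl⟩⟩

/-- The degrees in a format bound those of the polynomials. -/
structure HasFormat (H : Ω → HypTerm K L) (F : HypFormat L) : Prop where
  eq : ∀ ω, (H ω).format = F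

namespace HasFormat

variable {H : Ω → HypTerm K L} {F : HypFormat L} (hF : HasFormat H F)

include hF

theorem a (ω : Ω) : DegLE (H ω).a F.a.1 F.a.2 := by
  rw [← hF.eq ω]; exact degLE_degX_degY _

theorem b (ω : Ω) : DegLE (H ω).b F.b.1 F.b.2 := by
  rw [← hF.eq ω]; exact degLE_degX_degY _

theorem c₀ (ω : Ω) : DegLE (H ω).c₀ F.c₀.1 F.c₀.2 := by
  rw [← hF.eq ω]; exact degLE_degX_degY _

theorem c (ω : Ω) (l : Fin L) : DegLE ((H ω).c l) (F.c l).1 (F.c l).2 := by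
  rw [← hF.eq ω]; exact degLE_degX_degY _

end HasFormat

end TermComputation

/-! ### Degrees and cost of the logarithmic derivatives -/

section LogarithmicDerivatives

open Polynomial

variable {K : Type u} {Ω : Type*} [Field K] {L : ℕ} {V : Set (Ω → K)}

/-- Strict bounds are stated for `degree`, for which the zero polynomial is no exception even if `n
= 0`; they are translated to `natDegree` only at the end, where the bound is positive. -/
theorem degree_dY_lt {p : K[X][Y]} {n : ℕ} (hp : p.natDegree ≤ n) : (dY p).degree < n := by
  rw [dY_apply]
  by_cases h : p = 0
  · simp [h]
  · exact (degree_derivative_lt h).trans_le (degree_le_of_natDegree_le hp)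

theorem degree_mul_lt {p q : K[X][Y]} {m n : ℕ} (hp : p.degree < m) (hq : q.natDegree ≤ n) :
    (p * q).degree < ((m + n : ℕ) : WithBot ℕ) := by
  by_cases hp0 : p = 0
  · simp [hp0]
  by_cases hq0 : q = 0
  · simp [hq0]
  rw [← natDegree_lt_iff_degree_lt (mul_ne_zero hp0 hq0), natDegree_mul hp0 hq0]
  have := (natDegree_lt_iff_degree_lt hp0).2 hp
  omega

theorem natDegree_lt_of_degree_lt {p : K[X][Y]} {n : ℕ} (hn : 1 ≤ n) (hp : p.degree < n) :
    p.natDegree < n := by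
  by_cases hp0 : p = 0
  · rw [hp0, natDegree_zero]
    exact hn
  · exact (natDegree_lt_iff_degree_lt hp0).2 hp

theorem degree_lt_mono {p : K[X][Y]} {m n : ℕ} (hp : p.degree < m) (h : m ≤ n) : p.degree < n :=
  hp.trans_le (WithBot.coe_le_coe.2 h)

namespace HasFormat

variable {H : Ω → HypTerm K L} {F : HypFormat L}

theorem degLE_prod (hF : HasFormat H F) (s : Finset (Fin L)) (ω : Ω) :
    DegLE (∏ l ∈ s, (H ω).c l) (∑ l ∈ s, (F.c l).1) (∑ l ∈ s, (F.c l).2) :=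
  DegLE.prod s _ _ _ fun l _ => hF.c ω l

theorem degLE_proper (hF : HasFormat H F) (ω : Ω) :
    DegLE (∏ l ∈ HypTerm.proper F, (H ω).c l) (∑ l, (F.c l).1) (∑ l, (F.c l).2) :=
  (hF.degLE_prod _ ω).mono (Finset.sum_le_sum_of_subset (Finset.subset_univ _))
    (Finset.sum_le_sum_of_subset (Finset.subset_univ _))

theorem powersNumerator_eq (hF : HasFormat H F) (d : Derivation K K[X][Y] K[X][Y]) (ω : Ω) :
    (H ω).powersNumerator d = ∑ l ∈ HypTerm.proper F,
      (H ω).e l • (d ((H ω).c l) * ∏ k ∈ (HypTerm.proper F).erase l, (H ω).c k) := by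
  rw [HypTerm.powersNumerator, hF.eq]

theorem degLE_powersNumerator_term (hF : HasFormat H F) {d : Derivation K K[X][Y] K[X][Y]}
    (hd : d = dX ∨ d = dY) (ω : Ω) {l : Fin L} (hl : l ∈ HypTerm.proper F) :
    DegLE (d ((H ω).c l) * ∏ k ∈ (HypTerm.proper F).erase l, (H ω).c k)
      (∑ l, (F.c l).1) (∑ l, (F.c l).2) := by
  refine (((hF.c ω l).derivation hd).mul (hF.degLE_prod _ ω)).mono ?_ ?_
  · rw [Finset.add_sum_erase _ (fun l => (F.c l).1) hl]
    exact Finset.sum_le_sum_of_subset (Finset.subset_univ _)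
  · rw [Finset.add_sum_erase _ (fun l => (F.c l).2) hl]
    exact Finset.sum_le_sum_of_subset (Finset.subset_univ _)

theorem degLE_powersNumerator (hF : HasFormat H F) {d : Derivation K K[X][Y] K[X][Y]}
    (hd : d = dX ∨ d = dY) (ω : Ω) :
    DegLE ((H ω).powersNumerator d) (∑ l, (F.c l).1) (∑ l, (F.c l).2) := by
  rw [hF.powersNumerator_eq]
  exact DegLE.sum _ _ fun l hl => (hF.degLE_powersNumerator_term hd ω hl).smul _

theorem degree_powersNumerator (hF : HasFormat H F) (ω : Ω) :
    ((H ω).powersNumerator dY).degree < ((∑ l, (F.c l).2 : ℕ) : WithBot ℕ) := by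
  rw [hF.powersNumerator_eq, ← mem_degreeLT]
  refine sum_mem fun l hl => ?_
  rw [← algebraMap_smul K[X]]
  refine Submodule.smul_mem _ _ (mem_degreeLT.2 (degree_lt_mono
    (degree_mul_lt (degree_dY_lt (hF.c ω l).natDegree) (hF.degLE_prod _ ω).natDegree) ?_))
  rw [Finset.add_sum_erase _ (fun l => (F.c l).2) hl]
  exact Finset.sum_le_sum_of_subset (Finset.subset_univ _)

variable {z sx sy : Ω → K[X][Y]} {t G D : ℕ}

theorem degLE_denominator (hF : HasFormat H F) (hx : F.sizeX ≤ t) (hy : F.sizeY ≤ t)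
    (hz : ∀ ω, DegLE (z ω) (t - F.sizeX) (t - F.sizeY)) (ω : Ω) :
    DegLE ((H ω).denominator (z ω)) t t := by
  rw [HypTerm.denominator, hF.eq]
  refine (((hF.b ω).mul (hz ω)).mul (hF.degLE_proper ω)).mono ?_ ?_
  · rw [HypFormat.sizeX] at *
    omega
  · rw [HypFormat.sizeY] at *
    omega

theorem degLE_numerator (hF : HasFormat H F) (hx : F.sizeX ≤ t) (hy : F.sizeY ≤ t)
    (hG : F.a.1 ≤ F.b.1 + G) (hz : ∀ ω, DegLE (z ω) (t - F.sizeX) (t - F.sizeY))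
    (hs : ∀ ω, DegLE (sx ω) (t - F.sizeX) (t - F.sizeY))
    {d : Derivation K K[X][Y] K[X][Y]} (hd : d = dX ∨ d = dY) (ω : Ω) :
    DegLE ((H ω).numerator d (z ω) (sx ω)) (t + G) t := by
  rw [HypTerm.numerator, hF.eq]
  rw [HypFormat.sizeX] at *
  rw [HypFormat.sizeY] at *
  refine .add ((((((hF.a ω).derivation hd).mul (hz ω)).sub ((hF.a ω).mul (hs ω))).mul
    (hF.degLE_proper ω)).mono ?_ ?_)
    ((((hF.b ω).mul (hz ω)).mul (hF.degLE_powersNumerator hd ω)).mono ?_ ?_) <;> omega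

/-- Every summand contains a derivative in `y`, of `a`, of some `c l`, or of `b` through `sy`, and
therefore stays strictly below the degree bound for the denominator. -/
theorem natDegree_numerator (hF : HasFormat H F) (hy : F.sizeY ≤ t) (ht : 1 ≤ t)
    (hz : ∀ ω, (z ω).natDegree ≤ t - F.sizeY)
    (hs : ∀ ω, (sy ω).degree < ((t - F.sizeY : ℕ) : WithBot ℕ)) (ω : Ω) :
    ((H ω).numerator dY (z ω) (sy ω)).natDegree < t := by
  refine natDegree_lt_of_degree_lt ht ?_
  rw [HypTerm.numerator, hF.eq]
  rw [HypFormat.sizeY] at *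
  have h₁ := degree_mul_lt (degree_dY_lt (hF.a ω).natDegree) (hz ω)
  have h₂ := degree_mul_lt (hs ω) (hF.a ω).natDegree
  rw [mul_comm] at h₂
  have h₃ := degree_mul_lt (hF.degree_powersNumerator ω)
    (natDegree_mul_le_of_le (hF.b ω).natDegree (hz ω))
  rw [mul_comm] at h₃
  refine (degree_add_le _ _).trans_lt (max_lt ?_ (degree_lt_mono h₃ (by omega)))
  rw [add_comm] at h₂
  refine degree_lt_mono (degree_mul_lt ((degree_sub_le _ _).trans_lt (max_lt h₁ h₂))
    (hF.degLE_proper ω).natDegree) (by omega)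

/-! ### The cost -/

theorem slp_proper (hF : HasFormat H F) (hk : KnownTerm V H) (hx : F.sizeX ≤ t)
    (hy : F.sizeY ≤ t) (ht : t + 2 ≤ D) (s : Finset (Fin L)) (hs : s ⊆ HypTerm.proper F) :
    SLP V (4 * D ^ 5) (coefs fun ω => ∏ l ∈ s, (H ω).c l) := by
  have h₁ : ∑ l ∈ s, (F.c l).1 ≤ ∑ l, (F.c l).1 :=
    Finset.sum_le_sum_of_subset (Finset.subset_univ _)
  have h₂ : ∑ l ∈ s, (F.c l).2 ≤ ∑ l, (F.c l).2 :=
    Finset.sum_le_sum_of_subset (Finset.subset_univ _)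
  have h₃ := (Finset.card_le_card hs).trans F.card_proper_le
  rw [HypFormat.sizeX] at hx
  rw [HypFormat.sizeY] at hy
  refine (slp_prod hk.consts s (fun l ω => (H ω).c l) _ _ (fun l _ ω => hF.c ω l)
    (fun l _ => hk.c l) (D := D) (by omega) (by omega)).mono subset_rfl ?_ subset_rfl
  calc _ ≤ (2 * D) * (2 * D ^ 4) := by gcongr; omega
    _ = 4 * D ^ 5 := by ring

theorem slp_powersNumerator (hF : HasFormat H F) (hk : KnownTerm V H) (hx : F.sizeX ≤ t)
    (hy : F.sizeY ≤ t) (ht : t + 2 ≤ D) {d : Derivation K K[X][Y] K[X][Y]}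
    (hd : d = dX ∨ d = dY) :
    SLP V (16 * D ^ 6) (coefs fun ω => (H ω).powersNumerator d) := by
  have h₃ := F.card_proper_le
  have hx' := hx
  have hy' := hy
  rw [HypFormat.sizeX] at hx'
  rw [HypFormat.sizeY] at hy'
  have hsq : ∀ {a b}, a ≤ t → b ≤ t → (a + 1) * (b + 1) ≤ D ^ 2 := fun ha hb =>
    mul_succ_le_sq (by omega) (by omega)
  have hsum : ∑ l, (F.c l).1 ≤ t ∧ ∑ l, (F.c l).2 ≤ t := by omega
  have hone : ∀ l ∈ HypTerm.proper F, SLP V (4 * D ^ 5 + (D ^ 2 + (2 * D ^ 4 + D ^ 2)))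
      (coefs fun ω => (H ω).e l • (d ((H ω).c l) *
        ∏ k ∈ (HypTerm.proper F).erase l, (H ω).c k)) := by
    intro l hl
    have e₁ := Finset.add_sum_erase _ (fun l => (F.c l).1) hl
    have e₂ := Finset.add_sum_erase _ (fun l => (F.c l).2) hl
    have i₁ : ∑ l ∈ HypTerm.proper F, (F.c l).1 ≤ ∑ l, (F.c l).1 :=
      Finset.sum_le_sum_of_subset (Finset.subset_univ _)
    have i₂ : ∑ l ∈ HypTerm.proper F, (F.c l).2 ≤ ∑ l, (F.c l).2 :=
      Finset.sum_le_sum_of_subset (Finset.subset_univ _)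
    refine (hF.slp_proper hk hx hy ht _ (Finset.erase_subset l _)).trans fun W hW kW => ?_
    have hkW := hk.mono hW
    refine ((slp_derivation hd hkW.consts (fun ω => hF.c ω l) (hkW.c l)).mono subset_rfl
      (hsq (by omega) (by omega)) subset_rfl).trans fun W' hW' kW' => ?_
    have hkW' := hkW.mono hW'
    refine (slp_mul_of_le hkW'.consts (fun ω => (hF.c ω l).derivation hd)
      (fun ω => hF.degLE_prod _ ω) kW' (kW.trans hW') (by omega) (by omega)).trans
        fun W'' hW'' kW'' => ?_
    exact (slp_smul (hkW'.mono hW'').consts ((hkW'.mono hW'').e l)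
      (fun ω => hF.degLE_powersNumerator_term hd ω hl) kW'').mono subset_rfl
        (hsq hsum.1 hsum.2) subset_rfl
  have hall := SLP.biUnion (HypTerm.proper F) _ hone
  simp only [hF.powersNumerator_eq]
  refine (hall.trans fun W hW kW => slp_sum (hk.mono hW).consts _
    (fun l ω => (H ω).e l • (d ((H ω).c l) * ∏ k ∈ (HypTerm.proper F).erase l, (H ω).c k))
    (fun l hl ω => (hF.degLE_powersNumerator_term hd ω hl).smul _)
    fun l hl => (Set.subset_biUnion_of_mem (u := fun l => coefs fun ω => (H ω).e l •
      (d ((H ω).c l) * ∏ k ∈ (HypTerm.proper F).erase l, (H ω).c k)) hl).trans kW).mono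
      subset_rfl ?_ subset_rfl
  have hD : 2 ≤ D := by omega
  have hc : (HypTerm.proper F).card ≤ 2 * D := by omega
  have p₁ : D ^ 2 ≤ D ^ 5 := Nat.pow_le_pow_right (by omega) (by omega)
  have p₂ : 2 * D ^ 4 ≤ D ^ 5 := by
    rw [pow_succ D 4]; nlinarith [Nat.mul_le_mul_left (D ^ 4) hD]
  calc _ ≤ 2 * D * (4 * D ^ 5 + (D ^ 5 + (D ^ 5 + D ^ 5))) + 2 * D * D ^ 5 := by
        gcongr
        exact (hsq hsum.1 hsum.2).trans p₁
    _ = 16 * D ^ 6 := by ring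

theorem slp_denominator (hF : HasFormat H F) (hk : KnownTerm V H) (hx : F.sizeX ≤ t)
    (hy : F.sizeY ≤ t) (ht : t + 2 ≤ D)
    (hz : ∀ ω, DegLE (z ω) (t - F.sizeX) (t - F.sizeY)) (kz : Known V z) :
    SLP V (6 * D ^ 5) (coefs fun ω => (H ω).denominator (z ω)) := by
  have hx' := hx
  have hy' := hy
  rw [HypFormat.sizeX] at hx'
  rw [HypFormat.sizeY] at hy'
  have hsz : ∀ ω, DegLE (z ω) (t - (F.b.1 + ∑ l, (F.c l).1))
    (t - (max F.a.2 F.b.2 + ∑ l, (F.c l).2)) := hz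
  simp only [HypTerm.denominator, hF.eq]
  refine ((hF.slp_proper hk hx hy ht _ subset_rfl).trans (M := 2 * D ^ 4 + 2 * D ^ 4)
    fun W hW kW => ?_).mono subset_rfl ?_ subset_rfl
  · refine (slp_mul_of_le (D := D) (hk.mono hW).consts (fun ω => hF.b ω) hsz (hk.mono hW).b
      (kz.mono hW) (by omega) (by omega)).trans fun W' hW' kW' => ?_
    exact slp_mul_of_le ((hk.mono hW).mono hW').consts (fun ω => (hF.b ω).mul (hsz ω))
      (fun ω => hF.degLE_proper ω) kW' (kW.trans hW') (by omega) (by omega)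
  · have : 2 * D ^ 4 ≤ D ^ 5 := by
      rw [pow_succ D 4]; nlinarith [Nat.mul_le_mul_left (D ^ 4) (show 2 ≤ D by omega)]
    omega

theorem slp_numerator (hF : HasFormat H F) (hk : KnownTerm V H) (hx : F.sizeX ≤ t)
    (hy : F.sizeY ≤ t) (ht : t + 2 ≤ D) (ha : t + G + 2 ≤ D) (hG : F.a.1 ≤ F.b.1 + G)
    (hz : ∀ ω, DegLE (z ω) (t - F.sizeX) (t - F.sizeY)) (kz : Known V z)
    (hs : ∀ ω, DegLE (sx ω) (t - F.sizeX) (t - F.sizeY)) (ks : Known V sx)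
    {d : Derivation K K[X][Y] K[X][Y]} (hd : d = dX ∨ d = dY) :
    SLP V (26 * D ^ 6) (coefs fun ω => (H ω).numerator d (z ω) (sx ω)) := by
  have hx' := hx
  have hy' := hy
  rw [HypFormat.sizeX] at hx'
  rw [HypFormat.sizeY] at hy'
  have hz' : ∀ ω, DegLE (z ω) (t - (F.b.1 + ∑ l, (F.c l).1))
    (t - (max F.a.2 F.b.2 + ∑ l, (F.c l).2)) := hz
  have hs' : ∀ ω, DegLE (sx ω) (t - (F.b.1 + ∑ l, (F.c l).1))
    (t - (max F.a.2 F.b.2 + ∑ l, (F.c l).2)) := hs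
  simp only [HypTerm.numerator, hF.eq]
  refine ((hF.slp_proper hk hx hy ht _ subset_rfl).trans (M := 16 * D ^ 6 + (D ^ 2 + (2 * D ^ 4 +
    (2 * D ^ 4 + (D ^ 2 + (2 * D ^ 4 + (2 * D ^ 4 + (2 * D ^ 4 + D ^ 2)))))))) fun W₁ hW₁ kP => ?_).mono
      subset_rfl ?_ subset_rfl
  · have hk₁ := hk.mono hW₁
    refine (hF.slp_powersNumerator hk₁ hx hy ht hd).trans fun W₂ hW₂ kN => ?_
    have hk₂ := hk₁.mono hW₂
    refine ((slp_derivation hd hk₂.consts (fun ω => hF.a ω) hk₂.a).mono subset_rfl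
      (mul_succ_le_sq (D := D) (by omega) (by omega)) subset_rfl).trans fun W₃ hW₃ kd => ?_
    have hk₃ := hk₂.mono hW₃
    have s₃ := (hW₁.trans hW₂).trans hW₃
    refine (slp_mul_of_le (D := D) hk₃.consts (fun ω => (hF.a ω).derivation hd) hz' kd
      (kz.mono s₃) (by omega) (by omega)).trans fun W₄ hW₄ k₄ => ?_
    have hk₄ := hk₃.mono hW₄
    refine (slp_mul_of_le (D := D) hk₄.consts (fun ω => hF.a ω) hs' hk₄.a
      (ks.mono (s₃.trans hW₄)) (by omega) (by omega)).trans fun W₅ hW₅ k₅ => ?_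
    have hk₅ := hk₄.mono hW₅
    refine ((slp_sub hk₅.consts (fun ω => ((hF.a ω).derivation hd).mul (hz' ω))
      (fun ω => (hF.a ω).mul (hs' ω)) (k₄.trans hW₅) k₅).mono subset_rfl
      (mul_succ_le_sq (D := D) (by omega) (by omega)) subset_rfl).trans fun W₆ hW₆ k₆ => ?_
    have hk₆ := hk₅.mono hW₆
    have s₆ := ((hW₃.trans hW₄).trans hW₅).trans hW₆
    refine (slp_mul_of_le (D := D) hk₆.consts (fun ω => (((hF.a ω).derivation hd).mul (hz' ω)).sub
      ((hF.a ω).mul (hs' ω))) (fun ω => hF.degLE_proper ω) k₆ (kP.trans (hW₂.trans s₆)) (by omega)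
      (by omega)).trans fun W₇ hW₇ k₇ => ?_
    have hk₇ := hk₆.mono hW₇
    refine (slp_mul_of_le (D := D) hk₇.consts (fun ω => hF.b ω) hz' hk₇.b
      (kz.mono (((hW₁.trans hW₂).trans s₆).trans hW₇)) (by omega) (by omega)).trans
        fun W₈ hW₈ k₈ => ?_
    have hk₈ := hk₇.mono hW₈
    refine (slp_mul_of_le (D := D) hk₈.consts (fun ω => (hF.b ω).mul (hz' ω))
      (fun ω => hF.degLE_powersNumerator hd ω) k₈ (kN.trans ((s₆.trans hW₇).trans hW₈)) (by omega)
      (by omega)).trans fun W₉ hW₉ k₉ => ?_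
    exact (slp_add (a := t + G) (b := t) (hk₈.mono hW₉).consts
      (fun ω => ((((((hF.a ω).derivation hd).mul (hz' ω)).sub ((hF.a ω).mul (hs' ω))).mul
        (hF.degLE_proper ω)).mono (by omega) (by omega)))
      (fun ω => ((((hF.b ω).mul (hz' ω)).mul (hF.degLE_powersNumerator hd ω)).mono
        (by omega) (by omega))) ((k₇.trans hW₈).trans hW₉) k₉).mono subset_rfl
      (mul_succ_le_sq (by omega) (by omega)) subset_rfl
  · have hD : 1 ≤ D := by omega
    have p₂ : D ^ 2 ≤ D ^ 5 := Nat.pow_le_pow_right hD (by omega)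
    have p₄ : 2 * D ^ 4 ≤ D ^ 5 := by
      rw [pow_succ D 4]; nlinarith [Nat.mul_le_mul_left (D ^ 4) (show 2 ≤ D by omega)]
    have p₅ : 2 * D ^ 5 ≤ D ^ 6 := by
      rw [pow_succ D 5]; nlinarith [Nat.mul_le_mul_left (D ^ 5) (show 2 ≤ D by omega)]
    omega

end HasFormat

end LogarithmicDerivatives

/-! ### Finding a small denominator for the logarithmic derivatives of `b` -/

section LinearRelations

open Polynomial

variable {K : Type u} {Ω : Type*} [Field K] {V : Set (Ω → K)}

/-- Computing a linear relation between polynomials, or rather between tuples of polynomials. -/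
theorem Reach.exists_relation {σ β : Type*} [Fintype σ] [Fintype β] (E : σ → β → Ω → K[X][Y])
    {a b : ℕ} (hE : ∀ s i H, DegLE (E s i H) a b) (S : Set Ω) (hV : HasConsts V)
    (kE : ∀ s i, Known V (E s i)) :
    Reach (fun S' V' =>
      (∀ H ∈ S', ∀ u : σ → K, (∀ i, ∑ s, u s • E s i H = 0) → u = 0) ∨
        ∃ u : σ → Ω → K, (∀ s, u s ∈ V') ∧
          ∀ H ∈ S', (fun s => u s H) ≠ 0 ∧ ∀ i, ∑ s, u s H • E s i H = 0)
      (Fintype.card σ * (4 * (Fintype.card β * ((a + 1) * (b + 1)) + 1) * (Fintype.card σ + 1)))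
      S V := by
  classical
  set e := Fintype.equivFin σ
  let A : Ω → Matrix (β × (Fin (a + 1) × Fin (b + 1))) (Fin (Fintype.card σ)) K :=
    fun H => Matrix.of fun x j => coef (E (e.symm j) x.1) x.2.1 x.2.2 H
  have hA : ∀ H (u : Fin (Fintype.card σ) → K), (A H).mulVec u = 0 ↔
      ∀ i, ∑ s, u (e s) • E s i H = 0 := by
    intro H u
    have hentry : ∀ i (k l : ℕ), ((∑ s, u (e s) • E s i H).coeff l).coeff k =
        ∑ j, coef (E (e.symm j) i) k l H * u j := by
      intro i k l
      rw [finsetSum_coeff, finsetSum_coeff, ← e.symm.sum_comp]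
      refine Finset.sum_congr rfl fun j _ => ?_
      rw [coeff_smul, coeff_smul, smul_eq_mul, Equiv.apply_symm_apply, mul_comm, coef]
    constructor
    · intro h i
      ext l k
      by_cases hkl : k ≤ a ∧ l ≤ b
      · have := congrFun h (i, (⟨k, by omega⟩, ⟨l, by omega⟩))
        rw [hentry, coeff_zero, coeff_zero]
        exact this
      · exact DegLE.sum (a := a) (b := b) _ _ (fun s _ => (hE s i H).smul _) k l (by omega) |>.trans
          (by simp)
    · intro h
      funext x
      have := hentry x.1 x.2.1 x.2.2
      rw [h x.1, coeff_zero, coeff_zero] at this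
      exact this.symm
  have := Reach.exists_kernel (Fintype.card σ) A S V hV fun x j => (kE _ _).coef_mem _ _
  rw [Fintype.card_prod, Fintype.card_prod, Fintype.card_fin, Fintype.card_fin] at this
  refine this.imp fun S' V' _ _ h => ?_
  rcases h with h | ⟨u, hu, h⟩
  · refine Or.inl fun H hH u hu => ?_
    have h0 := h H hH (fun j => u (e.symm j)) ((hA H _).2 fun i => by simpa using hu i)
    funext s
    simpa using congrFun h0 (e s)
  · refine Or.inr ⟨fun s => u (e s), fun s => hu _, fun H hH => ⟨fun h0 => (h H hH).1 ?_,
      (hA H fun j => u j H).1 (h H hH).2⟩⟩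
    funext j
    simpa using congrFun h0 (e.symm j)

/-- The polynomial with given coefficients. -/
def ofCoeffs {A B : ℕ} (u : Fin A × Fin B → K) : K[X][Y] :=
  ∑ s, u s • (C ((X : K[X]) ^ (s.1 : ℕ)) * (X : K[X][Y]) ^ (s.2 : ℕ))

theorem coeff_coeff_monomial (k l i j : ℕ) :
    ((C ((X : K[X]) ^ k) * (X : K[X][Y]) ^ l).coeff j).coeff i = if i = k ∧ j = l then 1 else 0 := by
  rw [coeff_C_mul, coeff_X_pow]
  by_cases hj : j = l
  · simp [hj, coeff_X_pow]
  · simp [hj]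

theorem coeff_coeff_ofCoeffs {A B : ℕ} (u : Fin A × Fin B → K) (i j : ℕ) :
    ((ofCoeffs u).coeff j).coeff i =
      if h : i < A ∧ j < B then u (⟨i, h.1⟩, ⟨j, h.2⟩) else 0 := by
  simp only [ofCoeffs, finsetSum_coeff, coeff_smul, coeff_coeff_monomial, smul_eq_mul, mul_ite,
    mul_one, mul_zero]
  split_ifs with h
  · rw [Finset.sum_eq_single (⟨i, h.1⟩, ⟨j, h.2⟩)]
    · simp
    · rintro ⟨k, l⟩ _ hne
      rw [if_neg]
      rintro ⟨rfl, rfl⟩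
      exact hne rfl
    · simp
  · refine Finset.sum_eq_zero fun s _ => if_neg ?_
    rintro ⟨rfl, rfl⟩
    exact h ⟨s.1.2, s.2.2⟩

theorem ofCoeffs_coeff {A B : ℕ} {p : K[X][Y]}
    (hp : ∀ i j, A ≤ i ∨ B ≤ j → (p.coeff j).coeff i = 0) :
    ofCoeffs (fun s : Fin A × Fin B => (p.coeff s.2).coeff s.1) = p := by
  ext j i
  rw [coeff_coeff_ofCoeffs]
  split_ifs with h
  · rfl
  · exact (hp i j (by omega)).symm

theorem ofCoeffs_eq_zero {A B : ℕ} {u : Fin A × Fin B → K} (h : ofCoeffs u = 0) : u = 0 := by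
  funext ⟨i, j⟩
  have := coeff_coeff_ofCoeffs u i j
  simpa [h] using this.symm

theorem DegLE.ofCoeffs {A B a b : ℕ} (u : Fin A × Fin B → K) (ha : A ≤ a + 1) (hb : B ≤ b + 1) :
    DegLE (ofCoeffs u) a b := fun i j h => by
  rw [coeff_coeff_ofCoeffs, dif_neg (by omega)]

theorem degree_ofCoeffs_lt {A B : ℕ} (u : Fin A × Fin B → K) : (ofCoeffs u).degree < B := by
  rw [degree_lt_iff_coeff_zero]
  intro j hj
  ext i
  rw [coeff_coeff_ofCoeffs, dif_neg (by omega), coeff_zero]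

theorem known_ofCoeffs {A B : ℕ} (hV : HasConsts V) {u : Fin A × Fin B → Ω → K}
    (hu : ∀ s, u s ∈ V) : Known V fun H => ofCoeffs fun s => u s H := by
  refine known_iff.2 fun i j => ?_
  by_cases h : i < A ∧ j < B
  · have : coef (fun H => ofCoeffs fun s => u s H) i j = u (⟨i, h.1⟩, ⟨j, h.2⟩) := by
      funext H
      rw [coef, coeff_coeff_ofCoeffs, dif_pos h]
    rw [this]
    exact hu _
  · have : coef (fun H => ofCoeffs fun s => u s H) i j = fun _ => 0 := by
      funext H
      rw [coef, coeff_coeff_ofCoeffs, dif_neg h]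
    rw [this]
    exact hV 0

theorem known_monomial_mul (hV : HasConsts V) {p : Ω → K[X][Y]} (kp : Known V p) (k l : ℕ) :
    Known V fun H => C ((X : K[X]) ^ k) * (X : K[X][Y]) ^ l * p H := by
  refine known_iff.2 fun i j => ?_
  by_cases h : k ≤ i ∧ l ≤ j
  · have : coef (fun H => C ((X : K[X]) ^ k) * (X : K[X][Y]) ^ l * p H) i j =
        coef p (i - k) (j - l) := by
      funext H
      rw [coef, coef, mul_assoc, coeff_C_mul, coeff_X_pow_mul', if_pos h.1, coeff_X_pow_mul',
        if_pos h.2]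
    rw [this]
    exact kp.coef_mem _ _
  · have : coef (fun H => C ((X : K[X]) ^ k) * (X : K[X][Y]) ^ l * p H) i j = fun _ => 0 := by
      funext H
      rw [coef, mul_assoc, coeff_C_mul, coeff_X_pow_mul', coeff_X_pow_mul']
      split_ifs <;> simp_all
    rw [this]
    exact hV 0

theorem ofCoeffs_mul {A B : ℕ} (u : Fin A × Fin B → K) (p : K[X][Y]) :
    ∑ s, u s • (C ((X : K[X]) ^ (s.1 : ℕ)) * (X : K[X][Y]) ^ (s.2 : ℕ) * p) = ofCoeffs u * p := by
  rw [ofCoeffs, Finset.sum_mul]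
  exact Finset.sum_congr rfl fun s _ => (smul_mul_assoc _ _ _).symm

/-- Polynomials that make `s / z` the logarithmic derivatives of `b`. -/
structure LogDerivatives (b z sx sy : K[X][Y]) : Prop where
  ne_zero : z ≠ 0
  x : b * sx = z * dX b
  y : b * sy = z * dY b

/-- Computing the logarithmic derivatives of a polynomial with a denominator of bounded degrees. -/
theorem Reach.logDerivatives {b : Ω → K[X][Y]} {m n p q t D : ℕ} (S : Set Ω)
    (hV : HasConsts V) (hb : ∀ H, DegLE (b H) m n) (kb : Known V b) (hb0 : ∀ H ∈ S, b H ≠ 0)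
    (hm : m + p ≤ t) (hn : n + q ≤ t) (ht : t + 2 ≤ D) :
    Reach (fun S' V' =>
      (∀ H ∈ S', p < degX (sqfreePart (b H)) ∨ q < degY (sqfreePart (b H))) ∨
        ∃ z sx sy : Ω → K[X][Y], (Known V' z ∧ Known V' sx ∧ Known V' sy) ∧
          (∀ H, DegLE (z H) p q ∧ DegLE (sx H) p q ∧ DegLE (sy H) p q ∧ (sy H).degree < q) ∧
          ∀ H ∈ S', LogDerivatives (b H) (z H) (sx H) (sy H))
      (75 * D ^ 6) S V := by
  have hsq : ∀ {i j}, i ≤ t → j ≤ t → (i + 1) * (j + 1) ≤ D ^ 2 := fun hi hj =>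
    mul_succ_le_sq (by omega) (by omega)
  let M : ℕ → ℕ → K[X][Y] → K[X][Y] := fun k l f => C ((X : K[X]) ^ k) * (X : K[X][Y]) ^ l * f
  -- The unknowns are the coefficients of `z`, `sx`, `sy`; the two components encode `z * ∂b = b *
  -- s` for the derivatives in `x` and in `y`. The range `Fin q` in the last block enforces that
  -- `sy` has degree less than `q` in `y`.
  let E : (Fin (p + 1) × Fin (q + 1)) ⊕ ((Fin (p + 1) × Fin (q + 1)) ⊕ (Fin (p + 1) × Fin q)) →
      Bool → Ω → K[X][Y] := fun s i H => match s, i with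
    | .inl s, true => M s.1 s.2 (dX (b H))
    | .inl s, false => M s.1 s.2 (dY (b H))
    | .inr (.inl s), true => M s.1 s.2 ((-1 : K) • b H)
    | .inr (.inl _), false => 0
    | .inr (.inr _), true => 0
    | .inr (.inr s), false => M s.1 s.2 ((-1 : K) • b H)
  have hM : ∀ {k l : ℕ} {f : K[X][Y]}, k ≤ p → l ≤ q → DegLE f m n → DegLE (M k l f) t t :=
    fun hk hl hf => (((DegLE.C (b := 0) (natDegree_X_pow_le _)).mul (DegLE.X_pow _)).mul hf).mono
      (by omega) (by omega)
  have hE : ∀ s i H, DegLE (E s i H) t t := by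
    intro s i H
    rcases s with s | s | s <;> cases i
    · exact hM (by omega) (by omega) ((hb H).derivation (Or.inr rfl))
    · exact hM (by omega) (by omega) ((hb H).derivation (Or.inl rfl))
    · exact DegLE.zero
    · exact hM (by omega) (by omega) ((hb H).smul _)
    · exact hM (by omega) (by omega) ((hb H).smul _)
    · exact DegLE.zero
  have hEsum : ∀ H (u : _ → K) i, ∑ s, u s • E s i H =
      ofCoeffs (fun s => u (.inl s)) * (if i then dX (b H) else dY (b H)) -
        (if i then ofCoeffs (fun s => u (.inr (.inl s))) else
          ofCoeffs fun s => u (.inr (.inr s))) * b H := by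
    intro H u i
    rw [Fintype.sum_sum_type, Fintype.sum_sum_type]
    cases i
    · simp only [E, M, smul_zero, Finset.sum_const_zero, zero_add, ofCoeffs_mul]
      simp only [neg_smul, one_smul, Bool.false_eq_true, if_false]
      ring
    · simp only [E, M, smul_zero, Finset.sum_const_zero, add_zero, ofCoeffs_mul]
      simp only [neg_smul, one_smul, if_true]
      ring
  refine Reach.mono_cost (N := D ^ 2 + (D ^ 2 + (D ^ 2 + 72 * D ^ 6))) ?_ ?_
  swap
  · have : D ^ 2 ≤ D ^ 6 := Nat.pow_le_pow_right (by omega) (by omega)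
    omega
  refine ((slp_derivation (Or.inl rfl) hV hb kb).mono subset_rfl (hsq (by omega) (by omega))
    subset_rfl).reach fun V₁ s₁ k₁ => ?_
  refine ((slp_derivation (Or.inr rfl) (hV.mono s₁) hb (kb.mono s₁)).mono subset_rfl
    (hsq (by omega) (by omega)) subset_rfl).reach fun V₂ s₂ k₂ => ?_
  have hc₂ := (hV.mono s₁).mono s₂
  refine ((slp_smul hc₂ (c := fun _ => (-1 : K)) (hc₂ (-1)) hb (kb.mono (s₁.trans s₂))).mono
    subset_rfl (hsq (by omega) (by omega)) subset_rfl).reach fun V₃ s₃ k₃ => ?_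
  have hc₃ := hc₂.mono s₃
  have kE : ∀ s i, Known V₃ (E s i) := by
    intro s i
    rcases s with s | s | s <;> cases i
    · exact known_monomial_mul hc₃ (k₂.trans s₃) _ _
    · exact known_monomial_mul hc₃ (k₁.trans (s₂.trans s₃)) _ _
    · exact known_const hc₃ 0
    · exact known_monomial_mul hc₃ k₃ _ _
    · exact known_monomial_mul hc₃ k₃ _ _
    · exact known_const hc₃ 0
  refine ((Reach.exists_relation E hE S hc₃ kE).mono_cost ?_).imp fun S' V' hS hV' h => ?_
  · have h₁ := hsq (i := p) (j := q) (by omega) (by omega)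
    have h₂ : (p + 1) * q ≤ (p + 1) * (q + 1) := Nat.mul_le_mul_left _ (by omega)
    have h₃ := hsq (le_refl t) (le_refl t)
    simp only [Fintype.card_sum, Fintype.card_prod, Fintype.card_fin, Fintype.card_bool]
    have h₄ : (p + 1) * (q + 1) + ((p + 1) * (q + 1) + (p + 1) * q) + 1 ≤ 3 * D ^ 2 := by
      have : (p + 1) * q + 1 ≤ (p + 1) * (q + 1) := by rw [mul_add (p + 1) q 1]; omega
      omega
    have h₅ : 2 * ((t + 1) * (t + 1)) + 1 ≤ 2 * D ^ 2 := by nlinarith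
    calc _ ≤ 3 * D ^ 2 * (4 * (2 * D ^ 2) * (3 * D ^ 2)) := by gcongr; omega
      _ = 72 * D ^ 6 := by ring
  · rcases h with h | ⟨u, hu, h⟩
    -- If the square free part of `b` satisfied the degree bounds, it would give a nontrivial
    -- solution.
    · refine Or.inl fun H hH => ?_
      have hb0' := hb0 H (hS hH)
      by_contra hcon
      push Not at hcon
      set z := sqfreePart (b H) with hz
      have hz0 : z ≠ 0 := (sqfreePart_spec hb0').1.ne_zero
      obtain ⟨sx, hsx⟩ := dvd_sqfreePart_mul_derivation dX (b H)
      obtain ⟨sy, hsy⟩ := dvd_sqfreePart_mul_derivation dY (b H)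
      have dz : DegLE z p q := (degLE_degX_degY z).mono hcon.1 hcon.2
      have dsx : DegLE sx p q := (degLE_of_mul_eq hb0' hsx.symm
        ((degLE_degX_degY (b H)).derivation (Or.inl rfl))).mono hcon.1 hcon.2
      have dsy : DegLE sy p q := (degLE_of_mul_eq hb0' hsy.symm
        ((degLE_degX_degY (b H)).derivation (Or.inr rfl))).mono hcon.1 hcon.2
      have dsy' : ∀ j, q ≤ j → sy.coeff j = 0 := by
        intro j hj
        rcases natDegree_lt_of_mul_dY_eq hb0' hsy.symm with h0 | h0
        · rw [h0, coeff_zero]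
        · refine coeff_eq_zero_of_natDegree_lt ?_
          exact h0.trans_le (hcon.2.trans hj)
      have e₁ : ofCoeffs (fun s : Fin (p + 1) × Fin (q + 1) => (z.coeff s.2).coeff s.1) = z :=
        ofCoeffs_coeff fun i j hij => dz i j (by omega)
      have e₂ : ofCoeffs (fun s : Fin (p + 1) × Fin (q + 1) => (sx.coeff s.2).coeff s.1) = sx :=
        ofCoeffs_coeff fun i j hij => dsx i j (by omega)
      have e₃ : ofCoeffs (fun s : Fin (p + 1) × Fin q => (sy.coeff s.2).coeff s.1) = sy :=
        ofCoeffs_coeff fun i j hij => by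
          rcases hij with hij | hij
          · exact dsy i j (by omega)
          · rw [dsy' j hij, coeff_zero]
      have hu := h H hH (fun s => match s with
        | .inl s => (z.coeff s.2).coeff s.1
        | .inr (.inl s) => (sx.coeff s.2).coeff s.1
        | .inr (.inr s) => (sy.coeff s.2).coeff s.1) fun i => by
          rw [hEsum]
          cases i
          · simp only [Bool.false_eq_true, if_false]
            rw [e₁, e₃, hsy]
            ring
          · simp only [if_true]
            rw [e₁, e₂, hsx]
            ring
      refine hz0 (e₁.symm.trans ?_)
      have : (fun s : Fin (p + 1) × Fin (q + 1) => (z.coeff s.2).coeff s.1) = 0 :=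
        funext fun s => congrFun hu (.inl s)
      rw [this]
      simp [ofCoeffs]
    · have hc' := hc₃.mono hV'
      refine Or.inr ⟨fun H => ofCoeffs fun s => u (.inl s) H, fun H => ofCoeffs fun s =>
        u (.inr (.inl s)) H, fun H => ofCoeffs fun s => u (.inr (.inr s)) H,
        ⟨known_ofCoeffs hc' fun s => hu _, known_ofCoeffs hc' fun s => hu _,
          known_ofCoeffs hc' fun s => hu _⟩, fun H => ⟨DegLE.ofCoeffs _ le_rfl le_rfl,
          DegLE.ofCoeffs _ le_rfl le_rfl, DegLE.ofCoeffs _ le_rfl (by omega),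
          degree_ofCoeffs_lt _⟩, fun H hH => ?_⟩
      have hb0' := hb0 H (hS hH)
      obtain ⟨hne, heq⟩ := h H hH
      have hx := heq true
      have hy := heq false
      rw [hEsum] at hx hy
      simp only [if_true, Bool.false_eq_true, if_false] at hx hy
      -- A relation with `z = 0` would force `b * sx = 0` and `b * sy = 0`, hence be trivial.
      refine ⟨fun h0 => hne ?_, by linear_combination -hx, by linear_combination -hy⟩
      replace h0 : (ofCoeffs fun s => u (.inl s) H) = 0 := h0
      rw [h0, zero_mul, zero_sub, neg_eq_zero] at hx hy
      have h₁ := ofCoeffs_eq_zero h0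
      have h₂ := ofCoeffs_eq_zero ((mul_eq_zero.1 hx).resolve_right hb0')
      have h₃ := ofCoeffs_eq_zero ((mul_eq_zero.1 hy).resolve_right hb0')
      funext s
      rcases s with s | s | s
      · exact congrFun h₁ s
      · exact congrFun h₂ s
      · exact congrFun h₃ s

end LinearRelations

/-! ### Searching for an admissible degree bound -/

section Trials

open Polynomial

variable {K : Type u} {Ω : Type*} [Field K] {L : ℕ} {V : Set (Ω → K)}

/-- Searching for a constant at which bivariate polynomials do not vanish. -/
theorem Reach.exists_eval_ne_zero [CharZero K] {v : Ω → K[X][Y]} {a t : ℕ} (S : Set Ω)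
    (hV : HasConsts V) (hv : ∀ H, DegLE (v H) a t) (kv : Known V v) (hv0 : ∀ H ∈ S, v H ≠ 0) :
    Reach (fun S' _ => (∀ H, H ∉ S') ∨ ∃ y₀ : K, ∀ H ∈ S', (v H).eval (C y₀) ≠ 0)
      ((t + 1) * (a + 1) * (2 * (t + 1)) + (t + 1) * (a + 1)) S V := by
  classical
  set s := Finset.range (t + 1) ×ˢ Finset.range (a + 1) with hs
  have hcard : s.card = (t + 1) * (a + 1) := by simp [hs]
  have heval : ∀ H (c : K) i, ((v H).eval (C c)).coeff i =
      ∑ j ∈ Finset.range (t + 1), coef v i j H * c ^ j := by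
    intro H c i
    rw [eval_eq_sum_range' (Nat.lt_succ_of_le (hv H).natDegree), finsetSum_coeff]
    refine Finset.sum_congr rfl fun j _ => ?_
    rw [← C_pow, coeff_mul_C, coef]
  have hslp := SLP.biUnion s (fun x => {fun H => ∑ j ∈ Finset.range (t + 1),
    coef v x.2 j H * (x.1 : K) ^ j}) fun x _ => SLP.sum_mul hV (Finset.range (t + 1))
      (fun j => coef v x.2 j) (fun j _ => (x.1 : K) ^ j) (fun j _ => kv.coef_mem _ _)
      fun j _ => hV _
  rw [hcard, Finset.card_range] at hslp
  refine hslp.reach fun V₁ s₁ k₁ => ?_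
  have hfind := Reach.find_nonzero s.toList (fun x H => ((v H).eval (C (x.1 : K))).coeff x.2) S V₁
    fun x hx => by
      simp only [heval]
      exact k₁ (Set.mem_biUnion (Finset.mem_coe.2 (Finset.mem_toList.1 hx)) rfl)
  rw [Finset.length_toList, hcard] at hfind
  refine hfind.imp fun S' V' hS _ h => ?_
  rcases h with h | ⟨-, x, -, -, -, hx⟩
  · refine Or.inl fun H hH => hv0 H (hS hH) ?_
    -- The `t + 1` values `0, …, t` are too many roots for a nonzero polynomial of degree at most
    -- `t` in `y`.
    refine eq_zero_of_natDegree_lt_card_of_eval_eq_zero' (v H)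
      ((Finset.range (t + 1)).image fun k : ℕ => (C (k : K) : K[X])) ?_ ?_
    · intro y hy
      obtain ⟨k, hk, rfl⟩ := Finset.mem_image.1 hy
      ext i
      rw [coeff_zero]
      by_cases hi : i < a + 1
      · exact h (k, i) (Finset.mem_toList.2 (Finset.mem_product.2 ⟨hk, Finset.mem_range.2 hi⟩)) H hH
      · rw [heval]
        exact Finset.sum_eq_zero fun j _ => by rw [coef, hv H i j (by omega), zero_mul]
    · rw [Finset.card_image_of_injective _ (show Function.Injective fun k : ℕ => (C (k : K) : K[X])
        from C_injective.comp Nat.cast_injective), Finset.card_range]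
      exact Nat.lt_succ_of_le (hv H).natDegree
  -- The point is the same for all inputs on this branch, so the factor `y - y₀` of the certificate
  -- can be treated as a constant of the program.
  · exact Or.inr ⟨x.1, fun H hH h0 => hx H hH (by rw [h0, coeff_zero])⟩

/-- The `p i` are the coefficients of a telescoper for the terms described by `H`, and `f / g` is
the quotient of the certificate and the term. -/
def HypTerm.HasRelation (H : HypTerm K L) (r : ℕ) (p : Fin (r + 1) → K[X])
    (f g : K[X][Y]) : Prop :=
  ∀ (E : Type v) [Field E] [Algebra K E] [Algebra K[X][Y] E] [IsScalarTower K K[X][Y] E]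
    (D : DiffFieldExt K E) (h : E), H.Describes D h →
      D.IsCTRelation h r p (algebraMap K[X][Y] E f / algebraMap K[X][Y] E g * h)

theorem LogDerivatives.hasRelation {H : HypTerm K L} {z sx sy : K[X][Y]}
    (hz : LogDerivatives H.b z sx sy) {r : ℕ} {p : Fin (r + 1) → K[X]} {f g : K[X][Y]}
    (h : Telescopes.{u, v} H.c₀ (H.denominator z) (H.numerator dX z sx) (H.numerator dY z sy)
      r p f g) : HypTerm.HasRelation.{u, v} H r p f g := by
  intro E _ _ _ _ D e he
  have := h E D _ (he.hasLogDerivs hz.ne_zero hz.x hz.y)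
  rwa [mul_div_cancel₀ _ (D.algebraMap_ne H.c₀_ne)] at this

/-- On `S`, creative telescoping relations of order `r` have been computed. -/
def RelationFound (H : Ω → HypTerm K L) (r : ℕ) (S : Set Ω) (V : Set (Ω → K)) : Prop :=
  ∃ out : HypOutput r → Ω → K, (∀ w, out w ∈ V) ∧ ∀ ω ∈ S, ∃ p f g, g ≠ 0 ∧
    (fun w => out w ω) = HypOutput.value p f g ∧ HypTerm.HasRelation.{u, v} (H ω) r p f g

theorem RelationFound.of_empty (hV : HasConsts V) (H : Ω → HypTerm K L) (r : ℕ) {S : Set Ω}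
    (hS : ∀ ω, ω ∉ S) : RelationFound.{u, v} H r S V :=
  ⟨fun _ _ => 0, fun _ => hV 0, fun ω hω => (hS ω hω).elim⟩

/-- The number of operations for finding a relation by means of a linear system. -/
def telescoperCost (κ : ℕ → ℝ) (a t r ε D : ℕ) : ℕ :=
  ⌊(solutionDegree a t r ε : ℝ) * (systemSize t r ε : ℝ) ^ 3 *
    κ (max (solutionDegree a t r ε) (systemSize t r ε))⌋₊ +
      200 * (D ^ 7 + (solutionDegree a t r ε + 1) * D ^ 5)

/-- For `ε = 1` the numerator of the certificate is taken divisible by `y - y₀`, where `v` does not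
vanish on the line `y = y₀`. For `ε = 0` no such factor is needed, because a normalized term with
`φ₃ = 0` has no certificate of the zero operator. -/
theorem HasFormat.reach_relationFound [CharZero K] {κ : ℕ → ℝ} (hκ : SolvesLinearSystems K κ)
    {H : Ω → HypTerm K L} {F : HypFormat L} (hF : HasFormat H F) {S : Set Ω}
    (hk : KnownTerm V H) {z sx sy : Ω → K[X][Y]} {t G D r ε : ℕ} (hx : F.sizeX ≤ t)
    (hy : F.sizeY ≤ t) (h1 : 1 ≤ t) (hG : F.a.1 ≤ F.b.1 + G) (hc₁ : F.c₀.1 ≤ t + G)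
    (hc₂ : F.c₀.2 ≤ t) (ha : t + G + 2 ≤ D) (hr : r + 2 ≤ D)
    (hz : ∀ ω, DegLE (z ω) (t - F.sizeX) (t - F.sizeY))
    (hsx : ∀ ω, DegLE (sx ω) (t - F.sizeX) (t - F.sizeY))
    (hsy : ∀ ω, DegLE (sy ω) (t - F.sizeX) (t - F.sizeY))
    (hsy' : ∀ ω, (sy ω).degree < ((t - F.sizeY : ℕ) : WithBot ℕ))
    (kz : Known V z) (ksx : Known V sx) (ksy : Known V sy)
    (hlog : ∀ ω ∈ S, LogDerivatives (H ω).b (z ω) (sx ω) (sy ω))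
    (hcase : ε = 1 ∧ t ≤ r ∨ ε = 0 ∧ t ≤ r + 1 ∧ ∀ ω ∈ S, (H ω).Normalized ∧ (H ω).phi₃ = 0) :
    Reach (RelationFound.{u, v} H r) (100 * (D ^ 7 + (solutionDegree (t + G) t r ε + 1) * D ^ 5) +
      ⌊(solutionDegree (t + G) t r ε : ℝ) * (systemSize t r ε : ℝ) ^ 3 *
        κ (max (solutionDegree (t + G) t r ε) (systemSize t r ε))⌋₊ + 60 * D ^ 6) S V := by
  have ht : t + 2 ≤ D := by omega
  have dv := hF.degLE_denominator hx hy hz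
  have dwx := hF.degLE_numerator hx hy hG hz hsx (Or.inl rfl)
  have dwy := hF.degLE_numerator hx hy hG hz hsy (Or.inr rfl)
  have hv0 : ∀ ω ∈ S, (H ω).denominator (z ω) ≠ 0 := fun ω hω =>
    (H ω).denominator_ne_zero (hlog ω hω).ne_zero
  have core : ∀ (g : K[X][Y]) (S' : Set Ω) (V' : Set (Ω → K)), S' ⊆ S → V ⊆ V' → DegLE g 0 ε →
      Known V' (fun ω => (H ω).denominator (z ω)) →
      Known V' (fun ω => (H ω).numerator dX (z ω) (sx ω)) →
      Known V' (fun ω => (H ω).numerator dY (z ω) (sy ω)) →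
      (∀ ω ∈ S', ∀ q, twist dY ((H ω).denominator (z ω)) ((H ω).numerator dY (z ω) (sy ω))
        ((r : K) - 1) (g * q) = 0 → q = 0) →
      Reach (RelationFound.{u, v} H r) (⌊(solutionDegree (t + G) t r ε : ℝ) *
        (systemSize t r ε : ℝ) ^ 3 * κ (max (solutionDegree (t + G) t r ε) (systemSize t r ε))⌋₊ +
        100 * (D ^ 7 + (solutionDegree (t + G) t r ε + 1) * D ^ 5)) S' V' := by
    intro g S' V' hS hV' hg kv kwx kwy hinj
    have hk' := hk.mono hV'
    refine (Reach.telescoper.{u, v} hκ (by omega) h1 (by omega) (by omega) ha ht hr hg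
      hk'.consts (fun ω => (hF.c₀ ω).mono hc₁ hc₂) (fun ω => (dv ω).mono (by omega) le_rfl) dwx dwy
      (fun ω _ => hF.natDegree_numerator hy h1 (fun ω => (hz ω).natDegree) hsy' ω) hk'.c₀ kv kwx kwy
      (fun ω _ => (H ω).c₀_ne) (fun ω hω => hv0 ω (hS hω)) hinj).imp fun S'' V'' hS'' _ h => ?_
    obtain ⟨out, hout, h⟩ := h
    refine ⟨out, hout, fun ω hω => ?_⟩
    obtain ⟨p, f, g, hg, e, h⟩ := h ω hω
    exact ⟨p, f, g, hg, e, (hlog ω (hS (hS'' hω))).hasRelation h⟩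
  have hscan : (t + 1) * (t + 1) * (2 * (t + 1)) + (t + 1) * (t + 1) ≤ 3 * D ^ 5 := by
    calc _ ≤ D * D * (2 * D) + D * D * D := by
          refine Nat.add_le_add (by gcongr <;> omega) ?_
          exact (Nat.mul_le_mul (by omega) (by omega)).trans (Nat.le_mul_of_pos_right _ (by omega))
      _ = 3 * D ^ 3 := by ring
      _ ≤ 3 * D ^ 5 := by gcongr <;> omega
  have h₅ : 2 * D ^ 5 ≤ D ^ 6 := by
    rw [pow_succ D 5]; nlinarith [Nat.mul_le_mul_left (D ^ 5) (show 2 ≤ D by omega)]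
  set N := ⌊(solutionDegree (t + G) t r ε : ℝ) *
        (systemSize t r ε : ℝ) ^ 3 * κ (max (solutionDegree (t + G) t r ε) (systemSize t r ε))⌋₊
  set N' := 100 * (D ^ 7 + (solutionDegree (t + G) t r ε + 1) * D ^ 5)
  refine Reach.mono_cost (N := 6 * D ^ 5 + (26 * D ^ 6 + (26 * D ^ 6 + (3 * D ^ 5 + (N + N')))))
    ?_ (by omega)
  refine (hF.slp_denominator hk hx hy ht hz kz).reach fun V₁ s₁ k₁ => ?_
  refine (hF.slp_numerator (hk.mono s₁) hx hy ht ha hG hz (kz.mono s₁) hsx (ksx.mono s₁)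
    (Or.inl rfl)).reach fun V₂ s₂ k₂ => ?_
  have t₂ := s₁.trans s₂
  refine (hF.slp_numerator (hk.mono t₂) hx hy ht ha hG hz (kz.mono t₂) hsy (ksy.mono t₂)
    (Or.inr rfl)).reach fun V₃ s₃ k₃ => ?_
  have t₃ := t₂.trans s₃
  have hk₃ := hk.mono t₃
  rcases hcase with ⟨rfl, htr⟩ | ⟨rfl, htr, hn⟩
  · refine ((Reach.exists_eval_ne_zero S hk₃.consts dv (k₁.trans (s₂.trans s₃)) hv0).mono_cost
      hscan).bind fun S' V' hS hV' h => ?_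
    have hk' := hk₃.mono hV'
    rcases h with h | ⟨y₀, h⟩
    · exact .done (RelationFound.of_empty hk'.consts H r h)
    · refine core (X - C (C y₀)) S' V' hS (t₃.trans hV') ?_ (k₁.trans ((s₂.trans s₃).trans hV'))
        (k₂.trans (s₃.trans hV')) (k₃.trans hV') fun ω hω q hq => ?_
      · have h := (DegLE.X_pow (K := K) 1).sub
          (DegLE.C (a := 0) (b := 1) (natDegree_C y₀).le)
        rwa [pow_one] at h
      · have h0 := eq_zero_of_twist_eq_zero (C y₀) (h ω hω) (by simp) hq
        exact (mul_eq_zero.1 h0).resolve_left (X_sub_C_ne_zero _)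
  · refine (core 1 S V₃ subset_rfl t₃ DegLE.one (k₁.trans (s₂.trans s₃)) (k₂.trans s₃) k₃
      fun ω hω q hq => ?_).mono_cost (by omega)
    rw [one_mul] at hq
    exact (H ω).eq_zero_of_twist_eq_zero (hn ω hω).1 (hn ω hω).2 (hlog ω hω).ne_zero
      (hlog ω hω).y r hq

namespace HypTerm

theorem alpha_eq (H : HypTerm K L) : H.alpha = degX (sqfreePart H.b) + H.format.sizeX :=
  add_assoc _ _ _

theorem gamma_eq (H : HypTerm K L) : H.gamma = degY (sqfreePart H.b) + H.format.sizeY :=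
  add_assoc _ _ _

theorem le_tau (H : HypTerm K L) : H.alpha ≤ H.tau ∧ H.gamma ≤ H.tau ∧ H.format.c₀.1 ≤ H.tau ∧
    H.format.c₀.2 ≤ H.tau := by
  simp [tau, format]

theorem one_le_sizeY (H : HypTerm K L) : 1 ≤ H.format.sizeY :=
  Nat.one_le_iff_ne_zero.2 H.y_ne

theorem one_le_tau (H : HypTerm K L) : 1 ≤ H.tau := by
  have := H.one_le_sizeY
  have := H.le_tau
  have := H.gamma_eq
  omega

end HypTerm

/-- An attempt to find a relation, which is successful unless `τ` is larger than `t`. -/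
theorem HasFormat.reach_trial [CharZero K] {κ : ℕ → ℝ} (hκ : SolvesLinearSystems K κ)
    {H : Ω → HypTerm K L} {F : HypFormat L} (hF : HasFormat H F) {S : Set Ω}
    (hk : KnownTerm V H) {t G D r ε N : ℕ} (hG : F.a.1 ≤ F.b.1 + G) (ha : t + G + 2 ≤ D)
    (hr : r + 2 ≤ D)
    (hcase : ε = 1 ∧ t ≤ r ∨ ε = 0 ∧ t ≤ r + 1 ∧ ∀ ω ∈ S, (H ω).Normalized ∧ (H ω).phi₃ = 0)
    (hcost : telescoperCost κ (t + G) t r ε D ≤ N)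
    (hfail : ∀ S' V', S' ⊆ S → V ⊆ V' → (∀ ω ∈ S', t < (H ω).tau) →
      Reach (RelationFound.{u, v} H r) N S' V') :
    Reach (RelationFound.{u, v} H r) (75 * D ^ 6 + N) S V := by
  -- If the degrees in the format alone exceed `t`, then so does `τ`, and nothing has to be
  -- computed.
  by_cases hbig : F.sizeX ≤ t ∧ F.sizeY ≤ t ∧ F.c₀.1 ≤ t ∧ F.c₀.2 ≤ t
  swap
  · refine (hfail S V subset_rfl subset_rfl fun ω _ => ?_).mono_cost (Nat.le_add_left _ _)
    have := (H ω).le_tau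
    have := (H ω).alpha_eq
    have := (H ω).gamma_eq
    rw [hF.eq ω] at *
    omega
  obtain ⟨hx, hy, hc₁, hc₂⟩ := hbig
  have hsx : F.b.1 + (t - F.sizeX) ≤ t := by rw [HypFormat.sizeX] at *; omega
  have hsy : F.b.2 + (t - F.sizeY) ≤ t := by rw [HypFormat.sizeY] at *; omega
  refine (Reach.logDerivatives S hk.consts hF.b hk.b (fun ω _ => (H ω).b_ne) hsx hsy
    (by omega : t + 2 ≤ D)).bind fun S' V' hS hV' h => ?_
  rcases h with h | ⟨z, sx, sy, ⟨kz, ksx, ksy⟩, hdeg, hlog⟩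
  -- The square free part of `b` is too large for what `t` leaves after the other contributions, so
  -- `α` or `γ` exceeds `t`.
  · refine hfail S' V' hS hV' fun ω hω => ?_
    have h₁ := (H ω).le_tau
    have h₂ := (H ω).alpha_eq
    have h₃ := (H ω).gamma_eq
    have h₄ := h ω hω
    rw [hF.eq ω] at h₁ h₂ h₃
    omega
  · by_cases hne : Nonempty Ω
    · obtain ⟨ω₀⟩ := hne
      have h1 := (H ω₀).one_le_sizeY
      rw [hF.eq ω₀] at h1
      refine (hF.reach_relationFound.{u, v} hκ (hk.mono hV') hx hy (by omega) hG (by omega) hc₂ ha hr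
        (fun ω => (hdeg ω).1) (fun ω => (hdeg ω).2.1) (fun ω => (hdeg ω).2.2.1)
        (fun ω => (hdeg ω).2.2.2) kz ksx ksy hlog
        (hcase.imp_right fun h => ⟨h.1, h.2.1, fun ω hω => h.2.2 ω (hS hω)⟩)).mono_cost ?_
      refine le_trans ?_ hcost
      rw [telescoperCost]
      have : 2 * D ^ 6 ≤ D ^ 7 := by
        rw [pow_succ D 6]; nlinarith [Nat.mul_le_mul_left (D ^ 6) (show 2 ≤ D by omega)]
      omega
    · exact hfail S' V' hS hV' fun ω _ => (hne ⟨ω⟩).elim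

/-- Attempts to find a relation for increasing values of `t`. -/
theorem HasFormat.reach_trials [CharZero K] {κ : ℕ → ℝ} (hκ : SolvesLinearSystems K κ)
    {H : Ω → HypTerm K L} {F : HypFormat L} (hF : HasFormat H F) {G D r N : ℕ}
    (hG : F.a.1 ≤ F.b.1 + G) (hr : r + 2 ≤ D) (k : ℕ) {t : ℕ} {S : Set Ω} (hk : KnownTerm V H)
    (ht : t + k ≤ r) (ha : t + k + G + 2 ≤ D)
    (hcost : ∀ t', t ≤ t' → t' ≤ t + k → telescoperCost κ (t' + G) t' r 1 D ≤ N)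
    (hS : ∀ ω ∈ S, (H ω).tau ≤ t + k) :
    Reach (RelationFound.{u, v} H r) ((k + 1) * (75 * D ^ 6) + N) S V := by
  induction k generalizing t S V with
  | zero =>
    rw [zero_add, one_mul]
    refine hF.reach_trial hκ hk hG (by omega) hr (Or.inl ⟨rfl, ht⟩) (hcost t le_rfl (by omega))
      fun S' V' hS' hV' h => Reach.mono_cost (.done (.of_empty (hk.consts.mono hV') _ _
        fun ω hω => ?_)) (Nat.zero_le _)
    have := h ω hω
    have := hS ω (hS' hω)
    omega
  | succ k ih =>
    -- A failed trial costs only the search for a denominator. Each branch solves at most one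
    -- telescoper system, so `N` is paid once.
    rw [add_mul, one_mul, add_comm _ (75 * D ^ 6), add_assoc]
    refine hF.reach_trial hκ hk hG (by omega) hr (Or.inl ⟨rfl, by omega⟩)
      ((hcost t le_rfl (by omega)).trans (Nat.le_add_left _ _)) fun S' V' hS' hV' h => ?_
    exact ih (t := t + 1) (hk.mono hV') (by omega) (by omega)
      (fun t' h₁ h₂ => hcost t' (by omega) (by omega))
      fun ω hω => (hS ω (hS' hω)).trans (by omega)

end Trials

/-! ## Estimates for the number of operations -/

section Estimates

/-- Nonnegativity is not assumed for `κ`. It follows from running the solver on one variable and no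
equations, since the number of operations is nonnegative. -/
theorem SolvesLinearSystems.nonneg {K : Type*} [Field K] {κ : ℕ → ℝ} (hκ : SolvesLinearSystems K κ)
    {s : ℕ} (hs : 1 ≤ s) : 0 ≤ κ s := by
  obtain ⟨T, hT⟩ := hκ s 1 0 hs le_rfl (Nat.zero_le _)
  obtain ⟨u, -, -, -, n, -, hn⟩ := hT 0 (fun i => i.elim0)
    ⟨fun _ => 1, fun h => one_ne_zero (congrFun h 0), fun _ => by simp, by simp⟩
  have h₁ : (0 : ℝ) ≤ n := Nat.cast_nonneg n
  have h₂ : (0 : ℝ) < s := by exact_mod_cast hs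
  rw [max_eq_left hs, Nat.cast_one, one_pow, mul_one] at hn
  exact nonneg_of_mul_nonneg_right (h₁.trans hn) h₂

/-- From some point `t` on, `κ s / s` is at most `κ t / t`; below `t`, monotonicity suffices. -/
theorem Sublinear.exists_le_mul {κ : ℕ → ℝ} (hκ : Sublinear κ) (hmono : Monotone κ)
    (h0 : ∀ s, 1 ≤ s → 0 ≤ κ s) : ∃ A : ℝ, 0 ≤ A ∧ ∀ s : ℕ, 1 ≤ s → κ s ≤ A * s := by
  obtain ⟨t₀, ht⟩ := hκ
  set t := max t₀ 1
  have ht1 : 1 ≤ t := le_max_right _ _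
  have hA := h0 t ht1
  refine ⟨κ t, hA, fun s hs => ?_⟩
  have hs' : (1 : ℝ) ≤ s := by exact_mod_cast hs
  rcases le_total t s with h | h
  · have h₁ := ht t s (le_max_left _ _) h
    have h₂ : (1 : ℝ) ≤ t := by exact_mod_cast ht1
    nlinarith [h0 s hs]
  · nlinarith [hmono h]

/-- Enlarging the argument by the factor `1 + c / (2 * x)` enlarges `κ` by at most this factor,
which after multiplication by `x` costs only a multiple of `κ (2 * x ^ 3)`. The finitely many `x`
below the threshold of sublinearity are covered by the constant `M`. -/
theorem Sublinear.exists_le_add {κ : ℕ → ℝ} (hκ : Sublinear κ) (hmono : Monotone κ)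
    (h0 : ∀ s, 1 ≤ s → 0 ≤ κ s) (c : ℕ) : ∃ C : ℝ, 0 ≤ C ∧ ∀ x : ℕ, 1 ≤ x →
      x * κ (2 * x ^ 3 + c * x ^ 2) ≤ x * κ (2 * x ^ 3) + C * (1 + κ (2 * x ^ 3)) := by
  obtain ⟨t₀, ht⟩ := hκ
  set M := κ (2 * (t₀ + 1) ^ 3 + c * (t₀ + 1) ^ 2) with hM
  have hM0 : 0 ≤ M := h0 _ (Nat.one_le_iff_ne_zero.2 (by positivity))
  refine ⟨c + t₀ * M, by positivity, fun x hx => ?_⟩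
  have hs1 : 1 ≤ 2 * x ^ 3 := Nat.mul_pos two_pos (pow_pos hx 3)
  have hκs := h0 _ hs1
  rcases le_total t₀ x with h | h
  · have hle : t₀ ≤ 2 * x ^ 3 := by nlinarith [Nat.le_self_pow (show 3 ≠ 0 by norm_num) x]
    have h₁ := ht (2 * x ^ 3) (2 * x ^ 3 + c * x ^ 2) hle (Nat.le_add_right _ _)
    push_cast at h₁
    have hx' : (0 : ℝ) < x := by exact_mod_cast hx
    have h₂ : (x : ℝ) ^ 2 * (2 * (x * κ (2 * x ^ 3 + c * x ^ 2))) ≤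
        (x : ℝ) ^ 2 * (2 * (x * κ (2 * x ^ 3)) + c * κ (2 * x ^ 3)) := by
      linarith
    have h₃ := le_of_mul_le_mul_left h₂ (by positivity)
    have h₄ : (0 : ℝ) ≤ c * κ (2 * x ^ 3) := by positivity
    have h₅ : (0 : ℝ) ≤ t₀ * M * (1 + κ (2 * x ^ 3)) := by positivity
    have h₆ : (0 : ℝ) ≤ c := Nat.cast_nonneg c
    linarith
  · have h₁ : κ (2 * x ^ 3 + c * x ^ 2) ≤ M := hmono (by gcongr <;> omega)
    have h₂ : (x : ℝ) ≤ t₀ := by exact_mod_cast h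
    have h₃ : (0 : ℝ) ≤ x := Nat.cast_nonneg x
    have h₄ : (x : ℝ) * κ (2 * x ^ 3 + c * x ^ 2) ≤ t₀ * M :=
      mul_le_mul h₂ h₁ (h0 _ (by nlinarith)) (by positivity)
    have h₅ : (0 : ℝ) ≤ c * (1 + κ (2 * x ^ 3)) := by positivity
    have h₆ : (0 : ℝ) ≤ t₀ * M * κ (2 * x ^ 3) := by positivity
    have h₇ : (0 : ℝ) ≤ x * κ (2 * x ^ 3) := by positivity
    linarith

theorem telescoperCost_le {κ : ℕ → ℝ} (hmono : Monotone κ) (h0 : ∀ s, 1 ≤ s → 0 ≤ κ s)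
    {a t r ε D s : ℕ} {x y : ℝ} (hx : (solutionDegree a t r ε : ℝ) ≤ x)
    (hy : (systemSize t r ε : ℝ) ≤ y) (hns : solutionDegree a t r ε ≤ s)
    (hms : systemSize t r ε ≤ s) :
    (telescoperCost κ a t r ε D : ℝ) ≤
      x * y ^ 3 * κ s + 200 * ((D : ℝ) ^ 7 + (x + 1) * (D : ℝ) ^ 5) := by
  have hm1 : 1 ≤ systemSize t r ε := by rw [systemSize]; omega
  have hκ := h0 _ (hm1.trans (le_max_right (solutionDegree a t r ε) _))
  have hle : κ (max (solutionDegree a t r ε) (systemSize t r ε)) ≤ κ s := hmono (max_le hns hms)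
  have hx0 : 0 ≤ x := (Nat.cast_nonneg _).trans hx
  have hy0 : 0 ≤ y := (Nat.cast_nonneg _).trans hy
  rw [telescoperCost]
  push_cast
  refine add_le_add ((Nat.floor_le (by positivity)).trans ?_) (by gcongr)
  gcongr

theorem exists_mul_pow_le {A ρ c : ℝ} (hA : 0 ≤ A) (hρ : 0 ≤ ρ) (hc : 0 ≤ c) :
    ∃ C : ℝ, 0 ≤ C ∧ ∀ x : ℝ, 1 ≤ x →
      (A * x ^ 2 + c * x) * (ρ * x ^ 2 + c * x) ^ 3 ≤ x ^ 7 * (A * ρ ^ 3 * x + C) := by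
  refine ⟨3 * A * ρ ^ 2 * c + c * ρ ^ 3 + (3 * A * ρ * c ^ 2 + 3 * ρ ^ 2 * c ^ 2) +
    (A * c ^ 3 + 3 * ρ * c ^ 3) + c ^ 4, by positivity, fun x hx => ?_⟩
  have hx0 : 0 ≤ x := by linarith
  have h₁ : (3 * A * ρ * c ^ 2 + 3 * ρ ^ 2 * c ^ 2) * x ^ 6 ≤
      (3 * A * ρ * c ^ 2 + 3 * ρ ^ 2 * c ^ 2) * x ^ 7 :=
    mul_le_mul_of_nonneg_left (pow_le_pow_right₀ hx (by norm_num)) (by positivity)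
  have h₂ : (A * c ^ 3 + 3 * ρ * c ^ 3) * x ^ 5 ≤ (A * c ^ 3 + 3 * ρ * c ^ 3) * x ^ 7 :=
    mul_le_mul_of_nonneg_left (pow_le_pow_right₀ hx (by norm_num)) (by positivity)
  have h₃ : c ^ 4 * x ^ 4 ≤ c ^ 4 * x ^ 7 :=
    mul_le_mul_of_nonneg_left (pow_le_pow_right₀ hx (by norm_num)) (by positivity)
  linear_combination h₁ + h₂ + h₃

end Estimates

/-! ### Cost at order `τ - 1 + φ₃` -/

section EstimateMinimalOrder

/-- In both cases there is exactly one more unknown than there are equations: the divisor `r + 2 - ε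
- t` is one. -/
theorem sizes_of_order_eq (t G r ε : ℕ) (h : ε = 1 ∧ t = r ∨ ε = 0 ∧ t = r + 1) :
    solutionDegree (t + G) t r ε ≤ (r + 1 + G) * (2 * (r + 1) ^ 2 + 1) ∧
      systemSize t r ε ≤ (r + 1) ^ 2 + 2 := by
  rcases h with ⟨rfl, rfl⟩ | ⟨rfl, rfl⟩
  · constructor
    · rw [solutionDegree, show t + 2 - 1 - t = 1 by omega, Nat.div_one]
      rcases t with _ | t
      · simp; omega
      · rw [show t + 1 - 1 + 1 = t + 1 by omega,
          show (t + 1) * (t + 1) + 2 - 1 = (t + 1) * (t + 1) + 1 by omega]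
        nlinarith [Nat.zero_le (G * t), Nat.zero_le (G * t ^ 2)]
    · rw [systemSize, show t * t + 2 - 1 = t * t + 1 by omega]
      nlinarith
  · constructor
    · rw [solutionDegree, show r + 2 - 0 - (r + 1) = 1 by omega, Nat.div_one,
        show r + 1 - 1 + 0 = r by omega, Nat.sub_zero]
      nlinarith [Nat.zero_le (G * r), Nat.zero_le (G * r ^ 2)]
    · rw [systemSize, Nat.sub_zero]
      nlinarith

/-- Here `x` stands for `τ`. Degree about `2 * x ^ 3` and size about `x ^ 2` give the leading
coefficient `2`; the summand with `D ^ 6` pays for two searches for a denominator. -/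
theorem exists_cost_le_of_order_eq {κ : ℕ → ℝ} (hmono : Monotone κ) (hsub : Sublinear κ)
    (h0 : ∀ s, 1 ≤ s → 0 ≤ κ s) (G : ℕ) : ∃ C : ℝ, ∀ t r ε x D : ℕ,
      (ε = 1 ∧ t = r ∨ ε = 0 ∧ t = r + 1) → 1 ≤ x → r ≤ x → D = r + G + 3 →
      150 * (D : ℝ) ^ 6 + telescoperCost κ (t + G) t r ε D ≤
        2 * κ (2 * x ^ 3) * (x : ℝ) ^ 9 + C * (1 + κ (2 * x ^ 3)) * (x : ℝ) ^ 8 := by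
  set c := 16 + 9 * G with hc
  obtain ⟨C₁, hC₁, h₁⟩ := hsub.exists_le_add hmono h0 c
  obtain ⟨C₂, hC₂, h₂⟩ := exists_mul_pow_le (A := 2) (ρ := 1) (c := c) (by norm_num) (by norm_num)
    (Nat.cast_nonneg c)
  set d : ℝ := G + 4 with hd
  refine ⟨2 * C₁ + C₂ * (1 + C₁) + (150 * d ^ 6 + 200 * (d ^ 7 + (3 + c) * d ^ 5)),
    fun t r ε x D hε hx hr hD => ?_⟩
  obtain ⟨hn, hm⟩ := sizes_of_order_eq t G r ε hε
  have hn' : solutionDegree (t + G) t r ε ≤ 2 * x ^ 3 + c * x ^ 2 := by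
    refine hn.trans ((Nat.mul_le_mul (Nat.add_le_add_right (Nat.add_le_add_right hr 1) G)
      (Nat.add_le_add_right (Nat.mul_le_mul_left 2 (Nat.pow_le_pow_left
        (Nat.add_le_add_right hr 1) 2)) 1)).trans ?_)
    obtain ⟨y, rfl⟩ := Nat.exists_eq_add_of_le hx
    rw [hc]
    nlinarith [Nat.zero_le (G * y), Nat.zero_le (G * y ^ 2), Nat.zero_le (y ^ 2),
      Nat.zero_le (y ^ 3)]
  have hm' : systemSize t r ε ≤ x ^ 2 + c * x := by
    refine hm.trans ?_
    nlinarith [Nat.pow_le_pow_left (Nat.add_le_add_right hr 1) 2, Nat.zero_le (G * x)]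
  have hms : systemSize t r ε ≤ 2 * x ^ 3 + c * x ^ 2 := by
    refine hm'.trans ?_
    have e₁ : x ^ 2 ≤ x ^ 3 := Nat.pow_le_pow_right hx (by norm_num)
    have e₂ : c * x ≤ c * x ^ 2 := Nat.mul_le_mul_left c (Nat.le_self_pow two_ne_zero x)
    omega
  have hx1 : (1 : ℝ) ≤ x := by exact_mod_cast hx
  have hx0 : (0 : ℝ) ≤ x := by linarith
  set κ₀ := κ (2 * x ^ 3) with hκ₀
  have hκ₀0 : 0 ≤ κ₀ := h0 _ (Nat.mul_pos two_pos (pow_pos hx 3))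
  set κ₁ := κ (2 * x ^ 3 + c * x ^ 2) with hκ₁
  have hκ₁0 : 0 ≤ κ₁ := h0 _ (Nat.add_pos_left (Nat.mul_pos two_pos (pow_pos hx 3)) _)
  have hle := h₁ x hx
  rw [← hκ₀, ← hκ₁] at hle
  have hle' : κ₁ ≤ κ₀ + C₁ * (1 + κ₀) := by
    have e : (0 : ℝ) ≤ C₁ * (1 + κ₀) := by positivity
    nlinarith
  have hcost := telescoperCost_le (κ := κ) hmono h0 (D := D) (x := 2 * (x : ℝ) ^ 3 + c * (x : ℝ) ^ 2)
    (y := (x : ℝ) ^ 2 + c * x) (by exact_mod_cast hn') (by exact_mod_cast hm') hn' hms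
  rw [← hκ₁] at hcost
  have hprod := h₂ x hx1
  have hmain : (2 * (x : ℝ) ^ 3 + c * (x : ℝ) ^ 2) * ((x : ℝ) ^ 2 + c * x) ^ 3 * κ₁ ≤
      (x : ℝ) ^ 8 * (2 * (x * κ₀) + (2 * C₁ + C₂ * (1 + C₁)) * (1 + κ₀)) := by
    have e₁ : (2 * (x : ℝ) ^ 3 + c * (x : ℝ) ^ 2) * ((x : ℝ) ^ 2 + c * x) ^ 3 =
        x * ((2 * (x : ℝ) ^ 2 + c * x) * (1 * (x : ℝ) ^ 2 + c * x) ^ 3) := by ring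
    have e₂ : (2 * (x : ℝ) ^ 3 + c * (x : ℝ) ^ 2) * ((x : ℝ) ^ 2 + c * x) ^ 3 ≤
        (x : ℝ) ^ 8 * (2 * x + C₂) := by
      rw [e₁]
      calc _ ≤ x * ((x : ℝ) ^ 7 * (2 * 1 ^ 3 * x + C₂)) := by gcongr
        _ = _ := by ring
    calc _ ≤ (x : ℝ) ^ 8 * (2 * x + C₂) * κ₁ := by gcongr
      _ = (x : ℝ) ^ 8 * (2 * (x * κ₁) + C₂ * κ₁) := by ring
      _ ≤ (x : ℝ) ^ 8 * (2 * (x * κ₀ + C₁ * (1 + κ₀)) + C₂ * (κ₀ + C₁ * (1 + κ₀))) := by gcongr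
      _ ≤ _ := mul_le_mul_of_nonneg_left (by linear_combination hC₂) (by positivity)
  have hDd : (D : ℝ) ≤ d * x := by
    have : (r : ℝ) ≤ x := by exact_mod_cast hr
    have hG : (0 : ℝ) ≤ G := Nat.cast_nonneg G
    rw [hD, hd]
    push_cast
    nlinarith
  have hd0 : 0 ≤ d := by positivity
  have hlow : 150 * (D : ℝ) ^ 6 + 200 * ((D : ℝ) ^ 7 +
      (2 * (x : ℝ) ^ 3 + c * (x : ℝ) ^ 2 + 1) * (D : ℝ) ^ 5) ≤
      (150 * d ^ 6 + 200 * (d ^ 7 + (3 + c) * d ^ 5)) * (x : ℝ) ^ 8 := by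
    have p₁ : (D : ℝ) ^ 6 ≤ d ^ 6 * (x : ℝ) ^ 8 := by
      calc _ ≤ (d * x) ^ 6 := by gcongr
        _ = d ^ 6 * (x : ℝ) ^ 6 := mul_pow _ _ _
        _ ≤ _ := mul_le_mul_of_nonneg_left (pow_le_pow_right₀ hx1 (by norm_num)) (by positivity)
    have p₂ : (D : ℝ) ^ 7 ≤ d ^ 7 * (x : ℝ) ^ 8 := by
      calc _ ≤ (d * x) ^ 7 := by gcongr
        _ = d ^ 7 * (x : ℝ) ^ 7 := mul_pow _ _ _
        _ ≤ _ := mul_le_mul_of_nonneg_left (pow_le_pow_right₀ hx1 (by norm_num)) (by positivity)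
    have p₃ : 2 * (x : ℝ) ^ 3 + c * (x : ℝ) ^ 2 + 1 ≤ (3 + c) * (x : ℝ) ^ 3 := by
      have q₁ : (x : ℝ) ^ 2 ≤ (x : ℝ) ^ 3 := pow_le_pow_right₀ hx1 (by norm_num)
      have q₂ : (1 : ℝ) ≤ (x : ℝ) ^ 3 := one_le_pow₀ hx1
      have q₃ := mul_le_mul_of_nonneg_left q₁ (Nat.cast_nonneg (α := ℝ) c)
      linarith
    have p₄ : (2 * (x : ℝ) ^ 3 + c * (x : ℝ) ^ 2 + 1) * (D : ℝ) ^ 5 ≤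
        (3 + c) * d ^ 5 * (x : ℝ) ^ 8 := by
      calc _ ≤ (3 + c) * (x : ℝ) ^ 3 * (d * x) ^ 5 := by gcongr
        _ = _ := by ring
    linarith
  have hlow' : (150 * d ^ 6 + 200 * (d ^ 7 + (3 + c) * d ^ 5)) * (x : ℝ) ^ 8 ≤
      (150 * d ^ 6 + 200 * (d ^ 7 + (3 + c) * d ^ 5)) * (1 + κ₀) * (x : ℝ) ^ 8 := by
    gcongr
    exact le_mul_of_one_le_right (by positivity) (by linarith)
  linear_combination hcost + hmain + hlow + hlow'

end EstimateMinimalOrder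

/-! ### Cost at order `(1 + √17) / 4 * τ + O(1)` -/

section EstimateLargerOrder

/-- For `ρ = (1 + √17) / 4` the sizes of the linear system are quadratic when `r = ρ * t + O(1)`. -/
theorem exists_sizes_le {ρ : ℝ} (hρ1 : 1 < ρ) (hρ : 2 * ρ ^ 2 = ρ + 2) {c : ℝ} (hc : 0 ≤ c)
    (G : ℕ) : ∃ C t₁ : ℝ, 0 ≤ C ∧ ∀ t r : ℕ, t₁ ≤ t → |(r : ℝ) - ρ * t| ≤ c → t ≤ r ∧ 1 ≤ t ∧
      (solutionDegree (t + G) t r 1 : ℝ) ≤ (5 * ρ + 4) * (t : ℝ) ^ 2 + C * t ∧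
      (systemSize t r 1 : ℝ) ≤ ρ * (t : ℝ) ^ 2 + C * t := by
  have hδ : 0 < ρ - 1 := by linarith
  set C₁ : ℝ := 2 * c + 2 + G * (2 * ρ + 2 * c + 2) with hC₁
  have hC₁0 : 0 ≤ C₁ := by positivity
  -- The divisor `r + 1 - t` is only known to be at least `(ρ - 1) * t - c`. This value of `C₂`
  -- absorbs both `C₁` and the loss from `c`, using that `t₁` makes `c` at most half of `(ρ - 1) *
  -- t`.
  set C₂ : ℝ := 2 * (C₁ + c * (4 * ρ ^ 2 + 2 * ρ)) / (ρ - 1) with hC₂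
  have hC₂0 : 0 ≤ C₂ := by positivity
  have hC₂' : C₂ * (ρ - 1) = 2 * (C₁ + c * (4 * ρ ^ 2 + 2 * ρ)) := div_mul_cancel₀ _ hδ.ne'
  set C₃ : ℝ := (c + 1) * (1 + G) + ρ * G with hC₃
  have hC₃0 : 0 ≤ C₃ := by positivity
  refine ⟨C₂ + C₃ + (ρ + 2 * c + 2), 2 * c / (ρ - 1) + 1, by positivity, fun t r ht hr => ?_⟩
  have hr₁ := (abs_le.1 hr).1
  have hr₂ := (abs_le.1 hr).2
  have hq : 0 ≤ 2 * c / (ρ - 1) := by positivity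
  have ht1 : (1 : ℝ) ≤ t := by linarith
  have ht1' : 1 ≤ t := by exact_mod_cast ht1
  have htc : 2 * c ≤ (ρ - 1) * t := by
    have h : 2 * c / (ρ - 1) * (ρ - 1) = 2 * c := div_mul_cancel₀ _ hδ.ne'
    nlinarith
  have htr : (t : ℝ) ≤ r := by nlinarith
  have htr' : t ≤ r := by exact_mod_cast htr
  have hG : (0 : ℝ) ≤ G := Nat.cast_nonneg G
  have ht2 : (t : ℝ) ≤ (t : ℝ) ^ 2 := by nlinarith
  refine ⟨htr', ht1', ?_, ?_⟩
  · have hquot : (((t + G) * ((t - 1 + 1) * (r + 1) + (r * t + 2 - 1)) / (r + 2 - 1 - t) : ℕ) : ℝ) ≤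
        (4 * ρ ^ 2 + 2 * ρ) * (t : ℝ) ^ 2 + C₂ * t := by
      rw [show t - 1 + 1 = t by omega, show r * t + 2 - 1 = r * t + 1 by omega,
        show r + 2 - 1 - t = r + 1 - t by omega]
      refine Nat.cast_div_le.trans ?_
      have hden : ((r + 1 - t : ℕ) : ℝ) = r + 1 - t := by
        rw [Nat.cast_sub (by omega)]
        push_cast
        ring
      rw [hden, div_le_iff₀ (by linarith)]
      push_cast
      have e₁ : ((t : ℝ) + G) * (t * (r + 1) + (r * t + 1)) ≤ 2 * ρ * (t : ℝ) ^ 3 + C₁ * (t : ℝ) ^ 2 := by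
        have f₁ : (t : ℝ) * (r + 1) + (r * t + 1) ≤ 2 * ρ * (t : ℝ) ^ 2 + (2 * c + 2) * t := by
          nlinarith
        calc _ ≤ ((t : ℝ) + G) * (2 * ρ * (t : ℝ) ^ 2 + (2 * c + 2) * t) := by gcongr
          _ = 2 * ρ * (t : ℝ) ^ 3 + (2 * c + 2) * (t : ℝ) ^ 2 + G * (2 * ρ * (t : ℝ) ^ 2) +
              G * (2 * c + 2) * t := by ring
          _ ≤ 2 * ρ * (t : ℝ) ^ 3 + (2 * c + 2) * (t : ℝ) ^ 2 + G * (2 * ρ * (t : ℝ) ^ 2) +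
              G * (2 * c + 2) * (t : ℝ) ^ 2 := by gcongr
          _ = _ := by rw [hC₁]; ring
      refine e₁.trans ?_
      have e₂ : (ρ - 1) * t - c ≤ (r : ℝ) + 1 - t := by nlinarith
      calc 2 * ρ * (t : ℝ) ^ 3 + C₁ * (t : ℝ) ^ 2 ≤
          ((4 * ρ ^ 2 + 2 * ρ) * (t : ℝ) ^ 2 + C₂ * t) * ((ρ - 1) * t - c) := by
            -- By the equation for `ρ`, the leading coefficient `2 * ρ / (ρ - 1)` of the quotient is
            -- the polynomial `4 * ρ ^ 2 + 2 * ρ`; adding `ρ` from `(r + 1) * a` gives `5 * ρ + 4`.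
            have f₁ : (4 * ρ ^ 2 + 2 * ρ) * (ρ - 1) = 2 * ρ := by
              linear_combination (2 * ρ) * hρ
            have f₂ : 0 ≤ C₂ * t * ((ρ - 1) * t - 2 * c) :=
              mul_nonneg (by positivity) (by linarith)
            linear_combination f₂ / 2 - (t : ℝ) ^ 3 * f₁ - (t : ℝ) ^ 2 / 2 * hC₂'
        _ ≤ _ := by gcongr
    have hrest : ((r : ℝ) + 1) * (t + G) ≤ ρ * (t : ℝ) ^ 2 + C₃ * t := by
      have : (r : ℝ) + 1 ≤ ρ * t + (c + 1) := by linarith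
      calc _ ≤ (ρ * t + (c + 1)) * ((t : ℝ) + G) := by gcongr
        _ = ρ * (t : ℝ) ^ 2 + (c + 1 + ρ * G) * t + (c + 1) * G := by ring
        _ ≤ ρ * (t : ℝ) ^ 2 + (c + 1 + ρ * G) * t + (c + 1) * G * t := by
          have : (c + 1) * G ≤ (c + 1) * G * t := le_mul_of_one_le_right (by positivity) ht1
          linarith
        _ = _ := by rw [hC₃]; ring
    rw [solutionDegree]
    push_cast at hquot ⊢
    have hextra : 0 ≤ (ρ + 2 * c + 2) * (t : ℝ) := by positivity
    linear_combination hquot + hrest + hextra + (2 * (t : ℝ) ^ 2) * hρ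
  · have : (systemSize t r 1 : ℝ) = r + 1 + (r * t + 1) := by
      rw [systemSize, show r * t + 2 - 1 = r * t + 1 by omega]
      push_cast
      ring
    rw [this]
    have hextra : 0 ≤ (C₂ + C₃) * (t : ℝ) := by positivity
    have f₁ : (r : ℝ) * t ≤ (ρ * t + c) * t := by gcongr; linarith
    nlinarith

/-- Here `t` is the value on trial and `x` is `τ`. Both are within `c / ρ` of `r / ρ`, hence differ
by at most `2 * c`, which changes the sizes only by linear terms. The constant `11` works because `ρ
≤ 1.3` gives `5 * ρ + 4 ≤ 10.5`. -/
theorem exists_sizes_le_of_near {ρ : ℝ} (hρ1 : 1 < ρ) (hρ : 2 * ρ ^ 2 = ρ + 2) {c : ℝ}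
    (hc : 0 ≤ c) (G : ℕ) : ∃ C x₀ : ℝ, 0 ≤ C ∧ ∀ t r x : ℕ, x₀ ≤ x → |(r : ℝ) - ρ * t| ≤ c →
      |(r : ℝ) - ρ * x| ≤ c → t ≤ r ∧ 1 ≤ x ∧
      (solutionDegree (t + G) t r 1 : ℝ) ≤ (5 * ρ + 4) * (x : ℝ) ^ 2 + C * x ∧
      (systemSize t r 1 : ℝ) ≤ ρ * (x : ℝ) ^ 2 + C * x ∧
      solutionDegree (t + G) t r 1 ≤ 11 * x ^ 2 ∧ systemSize t r 1 ≤ 11 * x ^ 2 := by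
  obtain ⟨C₁, t₁, hC₁, h₁⟩ := exists_sizes_le hρ1 hρ hc G
  have hρ2 : ρ ≤ 1.3 := by nlinarith
  set C₂ : ℝ := (5 * ρ + 4) * (4 * c + 4 * c ^ 2) + C₁ * (1 + 2 * c) with hC₂
  have hC₂0 : 0 ≤ C₂ := by positivity
  refine ⟨C₂, max (t₁ + 2 * c) (2 * C₂ + 1), hC₂0, fun t r x hx₀' hrt hrx => ?_⟩
  have hx₁ : t₁ + 2 * c ≤ x := (le_max_left _ _).trans hx₀'
  have hx₂ : 2 * C₂ + 1 ≤ x := (le_max_right _ _).trans hx₀'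
  have hx1 : (1 : ℝ) ≤ x := by linarith
  have hdiff : |(t : ℝ) - x| ≤ 2 * c := by
    rw [abs_le] at *
    constructor <;> by_contra! hcon <;> nlinarith
  have ht₁ := (abs_le.1 hdiff).1
  have ht₂ := (abs_le.1 hdiff).2
  obtain ⟨htr, ht1, hn, hm⟩ := h₁ t r (by linarith) hrt
  have htx : (t : ℝ) ≤ x + 2 * c := by linarith
  have ht0 : (0 : ℝ) ≤ t := Nat.cast_nonneg t
  have hlin : C₁ * (t : ℝ) ≤ C₁ * (1 + 2 * c) * x := by
    calc _ ≤ C₁ * (x + 2 * c) := by gcongr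
      _ ≤ C₁ * (x + 2 * c * x) := by
        have : 2 * c ≤ 2 * c * x := le_mul_of_one_le_right (by positivity) hx1
        gcongr
      _ = _ := by ring
  have hsq : (t : ℝ) ^ 2 ≤ (x : ℝ) ^ 2 + (4 * c + 4 * c ^ 2) * x := by
    calc (t : ℝ) ^ 2 ≤ (x + 2 * c) ^ 2 := by gcongr
      _ = (x : ℝ) ^ 2 + 4 * c * x + 4 * c ^ 2 := by ring
      _ ≤ (x : ℝ) ^ 2 + 4 * c * x + 4 * c ^ 2 * x := by
        have : 4 * c ^ 2 ≤ 4 * c ^ 2 * x := le_mul_of_one_le_right (by positivity) hx1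
        linarith
      _ = _ := by ring
  have hn' : (solutionDegree (t + G) t r 1 : ℝ) ≤ (5 * ρ + 4) * (x : ℝ) ^ 2 + C₂ * x := by
    have := mul_le_mul_of_nonneg_left hsq (show 0 ≤ 5 * ρ + 4 by positivity)
    linear_combination hn + this + hlin
  have hm' : (systemSize t r 1 : ℝ) ≤ ρ * (x : ℝ) ^ 2 + C₂ * x := by
    have e₁ := mul_le_mul_of_nonneg_left hsq (show 0 ≤ ρ by positivity)
    have e₂ : 0 ≤ (4 * ρ + 4) * ((4 * c + 4 * c ^ 2) * x) := by positivity
    linear_combination hm + e₁ + hlin + e₂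
  have hx0 : (0 : ℝ) ≤ x := by linarith
  have hcx : C₂ * x ≤ (x : ℝ) ^ 2 / 2 := by nlinarith
  have hx2 := sq_nonneg (x : ℝ)
  refine ⟨htr, by exact_mod_cast hx1, hn', hm', ?_, ?_⟩
  · have : (solutionDegree (t + G) t r 1 : ℝ) ≤ ((11 * x ^ 2 : ℕ) : ℝ) := by
      have := mul_le_mul_of_nonneg_right (show 5 * ρ + 4 ≤ 10.5 by linarith) hx2
      push_cast
      linarith
    exact_mod_cast this
  · have : (systemSize t r 1 : ℝ) ≤ ((11 * x ^ 2 : ℕ) : ℝ) := by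
      have := mul_le_mul_of_nonneg_right hρ2 hx2
      push_cast
      linarith
    exact_mod_cast this

theorem exists_cost_le_of_order_near {κ : ℕ → ℝ} (hmono : Monotone κ)
    (h0 : ∀ s, 1 ≤ s → 0 ≤ κ s) {ρ : ℝ} (hρ1 : 1 < ρ) (hρ : 2 * ρ ^ 2 = ρ + 2) {c : ℝ}
    (hc : 0 ≤ c) (G : ℕ) : ∃ (C : ℝ) (x₀ : ℕ), ∀ t r x D : ℕ,
      x₀ ≤ x → |(r : ℝ) - ρ * t| ≤ c → |(r : ℝ) - ρ * x| ≤ c → D = r + G + 2 → t ≤ r ∧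
      (2 * c + 1) * (75 * (D : ℝ) ^ 6) + telescoperCost κ (t + G) t r 1 D ≤
        (5 * ρ + 4) * ρ ^ 3 * κ (11 * x ^ 2) * (x : ℝ) ^ 8 +
          C * (1 + κ (11 * x ^ 2)) * (x : ℝ) ^ 7 := by
  obtain ⟨C₂, x₀, hC₂0, h₁⟩ := exists_sizes_le_of_near hρ1 hρ hc G
  obtain ⟨C₃, hC₃, h₃⟩ := exists_mul_pow_le (A := 5 * ρ + 4) (ρ := ρ) (c := C₂) (by positivity)
    (by positivity) hC₂0
  set d : ℝ := ρ + c + G + 2 with hd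
  have hd0 : 0 ≤ d := by positivity
  refine ⟨C₃ + ((2 * c + 1) * 75 * d ^ 6 + 200 * (d ^ 7 + (5 * ρ + 5 + C₂) * d ^ 5)),
    ⌈x₀⌉₊, fun t r x D hx₀ hrt hrx hD => ?_⟩
  obtain ⟨htr, hx1', hn', hm', hns, hms⟩ :=
    h₁ t r x ((Nat.le_ceil _).trans (by exact_mod_cast hx₀)) hrt hrx
  refine ⟨htr, ?_⟩
  have hx1 : (1 : ℝ) ≤ x := by exact_mod_cast hx1'
  have hcost := telescoperCost_le (κ := κ) hmono h0 (D := D) hn' hm' hns hms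
  set κ₀ := κ (11 * x ^ 2) with hκ₀
  have hκ₀0 : 0 ≤ κ₀ := h0 _ (Nat.mul_pos (by norm_num) (pow_pos hx1' 2))
  have hmain := mul_le_mul_of_nonneg_right (h₃ x hx1) hκ₀0
  have hDd : (D : ℝ) ≤ d * x := by
    have := (abs_le.1 hrx).2
    have hG : (0 : ℝ) ≤ G := Nat.cast_nonneg G
    have e₁ : (c + G + 2) ≤ (c + G + 2) * x := le_mul_of_one_le_right (by positivity) hx1
    rw [hD, hd]
    push_cast
    linarith
  have hlow : (2 * c + 1) * (75 * (D : ℝ) ^ 6) + 200 * ((D : ℝ) ^ 7 +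
      ((5 * ρ + 4) * (x : ℝ) ^ 2 + C₂ * x + 1) * (D : ℝ) ^ 5) ≤
      ((2 * c + 1) * 75 * d ^ 6 + 200 * (d ^ 7 + (5 * ρ + 5 + C₂) * d ^ 5)) * (x : ℝ) ^ 7 := by
    have p₁ : (D : ℝ) ^ 6 ≤ d ^ 6 * (x : ℝ) ^ 7 := by
      calc _ ≤ (d * x) ^ 6 := by gcongr
        _ = d ^ 6 * (x : ℝ) ^ 6 := mul_pow _ _ _
        _ ≤ _ := mul_le_mul_of_nonneg_left (pow_le_pow_right₀ hx1 (by norm_num)) (by positivity)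
    have p₂ : (D : ℝ) ^ 7 ≤ d ^ 7 * (x : ℝ) ^ 7 := by
      calc _ ≤ (d * x) ^ 7 := by gcongr
        _ = d ^ 7 * (x : ℝ) ^ 7 := mul_pow _ _ _
    have p₃ : (5 * ρ + 4) * (x : ℝ) ^ 2 + C₂ * x + 1 ≤ (5 * ρ + 5 + C₂) * (x : ℝ) ^ 2 := by
      have q₁ : (x : ℝ) ≤ (x : ℝ) ^ 2 := by nlinarith
      have q₂ : (1 : ℝ) ≤ (x : ℝ) ^ 2 := one_le_pow₀ hx1
      have q₃ := mul_le_mul_of_nonneg_left q₁ hC₂0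
      linarith
    have p₄ : ((5 * ρ + 4) * (x : ℝ) ^ 2 + C₂ * x + 1) * (D : ℝ) ^ 5 ≤
        (5 * ρ + 5 + C₂) * d ^ 5 * (x : ℝ) ^ 7 := by
      calc _ ≤ (5 * ρ + 5 + C₂) * (x : ℝ) ^ 2 * (d * x) ^ 5 := by gcongr
        _ = _ := by ring
    have p₅ := mul_le_mul_of_nonneg_left p₁ (show 0 ≤ (2 * c + 1) * 75 by positivity)
    linear_combination p₅ + 200 * p₂ + 200 * p₄
  have hlow' : ((2 * c + 1) * 75 * d ^ 6 + 200 * (d ^ 7 + (5 * ρ + 5 + C₂) * d ^ 5)) * (x : ℝ) ^ 7 ≤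
      ((2 * c + 1) * 75 * d ^ 6 + 200 * (d ^ 7 + (5 * ρ + 5 + C₂) * d ^ 5)) * (1 + κ₀) *
        (x : ℝ) ^ 7 := by
    gcongr
    exact le_mul_of_one_le_right (by positivity) (by linarith)
  have hC₃' : 0 ≤ C₃ * (x : ℝ) ^ 7 := by positivity
  linear_combination hcost + hmain + hlow + hlow' + hC₃'

end EstimateLargerOrder

/-! ## The computation trees -/

section MainTheorem

variable {K : Type u} [Field K] {L : ℕ}

/-- The possible inputs are the terms satisfying `P`, so that hypotheses on the term that no zero
test can see are usable in the description of the program. -/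
theorem exists_findsCTRelation {r N : ℕ} {P : HypTerm K L → Prop}
    (h : Reach (RelationFound.{u, v} (fun ω : {H // P H} => ω.1) r) N Set.univ
      (initialFunctions fun ω : {H // P H} => ω.1.value)) :
    ∃ T : CompTree K (HypInput L) (HypOutput r), ∀ H, P H → ∀ B : ℝ, (N : ℝ) ≤ B →
      CompTree.FindsCTRelation.{u, v} T H B := by
  obtain ⟨T, hT⟩ := Reach.exists_tree (fun ω : {H // P H} => ω.1.value)
    (fun ω res => ∃ p f g, g ≠ 0 ∧ res = HypOutput.value p f g ∧
      HypTerm.HasRelation.{u, v} ω.1 r p f g) h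
  refine ⟨T, fun H hH B hB => ?_⟩
  obtain ⟨_, ⟨n, hrun, hn⟩, p, f, g, hg, rfl, hrel⟩ := hT ⟨H, hH⟩
  exact ⟨p, f, g, hg, ⟨n, hrun, hn.trans hB⟩, hrel⟩

theorem hasFormat_subtype {F : HypFormat L} {P : HypTerm K L → Prop} (h : ∀ H, P H → H.format = F) :
    HasFormat (fun ω : {H // P H} => ω.1) F :=
  ⟨fun ω => h ω.1 ω.2⟩

theorem HypTerm.degX_a_le {H : HypTerm K L} {F : HypFormat L} {B : ℤ} (hF : H.format = F)
    (hB : H.beta ≤ B) : F.a.1 ≤ F.b.1 + (B + 1).toNat := by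
  rw [← hF]
  have := Int.self_le_toNat (B + 1)
  rw [HypTerm.beta] at hB
  simp only [HypTerm.format]
  omega

theorem HypTerm.phi₃_le_one (H : HypTerm K L) : H.phi₃ ≤ 1 := by
  rw [HypTerm.phi₃]
  split_ifs <;> omega

variable [CharZero K] {κ : ℕ → ℝ}

/-- Relations of order `τ - 1 + φ₃`. -/
theorem exists_tree_of_order_eq (hκ_mono : Monotone κ) (hκ_sublinear : Sublinear κ)
    (hκ_solve : SolvesLinearSystems K κ) (B : ℤ) :
    ∃ C : ℝ, ∀ (L : ℕ) (F : HypFormat L) (r : ℕ),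
      ∃ T : CompTree K (HypInput L) (HypOutput r),
        ∀ H : HypTerm K L, H.format = F → H.beta ≤ B →
          (H.phi₃ = 0 → H.Normalized) → r + 1 = H.tau + H.phi₃ →
          CompTree.FindsCTRelation.{u, v} T H
            (2 * κ (2 * H.tau ^ 3) * (H.tau : ℝ) ^ 9
              + C * (1 + κ (2 * H.tau ^ 3)) * (H.tau : ℝ) ^ 8) := by
  set G := (B + 1).toNat with hG
  obtain ⟨C, hC⟩ := exists_cost_le_of_order_eq hκ_mono hκ_sublinear
    (fun s hs => hκ_solve.nonneg hs) G
  refine ⟨C, fun L F r => ?_⟩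
  let P : HypTerm K L → Prop := fun H => H.format = F ∧ H.beta ≤ B ∧
    (H.phi₃ = 0 → H.Normalized) ∧ r + 1 = H.tau + H.phi₃
  by_cases hex : ∃ H, P H
  swap
  -- No term satisfies the conditions, so any tree will do.
  · exact ⟨.output fun _ => .const 0, fun H h₁ h₂ h₃ h₄ => (hex ⟨H, h₁, h₂, h₃, h₄⟩).elim⟩
  obtain ⟨H₀, hH₀⟩ := hex
  have hFG := HypTerm.degX_a_le hH₀.1 hH₀.2.1
  rw [← hG] at hFG
  set D := r + G + 3 with hD
  have hF := hasFormat_subtype (P := P) (F := F) fun H h => h.1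
  have hk := knownTerm_initialFunctions fun ω : {H // P H} => ω.1
  set M := max (telescoperCost κ (r + G) r r 1 D) (telescoperCost κ (r + 1 + G) (r + 1) r 0 D)
    with hM
  have hreach : Reach (RelationFound.{u, v} (fun ω : {H // P H} => ω.1) r)
      (75 * D ^ 6 + (75 * D ^ 6 + M)) Set.univ (initialFunctions fun ω : {H // P H} => ω.1.value) := by
    -- The first trial is for `τ ≤ r`. If it fails, `r + 1 = τ + φ₃` leaves only `φ₃ = 0` and `τ = r
    -- + 1`; thus `φ₃` never has to be computed.
    refine hF.reach_trial hκ_solve hk hFG (t := r) (ε := 1) (by omega) (by omega)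
      (Or.inl ⟨rfl, le_rfl⟩) ((le_max_left _ _).trans (Nat.le_add_left _ _))
      fun S₁ V₁ _ hV₁ h₁ => ?_
    have hφ : ∀ ω ∈ S₁, ω.1.phi₃ = 0 := by
      intro ω hω
      have := h₁ ω hω
      have := ω.2.2.2.2
      have := ω.1.phi₃_le_one
      omega
    refine hF.reach_trial hκ_solve (hk.mono hV₁) hFG (t := r + 1) (ε := 0) (by omega) (by omega)
      (Or.inr ⟨rfl, le_rfl, fun ω hω => ⟨ω.2.2.2.1 (hφ ω hω), hφ ω hω⟩⟩) (le_max_right _ _)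
      fun S₂ V₂ _ hV₂ h₂ => Reach.mono_cost (.done (.of_empty ((hk.mono hV₁).mono hV₂).consts _ _
        fun ω hω => ?_)) (Nat.zero_le _)
    have := h₂ ω hω
    have := ω.2.2.2.2
    omega
  obtain ⟨T, hT⟩ := exists_findsCTRelation hreach
  refine ⟨T, fun H h₁ h₂ h₃ h₄ => hT H ⟨h₁, h₂, h₃, h₄⟩ _ ?_⟩
  have hr : r ≤ H.tau := by
    have := H.phi₃_le_one
    omega
  have e : ((75 * D ^ 6 + (75 * D ^ 6 + M) : ℕ) : ℝ) = 150 * (D : ℝ) ^ 6 + M := by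
    push_cast
    ring
  rw [e]
  rcases max_choice (telescoperCost κ (r + G) r r 1 D) (telescoperCost κ (r + 1 + G) (r + 1) r 0 D)
    with h | h
  · rw [hM, h]
    exact hC r r 1 H.tau D (Or.inl ⟨rfl, rfl⟩) H.one_le_tau hr hD
  · rw [hM, h]
    exact hC (r + 1) r 0 H.tau D (Or.inr ⟨rfl, rfl⟩) H.one_le_tau hr hD

/-- Relations of order `ρ * τ + O(1)` for `ρ = (1 + √17) / 4`. -/
theorem exists_tree_of_order_near (hκ_mono : Monotone κ) (hκ_solve : SolvesLinearSystems K κ)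
    {ρ : ℝ} (hρ1 : 1 < ρ) (hρ : 2 * ρ ^ 2 = ρ + 2) (B : ℤ) {c : ℝ} (hc : 0 ≤ c) :
    ∃ (C : ℝ) (τ₀ : ℕ), ∀ (L : ℕ) (F : HypFormat L) (r : ℕ),
        ∃ T : CompTree K (HypInput L) (HypOutput r),
          ∀ H : HypTerm K L, H.format = F → H.beta ≤ B → τ₀ ≤ H.tau →
            |(r : ℝ) - ρ * (H.tau : ℝ)| ≤ c →
            CompTree.FindsCTRelation.{u, v} T H
              ((5 * ρ + 4) * ρ ^ 3 * κ (11 * H.tau ^ 2) * (H.tau : ℝ) ^ 8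
                + C * (1 + κ (11 * H.tau ^ 2)) * (H.tau : ℝ) ^ 7) := by
  set G := (B + 1).toNat with hG
  obtain ⟨C, τ₀, hC⟩ := exists_cost_le_of_order_near hκ_mono
    (fun s hs => hκ_solve.nonneg hs) hρ1 hρ hc G
  refine ⟨C, τ₀, fun L F r => ?_⟩
  let P : HypTerm K L → Prop := fun H => H.format = F ∧ H.beta ≤ B ∧ τ₀ ≤ H.tau ∧
    |(r : ℝ) - ρ * (H.tau : ℝ)| ≤ c
  by_cases hex : ∃ H, P H
  swap
  · exact ⟨.output fun _ => .const 0, fun H h₁ h₂ h₃ h₄ => (hex ⟨H, h₁, h₂, h₃, h₄⟩).elim⟩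
  obtain ⟨H₀, hH₀⟩ := hex
  have hFG := HypTerm.degX_a_le hH₀.1 hH₀.2.1
  rw [← hG] at hFG
  set D := r + G + 2 with hD
  have hρ0 : 0 < ρ := by linarith
  -- The natural numbers from `t₀` to `t₁` are those `t` with `|r - ρ * t| ≤ c`, the candidates for
  -- `τ`.
  set t₀ := ⌈((r : ℝ) - c) / ρ⌉₊ with ht₀
  set t₁ := ⌊((r : ℝ) + c) / ρ⌋₊ with ht₁
  have ht₁' : (t₁ : ℝ) ≤ (r + c) / ρ := Nat.floor_le (by positivity)
  have ht₀' : ((r : ℝ) - c) / ρ ≤ t₀ := Nat.le_ceil _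
  have hτ : ∀ H, P H → t₀ ≤ H.tau ∧ H.tau ≤ t₁ := by
    intro H hH
    obtain ⟨h₁, h₂⟩ := abs_le.1 hH.2.2.2
    constructor
    · refine Nat.ceil_le.2 ((div_le_iff₀ hρ0).2 ?_)
      linarith
    · refine Nat.le_floor ((le_div_iff₀ hρ0).2 ?_)
      linarith
  obtain ⟨k, hk⟩ := Nat.exists_eq_add_of_le ((hτ H₀ hH₀).1.trans (hτ H₀ hH₀).2)
  have ht : ∀ t, t₀ ≤ t → t ≤ t₁ → |(r : ℝ) - ρ * (t : ℝ)| ≤ c := by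
    intro t h₁ h₂
    have h₁' : ((r : ℝ) - c) / ρ ≤ t := ht₀'.trans (by exact_mod_cast h₁)
    have h₂' : (t : ℝ) ≤ (r + c) / ρ := le_trans (by exact_mod_cast h₂) ht₁'
    rw [div_le_iff₀ hρ0] at h₁'
    rw [le_div_iff₀ hρ0] at h₂'
    rw [abs_le]
    constructor <;> linarith
  have hbound : ∀ H, P H → ∀ t, t₀ ≤ t → t ≤ t₁ → _ := fun H hH t h₁ h₂ =>
    hC t r H.tau D hH.2.2.1 (ht t h₁ h₂) hH.2.2.2 hD
  have htr : t₁ ≤ r := (hbound H₀ hH₀ t₁ (by omega) le_rfl).1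
  -- The number of trials is bounded independently of `τ`, so all of them together stay within the
  -- error term.
  have hkc : (k : ℝ) ≤ 2 * c := by
    have e₁ : (t₁ : ℝ) = t₀ + k := by exact_mod_cast hk
    have e₂ : (k : ℝ) ≤ 2 * c / ρ := by
      have : (r + c) / ρ = (r - c) / ρ + 2 * c / ρ := by ring
      linarith
    exact e₂.trans (div_le_self (by positivity) hρ1.le)
  set f : ℕ → ℕ := fun t => telescoperCost κ (t + G) t r 1 D with hf
  obtain ⟨t', ht', hM⟩ := Finset.exists_mem_eq_sup (Finset.Icc t₀ t₁)
    ⟨t₀, Finset.mem_Icc.2 ⟨le_rfl, by omega⟩⟩ f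
  have hF := hasFormat_subtype (P := P) (F := F) fun H h => h.1
  have hreach := hF.reach_trials.{u, v} hκ_solve (D := D) (r := r)
    (N := (Finset.Icc t₀ t₁).sup f) hFG (by omega) k (t := t₀) (S := Set.univ)
    (knownTerm_initialFunctions fun ω : {H // P H} => ω.1) (by omega) (by omega)
    (fun t h₁ h₂ => Finset.le_sup (f := f) (Finset.mem_Icc.2 ⟨h₁, by omega⟩))
    fun ω _ => hk ▸ (hτ ω.1 ω.2).2
  obtain ⟨T, hT⟩ := exists_findsCTRelation hreach
  refine ⟨T, fun H h₁ h₂ h₃ h₄ => hT H ⟨h₁, h₂, h₃, h₄⟩ _ ?_⟩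
  rw [Finset.mem_Icc] at ht'
  refine le_trans ?_ (hbound H ⟨h₁, h₂, h₃, h₄⟩ t' ht'.1 ht'.2).2
  rw [hM]
  push_cast
  gcongr

/-- Relations in polynomial time. -/
theorem exists_tree_polynomial (hκ_mono : Monotone κ) (hκ_sublinear : Sublinear κ)
    (hκ_solve : SolvesLinearSystems K κ) :
    ∃ (C : ℝ) (k : ℕ), ∀ (L : ℕ) (F : HypFormat L), ∃ (r : ℕ)
      (T : CompTree K (HypInput L) (HypOutput r)),
        ∀ H : HypTerm K L, H.format = F →
          CompTree.FindsCTRelation.{u, v} T H (C * (max H.tau (degX H.a) : ℕ) ^ k) := by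
  have h0 : ∀ s, 1 ≤ s → 0 ≤ κ s := fun s hs => hκ_solve.nonneg hs
  obtain ⟨A, hA, hAκ⟩ := hκ_sublinear.exists_le_mul hκ_mono h0
  -- With `κ s ≤ A * s` the solver takes at most `2D³ * (D²)³ * A * 2D³ = 4A * D ^ 12` operations;
  -- `862 = 62 + 200 + 400 + 200` collects the remaining powers of `D`.
  refine ⟨(4 * A + 862) * 9 ^ 12, 12, fun L F => ?_⟩
  -- This leaves room for `b` itself as denominator `z` of its logarithmic derivatives, so `t`
  -- depends only on the format and no trial is needed.
  set t := F.b.1 + F.sizeX + (F.b.2 + F.sizeY) + F.c₀.1 + F.c₀.2 with ht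
  set G := F.a.1 with hG
  set D := t + G + 2 with hD
  refine ⟨t, ?_⟩
  let P : HypTerm K L → Prop := fun H => H.format = F
  by_cases hex : ∃ H, P H
  swap
  · exact ⟨.output fun _ => .const 0, fun H h => (hex ⟨H, h⟩).elim⟩
  obtain ⟨H₀, hH₀⟩ := hex
  have h1 : 1 ≤ F.sizeY := by
    have := H₀.one_le_sizeY
    rwa [hH₀] at this
  have hF := hasFormat_subtype (P := P) (F := F) fun H h => h
  have hk := knownTerm_initialFunctions fun ω : {H // P H} => ω.1
  have hsq : (F.b.1 + 1) * (F.b.2 + 1) ≤ D ^ 2 := mul_succ_le_sq (by omega) (by omega)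
  have hb : ∀ ω : {H // P H}, DegLE ω.1.b (t - F.sizeX) (t - F.sizeY) := fun ω =>
    (hF.b ω).mono (by omega) (by omega)
  have hreach : Reach (RelationFound.{u, v} (fun ω : {H // P H} => ω.1) t)
      (62 * D ^ 6 + telescoperCost κ (t + G) t t 1 D) Set.univ
      (initialFunctions fun ω : {H // P H} => ω.1.value) := by
    refine Reach.mono_cost ((slp_derivation (Or.inl rfl) hk.consts hF.b hk.b).reach
      fun V₁ s₁ k₁ => (slp_derivation (Or.inr rfl) (hk.mono s₁).consts hF.b (hk.mono s₁).b).reach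
        fun V₂ s₂ k₂ => hF.reach_relationFound hκ_solve ((hk.mono s₁).mono s₂) (G := G) (r := t)
          (t := t) (D := D) (ε := 1) (by omega) (by omega) (by omega) (by omega) (by omega)
          (by omega) (by omega) (by omega) hb (fun ω => (hb ω).derivation (Or.inl rfl))
          (fun ω => (hb ω).derivation (Or.inr rfl))
          (fun ω => degree_lt_mono (degree_dY_lt (hF.b ω).natDegree) (by omega))
          ((hk.mono s₁).mono s₂).b (k₁.trans s₂) k₂ (fun ω _ => ⟨ω.1.b_ne, rfl, rfl⟩)
          (Or.inl ⟨rfl, le_rfl⟩)) ?_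
    have : D ^ 2 ≤ D ^ 6 := Nat.pow_le_pow_right (by omega) (by omega)
    rw [telescoperCost]
    omega
  obtain ⟨T, hT⟩ := exists_findsCTRelation hreach
  refine ⟨T, fun H hH => hT H hH _ ?_⟩
  obtain ⟨hn, hm⟩ := sizes_of_order_eq t G t 1 (Or.inl ⟨rfl, rfl⟩)
  have hn' : solutionDegree (t + G) t t 1 ≤ 2 * D ^ 3 := by
    have e : 2 * (t + 1) ^ 2 + 1 ≤ 2 * D ^ 2 := by nlinarith
    calc _ ≤ D * (2 * D ^ 2) := hn.trans (Nat.mul_le_mul (by omega) e)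
      _ = 2 * D ^ 3 := by ring
  have hm' : systemSize t t 1 ≤ D ^ 2 := by nlinarith
  have hD1 : (1 : ℝ) ≤ D := by
    have : 1 ≤ D := by omega
    exact_mod_cast this
  have hms : systemSize t t 1 ≤ 2 * D ^ 3 := by
    have : D ^ 2 ≤ D ^ 3 := Nat.pow_le_pow_right (by omega) (by omega)
    omega
  have hcost := telescoperCost_le hκ_mono h0 (D := D) (x := 2 * (D : ℝ) ^ 3) (y := (D : ℝ) ^ 2)
    (by exact_mod_cast hn') (by exact_mod_cast hm') hn' hms
  have hκD := hAκ (2 * D ^ 3) (Nat.mul_pos two_pos (pow_pos (by omega) 3))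
  push_cast at hκD
  have hmain := mul_le_mul_of_nonneg_left hκD
    (show 0 ≤ 2 * (D : ℝ) ^ 3 * ((D : ℝ) ^ 2) ^ 3 by positivity)
  have hpow : ∀ i ≤ 12, (D : ℝ) ^ i ≤ (D : ℝ) ^ 12 := fun i hi => pow_le_pow_right₀ hD1 hi
  -- The six summands of `t` are at most `τ` each, and `D` adds `deg_x a` and `2 ≤ 2 * τ`.
  have hDM : (D : ℝ) ≤ 9 * (max H.tau (degX H.a) : ℕ) := by
    have e₁ := H.le_tau
    have e₂ := H.alpha_eq
    have e₃ := H.gamma_eq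
    have e₄ := H.one_le_tau
    have e₅ : degX H.a = F.a.1 := by rw [← hH]; rfl
    rw [hH] at e₁ e₂ e₃
    have e₆ : F.b.1 ≤ F.sizeX := Nat.le_add_right _ _
    have e₇ : F.b.2 ≤ F.sizeY := (le_max_right _ _).trans (Nat.le_add_right _ _)
    have : D ≤ 9 * max H.tau (degX H.a) := by omega
    exact_mod_cast this
  calc ((62 * D ^ 6 + telescoperCost κ (t + G) t t 1 D : ℕ) : ℝ)
      ≤ (4 * A + 862) * (D : ℝ) ^ 12 := by
        push_cast
        linear_combination hcost + hmain + 62 * hpow 6 (by norm_num) + 200 * hpow 7 (by norm_num) +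
          400 * hpow 8 (by norm_num) + 200 * hpow 5 (by norm_num)
    _ ≤ (4 * A + 862) * (9 * (max H.tau (degX H.a) : ℕ)) ^ 12 := by gcongr
    _ = _ := by rw [mul_pow, mul_assoc]

end MainTheorem

theorem mainTheorem3 {K : Type u} [Field K] [CharZero K] (κ : ℕ → ℝ)
    (hκ_mono : Monotone κ) (hκ_sublinear : Sublinear κ) (hκ_solve : SolvesLinearSystems K κ) :
    -- order `τ - 1 + φ₃`
    (∀ B : ℤ, ∃ C : ℝ, ∀ (L : ℕ) (F : HypFormat L) (r : ℕ),
      ∃ T : CompTree K (HypInput L) (HypOutput r),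
        ∀ H : HypTerm K L, H.format = F → H.beta ≤ B →
          (H.phi₃ = 0 → H.Normalized) → r + 1 = H.tau + H.phi₃ →
          CompTree.FindsCTRelation.{u, v} T H
            (2 * κ (2 * H.tau ^ 3) * (H.tau : ℝ) ^ 9
              + C * (1 + κ (2 * H.tau ^ 3)) * (H.tau : ℝ) ^ 8)) ∧
    -- order `(1 + √17) / 4 * τ + O(1)`
    ((1 + Real.sqrt 17) / 4 ≤ 1.281 ∧ (349 + 85 * Real.sqrt 17) / 32 ≤ 21.86 ∧
      ∀ (B : ℤ) (c : ℝ), ∃ (C : ℝ) (τ₀ : ℕ), ∀ (L : ℕ) (F : HypFormat L) (r : ℕ),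
        ∃ T : CompTree K (HypInput L) (HypOutput r),
          ∀ H : HypTerm K L, H.format = F → H.beta ≤ B → τ₀ ≤ H.tau →
            |(r : ℝ) - (1 + Real.sqrt 17) / 4 * (H.tau : ℝ)| ≤ c →
            CompTree.FindsCTRelation.{u, v} T H
              ((349 + 85 * Real.sqrt 17) / 32 * κ (11 * H.tau ^ 2) * (H.tau : ℝ) ^ 8
                + C * (1 + κ (11 * H.tau ^ 2)) * (H.tau : ℝ) ^ 7)) ∧
    -- polynomial time
    (∃ (C : ℝ) (k : ℕ), ∀ (L : ℕ) (F : HypFormat L), ∃ (r : ℕ)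
      (T : CompTree K (HypInput L) (HypOutput r)),
        ∀ H : HypTerm K L, H.format = F →
          CompTree.FindsCTRelation.{u, v} T H (C * (max H.tau (degX H.a) : ℕ) ^ k)) := by
  have hs : Real.sqrt 17 ^ 2 = 17 := Real.sq_sqrt (by norm_num)
  have hs₁ : Real.sqrt 17 ≤ 4.1232 := Real.sqrt_le_iff.2 (by norm_num)
  have hs₂ : 4 ≤ Real.sqrt 17 := Real.le_sqrt_of_sq_le (by norm_num)
  set ρ := (1 + Real.sqrt 17) / 4 with hρ
  have hρ₂ : 2 * ρ ^ 2 = ρ + 2 := by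
    rw [hρ]
    linear_combination hs / 8
  -- The right side is reduced to a linear polynomial in `ρ` by means of the quadratic equation.
  have hρ₃ : (349 + 85 * Real.sqrt 17) / 32 = (5 * ρ + 4) * ρ ^ 3 := by
    have e : (349 + 85 * Real.sqrt 17) / 32 = (85 * ρ + 66) / 8 := by rw [hρ]; ring
    rw [e]
    linear_combination (-(5 / 2) * ρ ^ 2 - 13 / 4 * ρ - 33 / 8) * hρ₂
  refine ⟨exists_tree_of_order_eq hκ_mono hκ_sublinear hκ_solve, ⟨by rw [hρ]; linarith,
    by linarith, fun B c => ?_⟩, exists_tree_polynomial hκ_mono hκ_sublinear hκ_solve⟩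
  -- The given `c` may be negative, so the estimate is applied to `max c 0`.
  obtain ⟨C, τ₀, h⟩ := exists_tree_of_order_near.{u, v} hκ_mono hκ_solve (ρ := ρ)
    (by rw [hρ]; linarith) hρ₂ B (le_max_right c 0)
  refine ⟨C, τ₀, fun L F r => ?_⟩
  obtain ⟨T, hT⟩ := h L F r
  refine ⟨T, fun H h₁ h₂ h₃ h₄ => ?_⟩
  rw [hρ₃]
  exact hT H h₁ h₂ h₃ (h₄.trans (le_max_left _ _))

end
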